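/- Let $\mathcal{M}=(a_{ij})$ be an $N\times n$ complex matrix such that each entry either vanishes or has positive real part, and no row vanishes. Let $Z$ be the largest number of vanishing entries in a row of $\mathcal{M}$, so $0\le Z<n$. For $w\in D:=\{w\in\mathbb{C}^n \mid \mathrm{Re}(w_j)>0,\ 1\le j\le n\}$ let $$\zeta_{N,n}(s,w,\mathcal{M}):=\sum_{k_1,\ldots,k_N=0}^{\infty}\ \prod_{j=1}^n\Big(w_j+\sum_{i=1}^N k_ia_{ij}\Big)^{-s},\qquad \mathcal{Z}_{N,n}(s,w,\mathcal{M}):=\int_{(0,\infty)^N}\ \prod_{j=1}^n\Big(w_j+\sum_{i=1}^N t_ia_{ij}\Big)^{-s}dt\qquad\Big(\mathrm{Re}(s)>\frac{N}{n-Z}\Big),$$ with principal powers, and denote by the same symbols their meromorphic continuations in $s$ to $\mathbb{C}$ (with removable singularities removed). Put $\zeta_{0,n}(s,w):=\prod_{j=1}^n w_j^{-s}$, let $W(x):=\sum_{i=1}^N x_i\mathcal{M}_i\in\mathbb{C}^n$ for $x\in\mathbb{C}^N$, where $\mathcal{M}_i$ is the $i$-th row of $\mathcal{M}$, and let $(\Delta_{e_i}f)(x):=f(x+e_i)-f(x)$,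 where $e_1,\ldots,e_N$ is the standard basis. Let $P$ be the set of rational numbers $\tilde s=a/b\le N/(n-Z)$ with $a,b\in\mathbb{Z}$, $n-Z\le b\le n$, $\tilde s\notin\{0,-1,-2,\ldots\}$, that are a pole of $s\mapsto\zeta_{N,n}(s,w,\mathcal{M})$ for at least one $w\in D$. Let $s\in\mathbb{C}\setminus P$, and let $x\in\mathbb{C}^N$ satisfy $\mathrm{Re}(x_i)>0$ $(1\le i\le N)$ and $\mathrm{Re}(W(x)_j)>0$ $(1\le j\le n)$. (The second condition follows from the first if $\mathcal{M}$ or $x$ is real and no column of $\mathcal{M}$ vanishes.) Then $\zeta_{N,n}(\,\cdot\,,W(x),\mathcal{M})$ and $\mathcal{Z}_{N,n}(\,\cdot\,,W(x),\mathcal{M})$ are regular at $s$, the function $t\mapsto\zeta_{N,n}(s,W(x+t),\mathcal{M})$ is integrable on $[0,1]^N$, and $$\int_{[0,1]^N}\zeta_{N,n}\big(s,W(x+t),\mathcal{M}\big)\,dt=\mathcal{Z}_{N,n}\big(s,W(x),\mathcal{M}\big)\qquad\text{(Raabe formula)}.$$ Moreover, $y\mapsto\mathcal{Z}_{N,n}(s,W(y),\mathcal{M})$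 is analytic at $y=x$, and $$\frac{\partial^N\mathcal{Z}_{N,n}\big(s,W(x),\mathcal{M}\big)}{\partial x_1\partial x_2\cdots\partial x_N}=\big(\Delta_{e_1}\circ\Delta_{e_2}\circ\cdots\circ\Delta_{e_N}\big)\big(\zeta_{N,n}(s,W(x),\mathcal{M})\big)=(-1)^N\prod_{j=1}^n\Big(\sum_{i=1}^N x_ia_{ij}\Big)^{-s}=(-1)^N\zeta_{0,n}\big(s,W(x)\big).$$ -/

import Mathlib

noncomputable section

namespace ShintaniBarnes

/-- `g` is the meromorphic continuation to `ℂ` of `f`, a function given on the half-plane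
`Re s > σ`. The normal form fixes the values: `g` is analytic wherever it has no pole
(removable singularities are removed) and takes the value `0` at its poles. -/
def IsMeromorphicContinuation (f : ℂ → ℂ) (σ : ℝ) (g : ℂ → ℂ) : Prop :=
  MeromorphicNFOn g Set.univ ∧ ∀ s : ℂ, σ < s.re → g s = f s

/-- A meromorphic continuation, in normal form, is unique. -/
theorem IsMeromorphicContinuation.unique {f : ℂ → ℂ} {σ : ℝ} {g h : ℂ → ℂ}
    (hg : IsMeromorphicContinuation f σ g) (hh : IsMeromorphicContinuation f σ h) : g = h := by
  have hd : MeromorphicOn (g - h) Set.univ := hg.1.meromorphicOn.sub hh.1.meromorphicOn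
  have hU : IsOpen {s : ℂ | σ < s.re} := isOpen_lt continuous_const Complex.continuous_re
  have h0 : meromorphicOrderAt (g - h) ((σ + 1 : ℝ) : ℂ) = ⊤ := by
    rw [meromorphicOrderAt_eq_top_iff]
    refine Filter.Eventually.filter_mono nhdsWithin_le_nhds ?_
    filter_upwards [hU.mem_nhds (show σ < (((σ + 1 : ℝ) : ℂ)).re by simp)] with z hz
    simp [hg.2 z hz, hh.2 z hz]
  funext z
  have hz : meromorphicOrderAt (g - h) z = ⊤ := by
    by_contra hne
    exact hd.meromorphicOrderAt_ne_top_of_isPreconnected isPreconnected_univ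
      (Set.mem_univ z) (Set.mem_univ _) hne h0
  rw [meromorphicOrderAt_eq_top_iff] at hz
  refine (((hg.1 (Set.mem_univ z)).eventuallyEq_nhdsNE_iff_eventuallyEq_nhds
    (hh.1 (Set.mem_univ z))).1 ?_).eq_of_nhds
  filter_upwards [hz] with y hy
  exact sub_eq_zero.1 hy

open Classical in
/-- The meromorphic continuation to `ℂ` of a function `f` given on the half-plane `Re s > σ`
(the zero function if there is none). -/
def meromorphicContinuation (f : ℂ → ℂ) (σ : ℝ) : ℂ → ℂ :=
  if h : ∃ g, IsMeromorphicContinuation f σ g then h.choose else 0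

variable {N n : ℕ}

/-- Each entry either vanishes or has positive real part, and no row vanishes. -/
structure HypothesisH (M : Matrix (Fin N) (Fin n) ℂ) : Prop where
  entry : ∀ i j, M i j = 0 ∨ 0 < (M i j).re
  row : ∀ i, ∃ j, M i j ≠ 0

/-- The largest number of vanishing entries in a row of `M`. -/
def maxZeros (M : Matrix (Fin N) (Fin n) ℂ) : ℕ :=
  Finset.univ.sup fun i : Fin N => (Finset.univ.filter fun j : Fin n => M i j = 0).card

/-- The abscissa `N / (n - Z)`, where `Z` is the largest number of zeros in a row of `M`. -/
def abscissa (M : Matrix (Fin N) (Fin n) ℂ) : ℝ :=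
  (N : ℝ) / ((n : ℝ) - (maxZeros M : ℝ))

/-- The Dirichlet series defining the zeta series in its half-plane of convergence. -/
def zetaSeries (M : Matrix (Fin N) (Fin n) ℂ) (s : ℂ) (w : Fin n → ℂ) : ℂ :=
  ∑' k : Fin N → ℕ, ∏ j, (w j + ∑ i, (k i : ℂ) * M i j) ^ (-s)

/-- The integral defining the zeta integral in its half-plane of convergence. -/
def zetaIntegral (M : Matrix (Fin N) (Fin n) ℂ) (s : ℂ) (w : Fin n → ℂ) : ℂ :=
  ∫ t : Fin N → ℝ in Set.univ.pi fun _ => Set.Ioi (0 : ℝ),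
    ∏ j, (w j + ∑ i, (t i : ℂ) * M i j) ^ (-s)

/-- The Shintani-Barnes zeta function `ζ_{N,n}(s, w, M)`, continued meromorphically in `s`. -/
def zeta (M : Matrix (Fin N) (Fin n) ℂ) (s : ℂ) (w : Fin n → ℂ) : ℂ :=
  meromorphicContinuation (fun z => zetaSeries M z w) (abscissa M) s

/-- The zeta integral `𝒵_{N,n}(s, w, M)`, continued meromorphically in `s`. -/
def zetaInt (M : Matrix (Fin N) (Fin n) ℂ) (s : ℂ) (w : Fin n → ℂ) : ℂ :=
  meromorphicContinuation (fun z => zetaIntegral M z w) (abscissa M) s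

/-- `ζ_{0,n}(s, w) = ∏ j, w_j ^ (-s)`. -/
def zetaZero (s : ℂ) (w : Fin n → ℂ) : ℂ := ∏ j, w j ^ (-s)

/-- The set of poles of `ζ_{N,n}`: the rational numbers `a / b ≤ N / (n - Z)` with
`n - Z ≤ b ≤ n`, other than `0, -1, -2, …`, that are a pole of `s ↦ ζ_{N,n}(s, w, M)` for at least
one `w` with all `Re w_j > 0`. -/
def polarSet (M : Matrix (Fin N) (Fin n) ℂ) : Set ℂ :=
  {s | (∃ a b : ℤ, (n : ℤ) - (maxZeros M : ℤ) ≤ b ∧ b ≤ (n : ℤ) ∧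
          (a : ℝ) / (b : ℝ) ≤ abscissa M ∧ s = (a : ℂ) / (b : ℂ)) ∧
        (∀ l : ℕ, s ≠ -(l : ℂ)) ∧
        ∃ w : Fin n → ℂ, (∀ j, 0 < (w j).re) ∧ meromorphicOrderAt (fun z => zeta M z w) s < 0}

/-- `W(x) = ∑ i, x_i M_i`, where `M_i` is the `i`-th row of `M`. -/
def W (M : Matrix (Fin N) (Fin n) ℂ) (x : Fin N → ℂ) : Fin n → ℂ :=
  fun j => ∑ i, x i * M i j

/-- The mixed partial derivative `∂^N F / ∂x_1 ∂x_2 ⋯ ∂x_N`. -/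
def mixedPartial (F : (Fin N → ℂ) → ℂ) : (Fin N → ℂ) → ℂ :=
  (List.finRange N).foldr (fun i G x => lineDeriv ℂ G x (Pi.single i 1)) F

/-- The iterated difference `Δ_{e_1} ∘ Δ_{e_2} ∘ ⋯ ∘ Δ_{e_N}` applied to `F`, where
`(Δ_e F)(x) = F (x + e) - F x`. -/
def mixedDifference (F : (Fin N → ℂ) → ℂ) : (Fin N → ℂ) → ℂ :=
  (List.finRange N).foldr (fun i G => fwdDiff (Pi.single i 1) G) F

end ShintaniBarnes

end

/-! For Re s beyond the abscissa the theorem is elementary. Replacing w by w + ∑ t_i M_i and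
integrating over the unit cube turns the sum over k into the integral over all cubes k + (0,1]^N,
that is, over (0,∞)^N: this is Raabe's formula (`HypothesisH.setIntegral_zetaSeries`). Each
difference Δ_{e_i} telescopes the sum in k_i and leaves minus the part with k_i = 0, so that N
differences leave (-1)^N times the term k = 0 (`mixedDifference_tsum`). By the fundamental theorem
of calculus, ∂/∂x_i of an average over a unit interval in direction i is Δ_{e_i}; hence the mixed
derivative of the cube average of zeta is the mixed difference of zeta (`mixedPartial_cubeAverage`).

The substance is the passage to arbitrary s outside the polar set. It requires a continuation of
zeta that is holomorphic jointly in (s, w) near such s (`HypothesisH.exists_differentiableOn_zeta`),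
with control of the possible poles uniformly in w. The start is the Mellin representation: Γ(s)^n
ζ(s,w) is the integral over the positive orthant of ∏ y_j^(s-1) · ∏ (1 - e^(-L_i(y)))^(-1) ·
e^(-w·y), where L_i(y) = ∑ a_ij y_j (`HypothesisH.Gamma_pow_mul_zetaSeries`). Writing (1 -
e^(-v))^(-1) = v^(-1) todd(v) leaves powers of linear forms in the denominator.

Such an integral converges as soon as, for every nonempty set B of variables, |B| Re s plus the
order of vanishing along B (`excess`) is positive (`exists_dominating`). Integration by parts along
the scaling of the variables in A extracts a factor |A| s + e and raises the excess of A by one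
without lowering any other (`card_mul_add_excess_mul_intg`). An induction over sets of variables
makes all excesses large (`continuable_intg`). If A contains the support of a row, then n - Z ≤ |A|
≤ n, and the factor vanishes at a rational number with an admissible denominator. Otherwise a single
variable is used, and the factors vanish only at 0, -1, -2, …. There are n rounds, each with at most
a simple zero at each of these integers, and Γ(s)^(-n) absorbs them.

The remaining denominator R(s) does not depend on w and vanishes only at pole candidates. At a
candidate outside the polar set, zeta is regular in s for every w, and Cauchy's formula on a small
circle around s gives joint holomorphy. All identities then extend by the identity theorem. -/

open MeasureTheory Set Filter Topology

namespace ShintaniBarnes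

/-! ### Holomorphic functions of several variables: Cauchy estimates and parameter integrals -/

section Holomorphic

variable {V F : Type*} [NormedAddCommGroup V] [NormedSpace ℂ V]
  [NormedAddCommGroup F] [NormedSpace ℂ F]

theorem hasDerivAt_comp_line {f : V → F} {x : V} (hf : DifferentiableAt ℂ f x) (v : V) :
    HasDerivAt (fun z : ℂ => f (x + z • v)) (fderiv ℂ f x v) 0 := by
  have h1 : HasDerivAt (fun z : ℂ => x + z • v) v 0 := by
    simpa using ((hasDerivAt_id (0 : ℂ)).smul_const v).const_add x
  have h2 : HasFDerivAt f (fderiv ℂ f x) (x + (0 : ℂ) • v) := by simpa using hf.hasFDerivAt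
  exact h2.comp_hasDerivAt 0 h1

theorem differentiableOn_comp_line {f : V → F} {U : Set V} (hf : DifferentiableOn ℂ f U)
    (x v : V) : DifferentiableOn ℂ (fun z : ℂ => f (x + z • v)) {z : ℂ | x + z • v ∈ U} := by
  refine hf.comp ?_ fun z hz => hz
  exact ((differentiable_id.smul_const v).const_add x).differentiableOn

/-- Cauchy's estimate for the Fréchet derivative. -/
theorem norm_fderiv_le_of_ball {f : V → F} {x : V} {r C : ℝ} (hr : 0 < r)
    (hf : DifferentiableOn ℂ f (Metric.ball x r)) (hC : ∀ y ∈ Metric.ball x r, ‖f y‖ ≤ C) :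
    ‖fderiv ℂ f x‖ ≤ C / r := by
  have hC0 : 0 ≤ C := (norm_nonneg _).trans (hC x (Metric.mem_ball_self hr))
  -- The one-variable Cauchy estimate on the complex line through x in direction v.
  have key : ∀ v : V, ∀ ρ : ℝ, 0 < ρ → ρ * ‖v‖ < r → ‖fderiv ℂ f x v‖ ≤ C / ρ := by
    intro v ρ hρ hv
    have hx := hf.differentiableAt (Metric.ball_mem_nhds x hr)
    rw [← (hasDerivAt_comp_line hx v).deriv]
    have hsub : Metric.closedBall (0 : ℂ) ρ ⊆ {z : ℂ | x + z • v ∈ Metric.ball x r} := by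
      intro z hz
      have hz' : ‖z‖ ≤ ρ := by simpa using hz
      have : ‖z • v‖ < r := by
        rw [norm_smul]
        exact (mul_le_mul_of_nonneg_right hz' (norm_nonneg v)).trans_lt hv
      simpa [dist_eq_norm] using this
    have hd : DifferentiableOn ℂ (fun z : ℂ => f (x + z • v)) (Metric.closedBall 0 ρ) :=
      (differentiableOn_comp_line hf x v).mono hsub
    refine Complex.norm_deriv_le_of_forall_mem_sphere_norm_le hρ ?_ fun z hz => ?_
    · refine ⟨hd.mono Metric.ball_subset_closedBall, ?_⟩
      rw [closure_ball (0 : ℂ) hρ.ne']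
      exact hd.continuousOn
    · exact hC _ (hsub (Metric.sphere_subset_closedBall hz))
  refine ContinuousLinearMap.opNorm_le_bound _ (by positivity) fun v => ?_
  rcases eq_or_ne v 0 with rfl | hv
  · simp
  have hv' : 0 < ‖v‖ := norm_pos_iff.2 hv
  -- The extremal radius r/‖v‖ itself is excluded, because f is only controlled on the open ball; it
  -- is reached as a limit.
  have hlim : Tendsto (fun ρ : ℝ => C / ρ) (𝓝[<] (r / ‖v‖)) (𝓝 (C / (r / ‖v‖))) :=
    ((continuousAt_const.div continuousAt_id (div_pos hr hv').ne').tendsto).mono_left nhdsWithin_le_nhds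
  have : ‖fderiv ℂ f x v‖ ≤ C / (r / ‖v‖) := by
    refine ge_of_tendsto hlim ?_
    filter_upwards [Ioo_mem_nhdsLT (show (0 : ℝ) < r / ‖v‖ by positivity)] with ρ hρ
    exact key v ρ hρ.1 ((lt_div_iff₀ hv').1 hρ.2)
  calc ‖fderiv ℂ f x v‖ ≤ C / (r / ‖v‖) := this
    _ = C / r * ‖v‖ := by field_simp

variable [FiniteDimensional ℂ V]

/-- Reduces measurability and holomorphy of an operator-valued derivative to those of its finitely
many values on a basis. -/
theorem clm_eq_sum_basis (L : V →L[ℂ] F) :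
    L = ∑ i, (((Module.finBasis ℂ V).coord i).toContinuousLinearMap).smulRight
      (L (Module.finBasis ℂ V i)) := by
  ext v
  conv_lhs => rw [← (Module.finBasis ℂ V).sum_repr v]
  simp only [map_sum, map_smul]
  simp

/-- A locally dominated integral of holomorphic functions is holomorphic. -/
theorem differentiableOn_integral_of_dominated {α : Type*} [MeasurableSpace α] {μ : Measure α}
    {U : Set V} (hU : IsOpen U) {f : V → α → F}
    (hm : ∀ x ∈ U, AEStronglyMeasurable (f x) μ)
    (hd : ∀ᵐ a ∂μ, DifferentiableOn ℂ (fun x => f x a) U)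
    (hb : ∀ x ∈ U, ∃ ε > 0, ∃ g : α → ℝ, Integrable g μ ∧
      ∀ᵐ a ∂μ, ∀ y ∈ Metric.ball x ε, ‖f y a‖ ≤ g a) :
    DifferentiableOn ℂ (fun x => ∫ a, f x a ∂μ) U := by
  intro x hx
  obtain ⟨ε, hε, g, hg, hfg⟩ := hb x hx
  obtain ⟨δ, hδ, hδU⟩ := Metric.isOpen_iff.1 hU x hx
  -- Half the radius: a ball of radius r around any point of the r-ball at x stays where f is
  -- dominated and holomorphic, so Cauchy's estimate dominates the derivative by g / r.
  set r := min ε δ / 2 with hr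
  have hr0 : 0 < r := by positivity
  have hsub : ∀ y ∈ Metric.ball x r, Metric.ball y r ⊆ Metric.ball x ε ∩ Metric.ball x δ := by
    intro y hy z hz
    have : dist z x < min ε δ := by
      have h1 : dist z y < r := hz
      have h2 : dist y x < r := hy
      linarith [dist_triangle z y x]
    exact ⟨this.trans_le (min_le_left _ _), this.trans_le (min_le_right _ _)⟩
  -- Directional derivatives are limits of difference quotients along 1/(k+1); the shift by k₀ keeps
  -- the points in U, where measurability is given.
  have hmeas : AEStronglyMeasurable (fun a => fderiv ℂ (fun x => f x a) x) μ := by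
    have hdir : ∀ v : V, AEStronglyMeasurable (fun a => fderiv ℂ (fun x => f x a) x v) μ := by
      intro v
      have hlim : Tendsto (fun k : ℕ => ((1 : ℂ) / ((k : ℂ) + 1))) atTop (𝓝[≠] 0) := by
        refine tendsto_nhdsWithin_iff.2 ⟨tendsto_one_div_add_atTop_nhds_zero_nat, ?_⟩
        refine Eventually.of_forall fun k => ?_
        simp only [mem_compl_iff, mem_singleton_iff]
        exact one_div_ne_zero (Nat.cast_add_one_ne_zero k)
      have hline : Tendsto (fun k : ℕ => x + ((1 : ℂ) / ((k : ℂ) + 1)) • v) atTop (𝓝 x) := by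
        have := (((tendsto_nhdsWithin_iff.1 hlim).1).smul_const v).const_add x
        simpa using this
      obtain ⟨k₀, hk₀⟩ := eventually_atTop.1 (hline.eventually (hU.mem_nhds hx))
      refine aestronglyMeasurable_of_tendsto_ae atTop
        (f := fun (k : ℕ) a => ((1 : ℂ) / (((k + k₀ : ℕ) : ℂ) + 1))⁻¹ •
          (f (x + ((1 : ℂ) / (((k + k₀ : ℕ) : ℂ) + 1)) • v) a - f x a)) (fun k => ?_) ?_
      · exact ((hm _ (hk₀ _ (Nat.le_add_left _ _))).sub (hm x hx)).const_smul _
      · filter_upwards [hd] with a ha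
        have := hasDerivAt_iff_tendsto_slope_zero.1
          (hasDerivAt_comp_line (ha.differentiableAt (hU.mem_nhds hx)) v)
        have := (this.comp hlim).comp (tendsto_add_atTop_nat k₀)
        simpa [Function.comp_def] using this
    have heq : (fun a => fderiv ℂ (fun x => f x a) x) = fun a =>
        ∑ i, (((Module.finBasis ℂ V).coord i).toContinuousLinearMap).smulRight
          (fderiv ℂ (fun x => f x a) x (Module.finBasis ℂ V i)) := by
      funext a
      exact clm_eq_sum_basis _
    rw [heq]
    refine Finset.aestronglyMeasurable_fun_sum _ fun i _ => ?_
    exact (ContinuousLinearMap.smulRightL ℂ V F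
      (((Module.finBasis ℂ V).coord i).toContinuousLinearMap)).continuous.comp_aestronglyMeasurable
        (hdir _)
  refine (hasFDerivAt_integral_of_dominated_of_fderiv_le (𝕜 := ℂ)
    (F' := fun y a => fderiv ℂ (fun x => f x a) y) (bound := fun a => g a / r)
    (Metric.ball_mem_nhds x hr0) ?_ ?_ hmeas ?_ (hg.div_const r) ?_
    ).differentiableAt.differentiableWithinAt
  · filter_upwards [hU.mem_nhds hx] with y hy using hm y hy
  · refine hg.mono' (hm x hx) ?_
    filter_upwards [hfg] with a ha using ha x (Metric.mem_ball_self hε)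
  · filter_upwards [hfg, hd] with a ha hda y hy
    refine norm_fderiv_le_of_ball hr0 (hda.mono fun z hz => hδU (hsub y hy hz).2) ?_
    exact fun z hz => ha z (hsub y hy hz).1
  · filter_upwards [hd] with a hda y hy
    have hyU : y ∈ U := hδU (hsub y hy (Metric.mem_ball_self hr0)).2
    exact (hda.differentiableAt (hU.mem_nhds hyU)).hasFDerivAt

/-- An integral over a compact set of a jointly continuous function that is holomorphic in the
parameter is holomorphic. -/
theorem differentiableOn_integral_of_compact {α : Type*} [MeasurableSpace α] [TopologicalSpace α]
    [OpensMeasurableSpace α] [SecondCountableTopologyEither α F] {μ : Measure α}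
    {K : Set α} (hK : IsCompact K) (hKm : MeasurableSet K) (hμ : μ K ≠ ⊤)
    {U : Set V} (hU : IsOpen U) {f : V → α → F}
    (hc : ContinuousOn (fun q : V × α => f q.1 q.2) (U ×ˢ K))
    (hd : ∀ a ∈ K, DifferentiableOn ℂ (fun x => f x a) U) :
    DifferentiableOn ℂ (fun x => ∫ a in K, f x a ∂μ) U := by
  have : ProperSpace V := FiniteDimensional.proper ℂ V
  refine differentiableOn_integral_of_dominated hU (fun x hx => ?_) ?_ fun x hx => ?_
  · refine ContinuousOn.aestronglyMeasurable ?_ hKm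
    exact hc.comp (f := fun a => (x, a)) (by fun_prop) fun a ha => ⟨hx, ha⟩
  · exact (ae_restrict_iff' hKm).2 (Eventually.of_forall hd)
  · obtain ⟨ε, hε, hεU⟩ := Metric.nhds_basis_closedBall.mem_iff.1 (hU.mem_nhds hx)
    obtain ⟨C, hC⟩ := ((isCompact_closedBall x ε).prod hK).exists_bound_of_continuousOn
      (hc.mono (prod_mono hεU subset_rfl))
    refine ⟨ε, hε, fun _ => C, ?_, ?_⟩
    · exact integrableOn_const hμ
    · refine (ae_restrict_iff' hKm).2 (Eventually.of_forall fun a ha y hy => ?_)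
      exact hC (y, a) ⟨Metric.ball_subset_closedBall hy, ha⟩

variable [CompleteSpace F]

/-- The Fréchet derivative of a holomorphic function is holomorphic. -/
theorem differentiableOn_fderiv {f : V → F} {U : Set V} (hU : IsOpen U)
    (hf : DifferentiableOn ℂ f U) : DifferentiableOn ℂ (fderiv ℂ f) U := by
  have hdir : ∀ v : V, DifferentiableOn ℂ (fun x => fderiv ℂ f x v) U := by
    intro v x hx
    obtain ⟨δ, hδ, hδU⟩ := Metric.isOpen_iff.1 hU x hx
    set ρ : ℝ := δ / 2 / (‖v‖ + 1) with hρ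
    have hρ0 : 0 < ρ := by positivity
    have hmem : ∀ y ∈ Metric.ball x (δ / 2), ∀ z : ℂ, ‖z‖ ≤ ρ → y + z • v ∈ U := by
      intro y hy z hz
      apply hδU
      have h1 : ‖y - x‖ < δ / 2 := by simpa [dist_eq_norm] using hy
      have h2 : ‖z • v‖ ≤ δ / 2 := by
        rw [norm_smul]
        calc ‖z‖ * ‖v‖ ≤ ρ * (‖v‖ + 1) := by gcongr; linarith
          _ = δ / 2 := by rw [hρ]; field_simp
      rw [Metric.mem_ball, dist_eq_norm, add_sub_right_comm]
      linarith [norm_add_le (y - x) (z • v)]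
    -- The Cauchy integral for the derivative in direction v. The base point y enters only through
    -- f, so the integral is holomorphic in y.
    have hI : DifferentiableOn ℂ (fun y => ∫ θ in Icc 0 (2 * Real.pi),
        deriv (circleMap 0 ρ) θ • (((circleMap 0 ρ θ - 0) ^ 2)⁻¹ • f (y + circleMap 0 ρ θ • v)))
        (Metric.ball x (δ / 2)) := by
      refine differentiableOn_integral_of_compact isCompact_Icc measurableSet_Icc
        isCompact_Icc.measure_ne_top Metric.isOpen_ball ?_ fun θ _ => ?_
      · refine ContinuousOn.smul ?_ (ContinuousOn.smul ?_ ?_)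
        · simp only [deriv_circleMap]
          fun_prop
        · refine ContinuousOn.inv₀ (by fun_prop) fun q _ => ?_
          simp [hρ0.ne']
        · refine hf.continuousOn.comp (by fun_prop) fun q hq => ?_
          exact hmem _ hq.1 _ (by simp [abs_of_pos hρ0])
      · refine (DifferentiableOn.const_smul ?_ _).const_smul _
        refine hf.comp (by fun_prop) fun y hy => ?_
        exact hmem _ hy _ (by simp [abs_of_pos hρ0])
    have heq : EqOn (fun x => fderiv ℂ f x v) (fun y => (2 * (Real.pi : ℂ) * Complex.I)⁻¹ •
        ∫ θ in Icc 0 (2 * Real.pi), deriv (circleMap 0 ρ) θ •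
          (((circleMap 0 ρ θ - 0) ^ 2)⁻¹ • f (y + circleMap 0 ρ θ • v)))
        (Metric.ball x (δ / 2)) := by
      intro y hy
      have hyU : y ∈ U := by simpa using hmem y hy 0 (by simpa using hρ0.le)
      have hopen : IsOpen {z : ℂ | y + z • v ∈ U} := hU.preimage (by fun_prop)
      have h := Complex.two_pi_I_inv_smul_circleIntegral_sub_sq_inv_smul_of_differentiable
        hopen (c := 0) (w₀ := 0) (R := ρ) (f := fun z : ℂ => f (y + z • v))
        (fun z hz => hmem y hy z (by simpa using hz)) (differentiableOn_comp_line hf y v)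
        (Metric.mem_ball_self hρ0)
      rw [(hasDerivAt_comp_line (hf.differentiableAt (hU.mem_nhds hyU)) v).deriv] at h
      simp only
      rw [← h, circleIntegral, intervalIntegral.integral_of_le (by positivity),
        integral_Icc_eq_integral_Ioc]
    have := ((hI.const_smul ((2 * (Real.pi : ℂ) * Complex.I)⁻¹)).congr heq).differentiableAt
      (Metric.ball_mem_nhds x (by positivity))
    exact this.differentiableWithinAt
  have heq : fderiv ℂ f = fun x =>
      ∑ i, ContinuousLinearMap.smulRightL ℂ V F
        (((Module.finBasis ℂ V).coord i).toContinuousLinearMap)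
        (fderiv ℂ f x (Module.finBasis ℂ V i)) := by
    funext a
    exact clm_eq_sum_basis _
  rw [heq]
  refine DifferentiableOn.fun_sum fun i _ => ?_
  exact (ContinuousLinearMap.differentiable _).comp_differentiableOn (hdir _)

end Holomorphic

/-! ### Holomorphic functions in finite dimension are analytic -/

section Analytic

/-- Induction through the derivative, which is again holomorphic. The target is quantified inside
because it changes from F to V →L[ℂ] F at each step. -/
theorem contDiffOn_nat_of_differentiableOn {V : Type} [NormedAddCommGroup V] [NormedSpace ℂ V]
    [FiniteDimensional ℂ V] {U : Set V} (hU : IsOpen U) (k : ℕ) :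
    ∀ (F : Type) [NormedAddCommGroup F] [NormedSpace ℂ F] [CompleteSpace F] (f : V → F),
      DifferentiableOn ℂ f U → ContDiffOn ℂ k f U := by
  induction k with
  | zero =>
    intro F _ _ _ f hf
    exact contDiffOn_zero.2 hf.continuousOn
  | succ k ih =>
    intro F _ _ _ f hf
    have h := ih _ _ (differentiableOn_fderiv hU hf)
    push_cast
    exact (contDiffOn_succ_iff_fderiv_of_isOpen hU).2 ⟨hf, by simp, h⟩

/-- Cauchy's estimate applied k times, each time shrinking the radius by h and paying a factor 1/h.
-/
theorem norm_iteratedFDeriv_le_of_ball {V : Type} [NormedAddCommGroup V] [NormedSpace ℂ V]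
    [FiniteDimensional ℂ V] {h : ℝ} (hh : 0 < h) (k : ℕ) :
    ∀ (F : Type) [NormedAddCommGroup F] [NormedSpace ℂ F] [CompleteSpace F] (f : V → F) (x : V)
      (C : ℝ), DifferentiableOn ℂ f (Metric.ball x ((k + 1) * h)) →
      (∀ y ∈ Metric.ball x ((k + 1) * h), ‖f y‖ ≤ C) → ‖iteratedFDeriv ℂ k f x‖ ≤ C / h ^ k := by
  induction k with
  | zero =>
    intro F _ _ _ f x C _ hC
    simpa using hC x (Metric.mem_ball_self (by simpa using hh))
  | succ k ih =>
    intro F _ _ _ f x C hf hC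
    rw [← norm_iteratedFDeriv_fderiv]
    push_cast at hf hC
    have hsub : ∀ y ∈ Metric.ball x ((k + 1) * h),
        Metric.ball y h ⊆ Metric.ball x ((k + 1 + 1) * h) := by
      intro y hy
      refine Metric.ball_subset_ball' ?_
      have : dist y x < (k + 1) * h := hy
      linarith
    have := ih _ (fderiv ℂ f) x (C / h) ((differentiableOn_fderiv Metric.isOpen_ball hf).mono
      (Metric.ball_subset_ball (by nlinarith))) fun y hy =>
      norm_fderiv_le_of_ball hh (hf.mono (hsub y hy)) fun z hz => hC z (hsub y hy hz)
    calc _ ≤ C / h / h ^ k := this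
      _ = C / h ^ (k + 1) := by rw [pow_succ]; field_simp

/-- In finite dimension, a holomorphic function is analytic. -/
theorem analyticAt_of_differentiableOn {V F : Type} [NormedAddCommGroup V] [NormedSpace ℂ V]
    [FiniteDimensional ℂ V] [NormedAddCommGroup F] [NormedSpace ℂ F] [CompleteSpace F]
    {f : V → F} {U : Set V} (hU : IsOpen U) (hf : DifferentiableOn ℂ f U) {x : V} (hx : x ∈ U) :
    AnalyticAt ℂ f x := by
  have : ProperSpace V := FiniteDimensional.proper ℂ V
  obtain ⟨R, hR, hRU⟩ := Metric.nhds_basis_closedBall.mem_iff.1 (hU.mem_nhds hx)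
  obtain ⟨C, hC⟩ := (isCompact_closedBall x R).exists_bound_of_continuousOn
    (hf.continuousOn.mono hRU)
  have hfR : DifferentiableOn ℂ f (Metric.ball x R) :=
    hf.mono (Metric.ball_subset_closedBall.trans hRU)
  have hC0 : 0 ≤ C := (norm_nonneg _).trans (hC x (Metric.mem_closedBall_self hR.le))
  let p : FormalMultilinearSeries ℂ V F := fun k => ((k.factorial : ℂ)⁻¹) • iteratedFDeriv ℂ k f x
  -- With h = R/(k+1) the k-th coefficient is at most C (k+1)^k / (k! R^k), which is at most C
  -- e^(k+1) / R^k; on the radius R e^(-2) the terms are bounded by C e.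
  obtain ⟨r, hr⟩ : ∃ r : NNReal, (r : ℝ) = R * Real.exp (-2) :=
    ⟨(R * Real.exp (-2)).toNNReal, Real.coe_toNNReal _ (by positivity)⟩
  have hr0 : 0 < (r : ℝ) := by rw [hr]; positivity
  have hrR : (r : ℝ) < R := by
    rw [hr]
    exact mul_lt_of_lt_one_right hR (Real.exp_lt_one_iff.2 (by norm_num))
  refine ⟨p, r, ⟨?_, by exact_mod_cast hr0, ?_⟩⟩
  · refine p.le_radius_of_bound (C * Real.exp 1) fun k => ?_
    have hk : (0 : ℝ) < k + 1 := by positivity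
    have h1 := norm_iteratedFDeriv_le_of_ball (h := R / (k + 1)) (by positivity) k F f x C
      (by rwa [mul_div_cancel₀ _ hk.ne']) (fun y hy => hC y (Metric.ball_subset_closedBall (by
        rwa [mul_div_cancel₀ _ hk.ne'] at hy)))
    have h2 : ‖p k‖ ≤ (k.factorial : ℝ)⁻¹ * (C / (R / (k + 1)) ^ k) := by
      simp only [p, norm_smul, norm_inv, Complex.norm_natCast]
      gcongr
    have h3 : ((k : ℝ) + 1) ^ k / k.factorial ≤ Real.exp (k + 1) :=
      Real.pow_div_factorial_le_exp _ hk.le k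
    calc ‖p k‖ * (r : ℝ) ^ k ≤ (k.factorial : ℝ)⁻¹ * (C / (R / (k + 1)) ^ k) * (r : ℝ) ^ k := by
          gcongr
      _ = C * (((k : ℝ) + 1) ^ k / k.factorial) * Real.exp (-2) ^ k := by
          rw [hr, mul_pow, div_pow]
          field_simp
      _ ≤ C * Real.exp (k + 1) * Real.exp (-2) ^ k := by gcongr
      _ = C * Real.exp (1 - k) := by
          rw [mul_assoc, ← Real.exp_nat_mul, ← Real.exp_add]; ring_nf
      _ ≤ C * Real.exp 1 := by gcongr; linarith [(Nat.cast_nonneg k : (0 : ℝ) ≤ k)]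
  · intro v hv
    have hv' : ‖v‖ < R := by
      have : ‖v‖ < r := by
        rw [Metric.mem_eball, edist_zero_right] at hv
        exact_mod_cast hv
      exact this.trans hrR
    -- The expansion at x + v is the one-variable Taylor series of z ↦ f(x + z v) at z = 1, so a
    -- disc of radius larger than 1 has to map into the ball.
    obtain ⟨a, ha1, ha⟩ : ∃ a : ℝ, 1 < a ∧ a * ‖v‖ < R := by
      rcases eq_or_ne v 0 with rfl | hv0
      · exact ⟨2, by norm_num, by simpa using hR⟩
      · have hv0' : 0 < ‖v‖ := norm_pos_iff.2 hv0
        obtain ⟨a, h1, h2⟩ := exists_between ((one_lt_div hv0').2 hv')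
        exact ⟨a, h1, (lt_div_iff₀ hv0').1 h2⟩
    set L : ℂ →L[ℂ] V := (ContinuousLinearMap.id ℂ ℂ).smulRight v with hL
    set g : V → F := fun u => f (x + u) with hg
    have hgd : DifferentiableOn ℂ g (Metric.ball 0 R) := by
      refine hfR.comp (by fun_prop) fun u hu => ?_
      simpa [dist_eq_norm] using hu
    have hline : DifferentiableOn ℂ (g ∘ L) (Metric.ball 0 a) := by
      refine hgd.comp L.differentiable.differentiableOn fun z hz => ?_
      have hz' : ‖z‖ < a := by simpa using hz
      have : ‖z‖ * ‖v‖ ≤ a * ‖v‖ := by gcongr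
      simpa [hL, norm_smul] using this.trans_lt ha
    have h := Complex.hasSum_taylorSeries_on_ball hline (z := 1) (by simpa using ha1)
    have hterm : ∀ k : ℕ, iteratedDeriv k (g ∘ L) 0 = iteratedFDeriv ℂ k f x fun _ => v := by
      intro k
      have hopen : IsOpen (L ⁻¹' Metric.ball 0 R) := Metric.isOpen_ball.preimage L.continuous
      have h0 : L 0 ∈ Metric.ball (0 : V) R := by simpa using hR
      have h1 := L.iteratedFDerivWithin_comp_right
        (contDiffOn_nat_of_differentiableOn Metric.isOpen_ball k F g hgd)
        Metric.isOpen_ball.uniqueDiffOn hopen.uniqueDiffOn (x := 0) h0 (i := k) le_rfl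
      rw [iteratedFDerivWithin_of_isOpen k hopen h0,
        iteratedFDerivWithin_of_isOpen k Metric.isOpen_ball h0] at h1
      rw [iteratedDeriv_eq_iteratedFDeriv, h1]
      simp [hg, iteratedFDeriv_comp_add_left, hL]
    simp only [hterm] at h
    simpa [hg, hL, p] using h

end Analytic

end ShintaniBarnes

namespace ShintaniBarnes

/-! ### Uniqueness and gluing of meromorphic continuations -/

section Continuation

/-- Identity theorem for meromorphic functions on a half-plane. -/
theorem eventuallyEq_of_eq_halfPlane {g h : ℂ → ℂ} {a b : ℝ}
    (hg : MeromorphicOn g {s | a < s.re}) (hh : MeromorphicOn h {s | a < s.re})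
    (heq : ∀ s : ℂ, b < s.re → g s = h s) {z : ℂ} (hz : a < z.re) : g =ᶠ[𝓝[≠] z] h := by
  have hd : MeromorphicOn (g - h) {s | a < s.re} := hg.sub hh
  have hU : IsOpen {s : ℂ | b < s.re} := isOpen_lt continuous_const Complex.continuous_re
  have hm : a < ((max a b + 1 : ℝ) : ℂ).re := by
    rw [Complex.ofReal_re]; linarith [le_max_left a b]
  have hm' : b < ((max a b + 1 : ℝ) : ℂ).re := by
    rw [Complex.ofReal_re]; linarith [le_max_right a b]
  have h0 : meromorphicOrderAt (g - h) ((max a b + 1 : ℝ) : ℂ) = ⊤ := by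
    rw [meromorphicOrderAt_eq_top_iff]
    refine Filter.Eventually.filter_mono nhdsWithin_le_nhds ?_
    filter_upwards [hU.mem_nhds hm'] with z hz
    simp [heq z hz]
  have hz' : meromorphicOrderAt (g - h) z = ⊤ := by
    by_contra hne
    exact hd.meromorphicOrderAt_ne_top_of_isPreconnected
      (convex_halfSpace_re_gt a).isPreconnected hz hm hne h0
  rw [meromorphicOrderAt_eq_top_iff] at hz'
  filter_upwards [hz'] with y hy using sub_eq_zero.1 hy

/-- Continuations to the half-planes `Re s > -K` glue to a continuation to `ℂ`. -/
theorem exists_isMeromorphicContinuation {f : ℂ → ℂ} {σ : ℝ} {G : ℕ → ℂ → ℂ} {b : ℕ → ℝ}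
    (hf : AnalyticOnNhd ℂ f {s | σ < s.re})
    (hG : ∀ K : ℕ, MeromorphicOn (G K) {s | -(K : ℝ) < s.re})
    (heq : ∀ (K : ℕ) (s : ℂ), b K < s.re → G K s = f s) :
    ∃ g, IsMeromorphicContinuation f σ g := by
  have hopen : ∀ a : ℝ, IsOpen {s : ℂ | a < s.re} := fun a =>
    isOpen_lt continuous_const Complex.continuous_re
  have hindep : ∀ (K K' : ℕ) (z : ℂ), -(K : ℝ) < z.re → -(K' : ℝ) < z.re →
      toMeromorphicNFAt (G K) z =ᶠ[𝓝 z] toMeromorphicNFAt (G K') z := by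
    intro K K' z hz hz'
    apply toMeromorphicNFAt_eventuallyEq_nhds_congr
    have ha : max (-(K : ℝ)) (-(K' : ℝ)) < z.re := max_lt hz hz'
    refine eventuallyEq_of_eq_halfPlane (a := max (-(K : ℝ)) (-(K' : ℝ))) (b := max (b K) (b K'))
      (fun s hs => hG K s (max_lt_iff.1 (mem_ofPred.1 hs)).1)
      (fun s hs => hG K' s (max_lt_iff.1 (mem_ofPred.1 hs)).2) (fun s hs => ?_) ha
    rw [heq K s ((le_max_left _ _).trans_lt hs), heq K' s ((le_max_right _ _).trans_lt hs)]
  set k : ℂ → ℕ := fun z => ⌈|z.re|⌉₊ + 1 with hk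
  have hkz : ∀ z : ℂ, -(k z : ℝ) < z.re := by
    intro z
    have h1 : |z.re| ≤ ⌈|z.re|⌉₊ := Nat.le_ceil _
    have h2 := neg_abs_le z.re
    simp only [hk]
    push_cast
    linarith
  -- The value at z is taken from any G K with -K < Re z; by `hindep` the normal form at z does not
  -- depend on that choice.
  set g : ℂ → ℂ := fun z => toMeromorphicNFAt (G (k z)) z z with hg
  have hgK : ∀ K : ℕ, EqOn g (toMeromorphicNFOn (G K) {s | -(K : ℝ) < s.re})
      {s | -(K : ℝ) < s.re} := by
    intro K z hz
    rw [toMeromorphicNFOn_eq_toMeromorphicNFAt (hG K) hz]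
    exact (hindep (k z) K z (hkz z) hz).eq_of_nhds
  have hgNF : MeromorphicNFOn g univ := by
    intro z _
    rw [meromorphicNFAt_congr ((hgK (k z)).eventuallyEq_of_mem ((hopen _).mem_nhds (hkz z)))]
    exact meromorphicNFOn_toMeromorphicNFOn (G (k z)) _ (hkz z)
  refine ⟨g, hgNF, fun s hs => ?_⟩
  have h : g =ᶠ[𝓝[≠] s] f := by
    -- To the right of this bound `G 0` is available, equals f, and f is analytic, so passing to the
    -- normal form changes nothing.
    refine eventuallyEq_of_eq_halfPlane (a := σ) (b := max (max (b 0) 0) σ)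
      (fun s _ => hgNF.meromorphicOn s (mem_univ s))
      (fun s hs => (hf s hs).meromorphicAt) (fun z hz => ?_) hs
    have h1 : b 0 < z.re := ((le_max_left _ _).trans (le_max_left _ _)).trans_lt hz
    have h2 : -((0 : ℕ) : ℝ) < z.re := by
      simpa using ((le_max_right _ _).trans (le_max_left _ _)).trans_lt hz
    have h3 : σ < z.re := (le_max_right _ _).trans_lt hz
    have h4 : G 0 =ᶠ[𝓝 z] f := by
      filter_upwards [(hopen (b 0)).mem_nhds h1] with y hy using heq 0 y hy
    rw [hgK 0 h2, toMeromorphicNFOn_eq_toMeromorphicNFAt (hG 0) h2,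
      toMeromorphicNFAt_eq_self.2 ((meromorphicNFAt_congr h4).2 (hf z h3).meromorphicNFAt)]
    exact h4.eq_of_nhds
  exact (((hgNF (mem_univ s)).eventuallyEq_nhdsNE_iff_eventuallyEq_nhds
    (hf s hs).meromorphicNFAt).1 h).eq_of_nhds

theorem isMeromorphicContinuation_meromorphicContinuation {f : ℂ → ℂ} {σ : ℝ}
    (h : ∃ g, IsMeromorphicContinuation f σ g) :
    IsMeromorphicContinuation f σ (meromorphicContinuation f σ) := by
  rw [meromorphicContinuation, dif_pos h]
  exact h.choose_spec

end Continuation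

end ShintaniBarnes

namespace ShintaniBarnes

/-! ### Domination of monomials divided by maxima -/

section Exponents

/-- A Hall type condition on the exponents of a monomial divided by powers of maxima lets one
bound it by monomials with positive exponents. The statement is given in logarithmic form. -/
theorem exists_positive_exponents {n : ℕ} {ι : Type} [Fintype ι] (S : ι → Finset (Fin n))
    (hS : ∀ i, (S i).Nonempty) (α : Fin n → ℝ) (β : ι → ℕ) (A : Finset (Fin n))
    (hA : ∀ B ⊆ A, B.Nonempty → ∑ i with S i ⊆ B, (β i : ℝ) < ∑ j ∈ B, α j) :
    ∃ E : Finset (Fin n → ℝ), (∀ e ∈ E, (∀ j ∈ A, 0 < e j) ∧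
        ∑ j ∈ A, e j = ∑ j ∈ A, α j - ∑ i with S i ⊆ A, (β i : ℝ)) ∧
      ∀ ℓ : Fin n → ℝ, ∃ e ∈ E,
        ∑ j ∈ A, α j * ℓ j - ∑ i with S i ⊆ A, (β i : ℝ) * (S i).sup' (hS i) ℓ
          ≤ ∑ j ∈ A, e j * ℓ j := by
  classical
  induction A using Finset.strongInduction with
  | H A ih =>
    rcases A.eq_empty_or_nonempty with rfl | hne
    · have hempty : (Finset.univ.filter fun i : ι => S i ⊆ ∅) = ∅ := by
        refine Finset.filter_eq_empty_iff.2 fun i _ h => ?_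
        exact (hS i).ne_empty (Finset.subset_empty.1 h)
      refine ⟨{0}, fun e he => ?_, fun ℓ => ⟨0, Finset.mem_singleton_self 0, ?_⟩⟩
      · rw [hempty]; simp
      · rw [hempty]; simp
    · have hrec : ∀ j ∈ A, _ := fun j hj => ih (A.erase j) (Finset.erase_ssubset hj)
        fun B hB hB' => hA B (hB.trans (Finset.erase_subset _ _)) hB'
      choose! E hE1 hE2 using hrec
      set d : Finset (Fin n) → ℝ := fun B => ∑ j ∈ B, α j - ∑ i with S i ⊆ B, (β i : ℝ) with hd
      have hdA : 0 < d A := sub_pos.2 (hA A subset_rfl hne)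
      have hd' : ∀ j ∈ A, 0 ≤ d (A.erase j) := by
        intro j hj
        obtain ⟨e, he, -⟩ := hE2 j hj 0
        have h1 : ∑ j ∈ A.erase j, e j = d (A.erase j) := (hE1 j hj e he).2
        rw [← h1]
        exact Finset.sum_nonneg fun l hl => ((hE1 j hj e he).1 l hl).le
      -- If ℓ_j is the largest logarithm, the exponent left at j is d A - d (A.erase j), possibly
      -- negative. Since ℓ_l ≤ ℓ_j, the fraction 1 - θ of the other exponents may be moved to j;
      -- this θ makes the result d A - θ d (A.erase j) positive and keeps the others positive.
      set θ : Fin n → ℝ := fun j => d A / (d A + d (A.erase j)) with hθ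
      have hθpos : ∀ j ∈ A, 0 < θ j := fun j hj => div_pos hdA (by linarith [hd' j hj])
      have hθle : ∀ j ∈ A, θ j ≤ 1 := fun j hj =>
        (div_le_one (by linarith [hd' j hj])).2 (by linarith [hd' j hj])
      have hθd : ∀ j ∈ A, 0 < d A - θ j * d (A.erase j) := by
        intro j hj
        have h1 : 0 < d A + d (A.erase j) := by linarith [hd' j hj]
        have : d A - θ j * d (A.erase j) = d A * d A / (d A + d (A.erase j)) := by
          simp only [hθ]; field_simp; ring
        rw [this]; positivity
      -- The union runs over every candidate j for the largest variable, so that the finite set of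
      -- exponents does not depend on ℓ.
      refine ⟨A.biUnion fun j => (E j).image fun e =>
        Function.update (fun l => θ j * e l) j (d A - θ j * d (A.erase j)), ?_, ?_⟩
      · intro e he
        simp only [Finset.mem_biUnion, Finset.mem_image] at he
        obtain ⟨j, hj, e, he, rfl⟩ := he
        refine ⟨fun l hl => ?_, ?_⟩
        · rcases eq_or_ne l j with rfl | hlj
          · simpa using hθd l hj
          · rw [Function.update_of_ne hlj]
            exact mul_pos (hθpos j hj) ((hE1 j hj e he).1 l (Finset.mem_erase.2 ⟨hlj, hl⟩))
        · rw [← Finset.add_sum_erase A _ hj, Function.update_self]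
          have : ∑ l ∈ A.erase j, Function.update (fun l => θ j * e l) j
              (d A - θ j * d (A.erase j)) l = θ j * d (A.erase j) := by
            rw [show d (A.erase j) = ∑ l ∈ A.erase j, e l from (hE1 j hj e he).2.symm,
              Finset.mul_sum]
            exact Finset.sum_congr rfl fun l hl => by
              rw [Function.update_of_ne (Finset.ne_of_mem_erase hl)]
          rw [this]
          simp only [hd]
          ring
      · intro ℓ
        -- The maximum over any set that contains j is now ℓ_j; the sets that avoid j are covered by
        -- the induction hypothesis for A without j.
        obtain ⟨j, hj, hmax⟩ := A.exists_max_image ℓ hne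
        obtain ⟨e, he, hle⟩ := hE2 j hj ℓ
        refine ⟨_, Finset.mem_biUnion.2 ⟨j, hj, Finset.mem_image.2 ⟨e, he, rfl⟩⟩, ?_⟩
        have hsplit : ∀ f : ι → ℝ, ∑ i with S i ⊆ A, f i =
            ∑ i with S i ⊆ A.erase j, f i + ∑ i with S i ⊆ A ∧ j ∈ S i, f i := by
          intro f
          rw [← Finset.sum_union]
          · refine Finset.sum_congr ?_ fun _ _ => rfl
            ext i
            simp only [Finset.mem_filter, Finset.mem_univ, true_and, Finset.mem_union,
              Finset.subset_erase]
            tauto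
          · refine Finset.disjoint_filter.2 fun i _ h1 h2 => ?_
            exact (Finset.subset_erase.1 h1).2 h2.2
        have hsup : ∑ i with S i ⊆ A ∧ j ∈ S i, (β i : ℝ) * (S i).sup' (hS i) ℓ =
            (∑ i with S i ⊆ A ∧ j ∈ S i, (β i : ℝ)) * ℓ j := by
          rw [Finset.sum_mul]
          refine Finset.sum_congr rfl fun i hi => ?_
          simp only [Finset.mem_filter, Finset.mem_univ, true_and] at hi
          congr 1
          exact le_antisymm (Finset.sup'_le _ _ fun l hl => hmax l (hi.1 hl))
            (Finset.le_sup' ℓ hi.2)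
        rw [hsplit, hsup, ← Finset.add_sum_erase A _ hj, ← Finset.add_sum_erase A _ hj,
          Function.update_self]
        have hupd : ∑ l ∈ A.erase j, Function.update (fun l => θ j * e l) j
            (d A - θ j * d (A.erase j)) l * ℓ l = θ j * ∑ l ∈ A.erase j, e l * ℓ l := by
          rw [Finset.mul_sum]
          refine Finset.sum_congr rfl fun l hl => ?_
          rw [Function.update_of_ne (Finset.ne_of_mem_erase hl), mul_assoc]
        rw [hupd]
        have hγ : ∑ i with S i ⊆ A ∧ j ∈ S i, (β i : ℝ) = α j - (d A - d (A.erase j)) := by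
          simp only [hd]
          rw [hsplit, ← Finset.add_sum_erase A _ hj]
          ring
        rw [hγ]
        have hsum : ∑ l ∈ A.erase j, e l * ℓ l ≤ d (A.erase j) * ℓ j := by
          rw [show d (A.erase j) = ∑ l ∈ A.erase j, e l from (hE1 j hj e he).2.symm,
            Finset.sum_mul]
          exact Finset.sum_le_sum fun l hl => mul_le_mul_of_nonneg_left
            (hmax l (Finset.mem_of_mem_erase hl)) ((hE1 j hj e he).1 l hl).le
        have := mul_le_mul_of_nonneg_left hsum (sub_nonneg.2 (hθle j hj))
        nlinarith [hle, this]

end Exponents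

/-- The open positive orthant. -/
def orthant (n : ℕ) : Set (Fin n → ℝ) := univ.pi fun _ => Ioi 0

theorem mem_orthant {n : ℕ} {y : Fin n → ℝ} : y ∈ orthant n ↔ ∀ j, 0 < y j := by
  simp [orthant]

theorem isOpen_orthant (n : ℕ) : IsOpen (orthant n) :=
  isOpen_set_pi finite_univ fun _ _ => isOpen_Ioi

theorem measurableSet_orthant (n : ℕ) : MeasurableSet (orthant n) := (isOpen_orthant n).measurableSet

theorem volume_restrict_orthant (n : ℕ) :
    (volume : Measure (Fin n → ℝ)).restrict (orthant n) =
      Measure.pi fun _ => (volume : Measure ℝ).restrict (Ioi 0) := by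
  rw [orthant, volume_pi, Measure.restrict_pi_pi]

theorem integrableOn_orthant_monomial {n : ℕ} {e : Fin n → ℝ} (he : ∀ j, 0 < e j) {ε : ℝ}
    (hε : 0 < ε) :
    IntegrableOn (fun y : Fin n → ℝ => ∏ j, (y j ^ (e j - 1) * Real.exp (-ε * y j)))
      (orthant n) := by
  rw [IntegrableOn, volume_restrict_orthant]
  refine Integrable.fintype_prod (f := fun j (t : ℝ) => t ^ (e j - 1) * Real.exp (-ε * t))
    fun j => ?_
  have := integrableOn_rpow_mul_exp_neg_mul_rpow (p := 1) (s := e j - 1) (b := ε)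
    (by linarith [he j]) one_pos hε
  simpa [IntegrableOn] using this

/-- Pays for letting Re s range over an interval with a small part of the exponential decay. -/
theorem exists_one_add_rpow_le_exp (κ : ℝ) {δ : ℝ} (hδ : 0 < δ) :
    ∃ C : ℝ, 0 < C ∧ ∀ t : ℝ, 0 ≤ t → (1 + t) ^ κ ≤ C * Real.exp (δ * t) := by
  obtain ⟨k, hk⟩ := exists_nat_ge κ
  refine ⟨k.factorial / δ ^ k * Real.exp δ, by positivity, fun t ht => ?_⟩
  have h1 : (1 + t) ^ κ ≤ (1 + t) ^ k := by
    rw [← Real.rpow_natCast]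
    exact Real.rpow_le_rpow_of_exponent_le (by linarith) hk
  have h2 := Real.pow_div_factorial_le_exp (δ * (1 + t)) (by positivity) k
  have h3 : Real.exp (δ * (1 + t)) = Real.exp δ * Real.exp (δ * t) := by
    rw [← Real.exp_add]; ring_nf
  rw [h3, mul_pow, div_le_iff₀ (by positivity)] at h2
  calc (1 + t) ^ κ ≤ (1 + t) ^ k := h1
    _ = (δ ^ k * (1 + t) ^ k) / δ ^ k := by field_simp
    _ ≤ (Real.exp δ * Real.exp (δ * t) * k.factorial) / δ ^ k := by gcongr
    _ = _ := by ring

/-- Linear forms on `ℝⁿ` whose coefficients vanish or have positive real part, each with a sequence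
of functions, every one the derivative of the preceding one, that grow subexponentially along the
form. -/
structure FormFamily (ι : Type) (n : ℕ) where
  /-- The coefficients of the linear forms. -/
  coeff : ι → Fin n → ℂ
  coeff_eq_zero_or : ∀ i j, coeff i j = 0 ∨ 0 < (coeff i j).re
  exists_coeff_ne_zero : ∀ i, ∃ j, coeff i j ≠ 0
  /-- The functions attached to the linear forms. -/
  func : ι → ℕ → ℂ → ℂ
  hasDerivAt_func : ∀ i m v, 0 < v.re → HasDerivAt (func i m) (func i (m + 1) v) v
  bound_func : ∀ i m, ∀ δ : ℝ, 0 < δ → ∃ C : ℝ, ∀ y ∈ orthant n,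
    ‖func i m (∑ j, coeff i j * (y j : ℂ))‖ ≤ C * Real.exp (δ * ∑ j, y j)

/-! ### Integrals over the orthant with linear forms in the denominator: convergence and holomorphy
-/

namespace FormFamily

variable {ι : Type} {n : ℕ} (Λ : FormFamily ι n)

/-- The `i`-th linear form. -/
noncomputable def form (i : ι) (y : Fin n → ℝ) : ℂ := ∑ j, Λ.coeff i j * (y j : ℂ)

/-- The variables that occur in the `i`-th linear form. -/
noncomputable def supp (i : ι) : Finset (Fin n) := Finset.univ.filter fun j => Λ.coeff i j ≠ 0

theorem mem_supp {i : ι} {j : Fin n} : j ∈ Λ.supp i ↔ Λ.coeff i j ≠ 0 := by simp [supp]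

theorem supp_nonempty (i : ι) : (Λ.supp i).Nonempty := by
  obtain ⟨j, hj⟩ := Λ.exists_coeff_ne_zero i
  exact ⟨j, Λ.mem_supp.2 hj⟩

theorem coeff_re_nonneg (i : ι) (j : Fin n) : 0 ≤ (Λ.coeff i j).re := by
  rcases Λ.coeff_eq_zero_or i j with h | h
  · simp [h]
  · exact h.le

theorem coeff_re_pos {i : ι} {j : Fin n} (h : j ∈ Λ.supp i) : 0 < (Λ.coeff i j).re :=
  (Λ.coeff_eq_zero_or i j).resolve_left (Λ.mem_supp.1 h)

theorem form_re (i : ι) (y : Fin n → ℝ) :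
    (Λ.form i y).re = ∑ j, (Λ.coeff i j).re * y j := by
  simp [form]

theorem le_form_re (i : ι) {y : Fin n → ℝ} (hy : ∀ j, 0 ≤ y j) (j : Fin n) :
    (Λ.coeff i j).re * y j ≤ (Λ.form i y).re := by
  rw [form_re]
  exact Finset.single_le_sum (f := fun j => (Λ.coeff i j).re * y j)
    (fun l _ => mul_nonneg (Λ.coeff_re_nonneg i l) (hy l)) (Finset.mem_univ j)

theorem form_re_pos (i : ι) {y : Fin n → ℝ} (hy : y ∈ orthant n) : 0 < (Λ.form i y).re := by
  rw [mem_orthant] at hy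
  obtain ⟨j, hj⟩ := Λ.supp_nonempty i
  exact (mul_pos (Λ.coeff_re_pos hj) (hy j)).trans_le (Λ.le_form_re i (fun j => (hy j).le) j)

theorem form_ne_zero (i : ι) {y : Fin n → ℝ} (hy : y ∈ orthant n) : Λ.form i y ≠ 0 := by
  intro h
  simpa [h] using Λ.form_re_pos i hy

/-- All terms of the form have nonnegative real part, so nothing cancels and the form is comparable
from below to the maximum of its variables. The constant is the least real part of a nonzero
coefficient. -/
theorem exists_le_norm_form (i : ι) : ∃ c : ℝ, 0 < c ∧ ∀ y ∈ orthant n, ∀ j ∈ Λ.supp i,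
    c * y j ≤ ‖Λ.form i y‖ := by
  obtain ⟨l, hl, hmin⟩ := (Λ.supp i).exists_min_image (fun j => (Λ.coeff i j).re)
    (Λ.supp_nonempty i)
  refine ⟨(Λ.coeff i l).re, Λ.coeff_re_pos hl, fun y hy j hj => ?_⟩
  rw [mem_orthant] at hy
  calc (Λ.coeff i l).re * y j ≤ (Λ.coeff i j).re * y j :=
        mul_le_mul_of_nonneg_right (hmin j hj) (hy j).le
    _ ≤ (Λ.form i y).re := Λ.le_form_re i (fun j => (hy j).le) j
    _ ≤ ‖Λ.form i y‖ := Complex.re_le_norm _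

theorem continuous_form (i : ι) : Continuous (Λ.form i) := by
  unfold form
  fun_prop

variable [Fintype ι]

/-- The excess of a set `B` of variables: the order of vanishing along `B` of the monomial with
exponents `p` divided by the `β i`-th powers of the linear forms. -/
noncomputable def excess (B : Finset (Fin n)) (p : Fin n → ℕ) (β : ι → ℕ) : ℤ :=
  ∑ j ∈ B, (p j : ℤ) - ∑ i with Λ.supp i ⊆ B, (β i : ℤ)

/-- The integrand. -/
noncomputable def integrand (p : Fin n → ℕ) (β m : ι → ℕ) (s : ℂ) (w : Fin n → ℂ) (y : Fin n → ℝ) : ℂ :=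
  (∏ j, (y j : ℂ) ^ (s + p j - 1)) *
    (∏ i, ((Λ.form i y ^ β i)⁻¹ * Λ.func i (m i) (Λ.form i y))) *
    Complex.exp (-∑ j, w j * (y j : ℂ))

/-- The integral of `FormFamily.integrand` over the positive orthant. -/
noncomputable def intg (p : Fin n → ℕ) (β m : ι → ℕ) (s : ℂ) (w : Fin n → ℂ) : ℂ :=
  ∫ y in orthant n, Λ.integrand p β m s w y

theorem continuousOn_integrand (p : Fin n → ℕ) (β m : ι → ℕ) (s : ℂ) (w : Fin n → ℂ) :
    ContinuousOn (Λ.integrand p β m s w) (orthant n) := by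
  unfold integrand
  refine ContinuousOn.mul (ContinuousOn.mul ?_ ?_) (by fun_prop)
  · refine continuousOn_finsetProd _ fun j _ => ?_
    refine ContinuousOn.cpow (by fun_prop) continuousOn_const fun y hy => ?_
    exact Complex.ofReal_mem_slitPlane.2 (mem_orthant.1 hy j)
  · refine continuousOn_finsetProd _ fun i _ => ContinuousOn.mul ?_ ?_
    · refine ContinuousOn.inv₀ ((Λ.continuous_form i).continuousOn.pow _) fun y hy => ?_
      exact pow_ne_zero _ (Λ.form_ne_zero i hy)
    · intro y hy
      refine ContinuousAt.continuousWithinAt ?_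
      exact ContinuousAt.comp (g := Λ.func i (m i))
        (Λ.hasDerivAt_func i (m i) _ (Λ.form_re_pos i hy)).continuousAt
        (Λ.continuous_form i).continuousAt

theorem norm_integrand (p : Fin n → ℕ) (β m : ι → ℕ) (s : ℂ) (w : Fin n → ℂ) {y : Fin n → ℝ}
    (hy : y ∈ orthant n) : ‖Λ.integrand p β m s w y‖ =
      (∏ j, y j ^ (s.re + p j - 1)) *
      (∏ i, ((‖Λ.form i y‖ ^ β i)⁻¹ * ‖Λ.func i (m i) (Λ.form i y)‖)) *
      Real.exp (-∑ j, (w j).re * y j) := by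
  rw [mem_orthant] at hy
  simp only [integrand, norm_mul, norm_prod, norm_inv, norm_pow, Complex.norm_exp]
  have h : ∀ j, ‖(y j : ℂ) ^ (s + p j - 1)‖ = y j ^ (s.re + p j - 1) := fun j => by
    rw [Complex.norm_cpow_eq_rpow_re_of_pos (hy j)]
    simp
  simp [h]

/-- Under a Hall type condition the integrand is dominated, locally uniformly in `s` and `w`. -/
theorem exists_dominating (p : Fin n → ℕ) (β m : ι → ℕ) {σ₁ σ₂ ε : ℝ} (hε : 0 < ε)
    (hB : ∀ B : Finset (Fin n), B.Nonempty → 0 < B.card * σ₁ + Λ.excess B p β) :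
    ∃ g : (Fin n → ℝ) → ℝ, IntegrableOn g (orthant n) ∧ ∀ (s : ℂ) (w : Fin n → ℂ),
      σ₁ ≤ s.re → s.re ≤ σ₂ → (∀ j, ε ≤ (w j).re) → ∀ y ∈ orthant n,
      ‖Λ.integrand p β m s w y‖ ≤ g y := by
  classical
  -- Applied to the logarithms of the y_j. The exponents σ₁ + p_j are those with respect to the
  -- measure ∏ dy_j / y_j, for which positive means integrable at 0.
  obtain ⟨E, hE1, hE2⟩ := exists_positive_exponents Λ.supp Λ.supp_nonempty
    (fun j => σ₁ + p j) β Finset.univ fun B _ hBn => by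
      have := hB B hBn
      simp only [excess] at this
      push_cast at this
      rw [Finset.sum_add_distrib, Finset.sum_const, nsmul_eq_mul]
      linarith
  choose c hc hcle using Λ.exists_le_norm_form
  -- The decay e^(-ε∑y) is split: at most ε/4 for the growth of all functions `func` together, ε/4
  -- for the range of Re s, and ε/2 remains for integrability.
  have hδ : 0 < ε / (4 * (Fintype.card ι + 1)) := by positivity
  choose C hC using fun i => Λ.bound_func i (m i) _ hδ
  obtain ⟨D, hD, hDle⟩ := exists_one_add_rpow_le_exp (σ₂ - σ₁) (show 0 < ε / 4 by positivity)
  set Q : ℝ := D ^ n * ∏ i, ((c i ^ β i)⁻¹ * |C i|) with hQ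
  refine ⟨fun y => Q * ∑ e ∈ E, ∏ j, (y j ^ (e j - 1) * Real.exp (-(ε / 2) * y j)), ?_, ?_⟩
  · refine Integrable.const_mul (integrable_finsetSum _ fun e he => ?_) _
    exact integrableOn_orthant_monomial (fun j => (hE1 e he).1 j (Finset.mem_univ j))
      (by positivity)
  intro s w hs1 hs2 hw y hy
  have hy' := mem_orthant.1 hy
  set ℓ : Fin n → ℝ := fun j => Real.log (y j) with hℓ
  have hYsum : 0 ≤ ∑ j, y j := Finset.sum_nonneg fun j _ => (hy' j).le
  have hmon : ∏ j, y j ^ (s.re + p j - 1) ≤ (∏ j, Real.exp ((σ₁ + p j) * ℓ j)) *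
      (∏ j, (y j)⁻¹) * (D ^ n * Real.exp (ε / 4 * ∑ j, y j)) := by
    have hterm : ∀ j, y j ^ (s.re + p j - 1) ≤ Real.exp ((σ₁ + p j) * ℓ j) * (y j)⁻¹ *
        (D * Real.exp (ε / 4 * y j)) := by
      intro j
      have h1 : y j ^ (s.re + p j - 1) = y j ^ (σ₁ + p j) * (y j)⁻¹ * y j ^ (s.re - σ₁) := by
        rw [← Real.rpow_neg_one (y j), ← Real.rpow_add (hy' j), ← Real.rpow_add (hy' j)]
        congr 1; ring
      have h2 : y j ^ (σ₁ + p j) = Real.exp ((σ₁ + p j) * ℓ j) := by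
        rw [Real.rpow_def_of_pos (hy' j), mul_comm]
      have h3 : y j ^ (s.re - σ₁) ≤ D * Real.exp (ε / 4 * y j) := by
        refine le_trans ?_ (hDle (y j) (hy' j).le)
        calc y j ^ (s.re - σ₁) ≤ (1 + y j) ^ (s.re - σ₁) :=
              Real.rpow_le_rpow (hy' j).le (by linarith) (by linarith)
          _ ≤ (1 + y j) ^ (σ₂ - σ₁) :=
              Real.rpow_le_rpow_of_exponent_le (by linarith [hy' j]) (by linarith)
      rw [h1, h2]
      have := hy' j
      gcongr
    calc ∏ j, y j ^ (s.re + p j - 1) ≤ ∏ j, (Real.exp ((σ₁ + p j) * ℓ j) * (y j)⁻¹ *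
        (D * Real.exp (ε / 4 * y j))) :=
          Finset.prod_le_prod (fun j _ => Real.rpow_nonneg (hy' j).le _) fun j _ => hterm j
      _ = _ := by
          simp only [Finset.prod_mul_distrib, Finset.prod_const, Finset.card_univ,
            Fintype.card_fin]
          rw [← Real.exp_sum Finset.univ (fun j => ε / 4 * y j), ← Finset.mul_sum]
  have hforms : ∏ i, ((‖Λ.form i y‖ ^ β i)⁻¹ * ‖Λ.func i (m i) (Λ.form i y)‖) ≤
      (∏ i, ((c i ^ β i)⁻¹ * |C i|)) *
        Real.exp (-∑ i, (β i : ℝ) * (Λ.supp i).sup' (Λ.supp_nonempty i) ℓ) *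
        Real.exp (ε / 4 * ∑ j, y j) := by
    have hterm : ∀ i, (‖Λ.form i y‖ ^ β i)⁻¹ * ‖Λ.func i (m i) (Λ.form i y)‖ ≤
        ((c i ^ β i)⁻¹ * |C i|) *
        Real.exp (-((β i : ℝ) * (Λ.supp i).sup' (Λ.supp_nonempty i) ℓ)) *
        Real.exp (ε / (4 * (Fintype.card ι + 1)) * ∑ j, y j) := by
      intro i
      have h1 : c i * Real.exp ((Λ.supp i).sup' (Λ.supp_nonempty i) ℓ) ≤ ‖Λ.form i y‖ := by
        obtain ⟨j, hj, hjeq⟩ := Finset.exists_mem_eq_sup' (Λ.supp_nonempty i) ℓ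
        rw [hjeq, hℓ, Real.exp_log (hy' j)]
        exact hcle i y hy j hj
      have h2 : (‖Λ.form i y‖ ^ β i)⁻¹ ≤ (c i ^ β i)⁻¹ *
          Real.exp (-((β i : ℝ) * (Λ.supp i).sup' (Λ.supp_nonempty i) ℓ)) := by
        rw [Real.exp_neg, Real.exp_nat_mul, ← mul_inv, ← mul_pow]
        have := hc i
        gcongr
      have h3 : ‖Λ.func i (m i) (Λ.form i y)‖ ≤ |C i| *
          Real.exp (ε / (4 * (Fintype.card ι + 1)) * ∑ j, y j) :=
        (hC i y hy).trans (by gcongr; exact le_abs_self _)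
      calc _ ≤ ((c i ^ β i)⁻¹ *
          Real.exp (-((β i : ℝ) * (Λ.supp i).sup' (Λ.supp_nonempty i) ℓ))) * (|C i| *
          Real.exp (ε / (4 * (Fintype.card ι + 1)) * ∑ j, y j)) := by
            have := hc i
            gcongr
        _ = _ := by ring
    refine (Finset.prod_le_prod (fun i _ => by positivity) fun i _ => hterm i).trans ?_
    rw [Finset.prod_mul_distrib, Finset.prod_mul_distrib, ← Real.exp_sum, Finset.sum_neg_distrib,
      Finset.prod_const, ← Real.exp_nat_mul]
    have hnn : 0 ≤ ∏ i, ((c i ^ β i)⁻¹ * |C i|) :=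
      Finset.prod_nonneg fun i _ => by have := hc i; positivity
    refine mul_le_mul_of_nonneg_left (Real.exp_le_exp.2 ?_) (mul_nonneg hnn (Real.exp_pos _).le)
    rw [← mul_assoc]
    refine mul_le_mul_of_nonneg_right ?_ hYsum
    rw [Finset.card_univ, mul_div_assoc', div_le_div_iff₀ (by positivity) (by positivity)]
    nlinarith [(Nat.cast_nonneg (Fintype.card ι) : (0 : ℝ) ≤ Fintype.card ι)]
  have hexp : Real.exp (-∑ j, (w j).re * y j) ≤ Real.exp (-(ε * ∑ j, y j)) := by
    refine Real.exp_le_exp.2 (neg_le_neg ?_)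
    rw [Finset.mul_sum]
    exact Finset.sum_le_sum fun j _ => mul_le_mul_of_nonneg_right (hw j) (hy' j).le
  obtain ⟨e, he, hle⟩ := hE2 ℓ
  have hfilt : (Finset.univ.filter fun i => Λ.supp i ⊆ Finset.univ) = Finset.univ := by simp
  rw [hfilt] at hle
  have hQ1 : 0 ≤ ∏ i, ((c i ^ β i)⁻¹ * |C i|) :=
    Finset.prod_nonneg fun i _ => by have := hc i; positivity
  rw [Λ.norm_integrand p β m s w hy]
  calc _ ≤ ((∏ j, Real.exp ((σ₁ + p j) * ℓ j)) *
      (∏ j, (y j)⁻¹) * (D ^ n * Real.exp (ε / 4 * ∑ j, y j))) *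
      ((∏ i, ((c i ^ β i)⁻¹ * |C i|)) *
        Real.exp (-∑ i, (β i : ℝ) * (Λ.supp i).sup' (Λ.supp_nonempty i) ℓ) *
        Real.exp (ε / 4 * ∑ j, y j)) * Real.exp (-(ε * ∑ j, y j)) := by
        refine mul_le_mul (mul_le_mul hmon hforms ?_ ?_) hexp (Real.exp_pos _).le ?_
        · exact Finset.prod_nonneg fun i _ => by positivity
        · have : 0 ≤ ∏ j, (y j)⁻¹ := Finset.prod_nonneg fun j _ => (inv_pos.2 (hy' j)).le
          have : 0 ≤ ∏ j, Real.exp ((σ₁ + p j) * ℓ j) :=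
            Finset.prod_nonneg fun j _ => (Real.exp_pos _).le
          positivity
        · have : 0 ≤ ∏ j, (y j)⁻¹ := Finset.prod_nonneg fun j _ => (inv_pos.2 (hy' j)).le
          have : 0 ≤ ∏ j, Real.exp ((σ₁ + p j) * ℓ j) :=
            Finset.prod_nonneg fun j _ => (Real.exp_pos _).le
          positivity
    _ = Q * (Real.exp (∑ j, (σ₁ + p j) * ℓ j -
          ∑ i, (β i : ℝ) * (Λ.supp i).sup' (Λ.supp_nonempty i) ℓ) * (∏ j, (y j)⁻¹) *
          Real.exp (-(ε / 2) * ∑ j, y j)) := by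
        rw [← Real.exp_sum, hQ, sub_eq_add_neg, Real.exp_add,
          show -(ε / 2) * ∑ j, y j = ε / 4 * ∑ j, y j + ε / 4 * ∑ j, y j + -(ε * ∑ j, y j) by ring,
          Real.exp_add, Real.exp_add]
        ring
    _ ≤ Q * (Real.exp (∑ j, e j * ℓ j) * (∏ j, (y j)⁻¹) *
          Real.exp (-(ε / 2) * ∑ j, y j)) := by
        have : 0 ≤ ∏ j, (y j)⁻¹ := Finset.prod_nonneg fun j _ => (inv_pos.2 (hy' j)).le
        have : 0 ≤ Q := by positivity
        gcongr
    _ = Q * ∏ j, (y j ^ (e j - 1) * Real.exp (-(ε / 2) * y j)) := by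
        rw [Real.exp_sum, Finset.mul_sum, Real.exp_sum, ← Finset.prod_mul_distrib,
          ← Finset.prod_mul_distrib]
        congr 1
        refine Finset.prod_congr rfl fun j _ => ?_
        rw [Real.rpow_sub_one (hy' j).ne', Real.rpow_def_of_pos (hy' j), mul_comm (e j), hℓ]
        ring
    _ ≤ _ := by
        have : 0 ≤ Q := by positivity
        refine mul_le_mul_of_nonneg_left ?_ this
        refine Finset.single_le_sum
          (f := fun e : Fin n → ℝ => ∏ j, (y j ^ (e j - 1) * Real.exp (-(ε / 2) * y j)))
          (fun e _ => ?_) he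
        exact Finset.prod_nonneg fun j _ =>
          mul_nonneg (Real.rpow_nonneg (hy' j).le _) (Real.exp_pos _).le

theorem integrableOn_integrand (p : Fin n → ℕ) (β m : ι → ℕ) {s : ℂ} {w : Fin n → ℂ}
    (hw : ∀ j, 0 < (w j).re)
    (hB : ∀ B : Finset (Fin n), B.Nonempty → 0 < B.card * s.re + Λ.excess B p β) :
    IntegrableOn (Λ.integrand p β m s w) (orthant n) := by
  obtain ⟨ε, hε, hεw⟩ : ∃ ε : ℝ, 0 < ε ∧ ∀ j, ε ≤ (w j).re := by
    rcases isEmpty_or_nonempty (Fin n) with h | h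
    · exact ⟨1, one_pos, fun j => (h.false j).elim⟩
    · obtain ⟨l, hl⟩ := Finite.exists_min fun j => (w j).re
      exact ⟨(w l).re, hw l, hl⟩
  obtain ⟨g, hg, hle⟩ := Λ.exists_dominating p β m (σ₂ := s.re) hε hB
  refine hg.mono' ((Λ.continuousOn_integrand p β m s w).aestronglyMeasurable
    (measurableSet_orthant n)) ?_
  exact (ae_restrict_iff' (measurableSet_orthant n)).2 (Eventually.of_forall fun y hy =>
    hle s w le_rfl le_rfl hεw y hy)

/-- The parameters `(s, w)` with `Re s > σ` and all `Re w_j > 0`. -/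
def paramDomain (n : ℕ) (σ : ℝ) : Set (ℂ × (Fin n → ℂ)) :=
  {q | σ < q.1.re ∧ ∀ j, 0 < (q.2 j).re}

theorem isOpen_paramDomain (n : ℕ) (σ : ℝ) : IsOpen (paramDomain n σ) := by
  refine IsOpen.inter (isOpen_lt continuous_const (Complex.continuous_re.comp continuous_fst)) ?_
  have : {q : ℂ × (Fin n → ℂ) | ∀ j, 0 < (q.2 j).re} = ⋂ j, {q | 0 < (q.2 j).re} := by
    ext q; simp
  change IsOpen {q : ℂ × (Fin n → ℂ) | ∀ j, 0 < (q.2 j).re}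
  rw [this]
  exact isOpen_iInter_of_finite fun j => isOpen_lt continuous_const (by fun_prop)

/-- The weak inequality at σ suffices: near a parameter with Re s > σ some σ₁ > σ still bounds Re s
from below, and there the inequality is strict because B is nonempty. -/
theorem differentiableOn_intg (p : Fin n → ℕ) (β m : ι → ℕ) {σ : ℝ}
    (hB : ∀ B : Finset (Fin n), B.Nonempty → 0 ≤ B.card * σ + Λ.excess B p β) :
    DifferentiableOn ℂ (fun q : ℂ × (Fin n → ℂ) => Λ.intg p β m q.1 q.2) (paramDomain n σ) := by
  refine differentiableOn_integral_of_dominated (isOpen_paramDomain n σ)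
    (f := fun q y => Λ.integrand p β m q.1 q.2 y) (fun q _ => ?_) ?_ fun q hq => ?_
  · exact (Λ.continuousOn_integrand p β m q.1 q.2).aestronglyMeasurable (measurableSet_orthant n)
  · refine (ae_restrict_iff' (measurableSet_orthant n)).2 (Eventually.of_forall fun y hy => ?_)
    refine Differentiable.differentiableOn ?_
    unfold integrand
    refine Differentiable.mul (Differentiable.mul ?_ (differentiable_const _)) (by fun_prop)
    have hj : ∀ j, Differentiable ℂ fun q : ℂ × (Fin n → ℂ) => (y j : ℂ) ^ (q.1 + p j - 1) := ?_
    · fun_prop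
    intro j
    refine Differentiable.const_cpow (by fun_prop) (Or.inl ?_)
    exact_mod_cast (mem_orthant.1 hy j).ne'
  · obtain ⟨hqs, hqw⟩ := hq
    obtain ⟨σ₁, h1, h2⟩ := exists_between hqs
    obtain ⟨ε, hε, hεw⟩ : ∃ ε : ℝ, 0 < ε ∧ ∀ j, 2 * ε ≤ (q.2 j).re := by
      rcases isEmpty_or_nonempty (Fin n) with h | h
      · exact ⟨1, one_pos, fun j => (h.false j).elim⟩
      · obtain ⟨l, hl⟩ := Finite.exists_min fun j => (q.2 j).re
        refine ⟨(q.2 l).re / 2, half_pos (hqw l), fun j => ?_⟩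
        linarith [hl j]
    obtain ⟨g, hg, hle⟩ := Λ.exists_dominating p β m (σ₁ := σ₁) (σ₂ := q.1.re + 1) hε
      fun B hBn => by
        have h3 := hB B hBn
        have h4 : (0 : ℝ) < B.card := by exact_mod_cast hBn.card_pos
        nlinarith
    refine ⟨min (min ε 1) (q.1.re - σ₁), lt_min (lt_min hε one_pos) (by linarith), g, hg, ?_⟩
    refine (ae_restrict_iff' (measurableSet_orthant n)).2 (Eventually.of_forall fun y hy r hr => ?_)
    rw [Metric.mem_ball, Prod.dist_eq, max_lt_iff] at hr
    have hr1 : |r.1.re - q.1.re| < min (min ε 1) (q.1.re - σ₁) := by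
      refine lt_of_le_of_lt ?_ hr.1
      rw [dist_eq_norm, ← Complex.sub_re]
      exact Complex.abs_re_le_norm _
    have hr2 : ∀ j, |(r.2 j).re - (q.2 j).re| < min (min ε 1) (q.1.re - σ₁) := by
      intro j
      refine lt_of_le_of_lt ?_ hr.2
      refine le_trans ?_ (dist_le_pi_dist r.2 q.2 j)
      rw [dist_eq_norm, ← Complex.sub_re]
      exact Complex.abs_re_le_norm _
    simp only [lt_min_iff, abs_lt] at hr1 hr2
    refine hle r.1 r.2 (by linarith [hr1.2.1]) (by linarith [hr1.1.2.2]) (fun j => ?_) y hy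
    linarith [(hr2 j).1.1.1, hεw j]

end FormFamily

end ShintaniBarnes

/-! ### Derivatives of the integrand -/

namespace ShintaniBarnes

/-- Integration by parts against the constant function 1 on the whole space; integrability replaces
boundary conditions. -/
theorem integral_eq_zero_of_hasLineDerivAt {n : ℕ} {F F' : (Fin n → ℝ) → ℂ} {v : Fin n → ℝ}
    (hF : Integrable F) (hF' : Integrable F') (h : ∀ y, HasLineDerivAt ℝ F (F' y) y v) :
    ∫ y, F' y = 0 := by
  have := integral_bilinear_hasLineDerivAt_right_eq_neg_left_of_integrable (μ := volume)
    (f := fun _ : Fin n → ℝ => (1 : ℂ)) (f' := fun _ => 0) (g := F) (g' := F') (v := v)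
    (B := ContinuousLinearMap.mul ℝ ℂ) (by simp) (by simpa using hF')
    (by simpa using hF) (fun y _ => by simpa using! hasDerivAt_const (0 : ℝ) (1 : ℂ))
    fun y _ => h y
  simpa using this

namespace FormFamily

variable {ι : Type} {n : ℕ}

theorem prod_cpow_add_single (p : Fin n → ℕ) (s : ℂ) {y : Fin n → ℝ} (hy : y ∈ orthant n)
    (j : Fin n) : ∏ k, (y k : ℂ) ^ (s + ((p + Pi.single j 1 : Fin n → ℕ) k) - 1) =
      y j * ∏ k, (y k : ℂ) ^ (s + p k - 1) := by
  have hyj : (y j : ℂ) ≠ 0 := by exact_mod_cast (mem_orthant.1 hy j).ne'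
  rw [← Finset.mul_prod_erase _ _ (Finset.mem_univ j),
    ← Finset.mul_prod_erase Finset.univ (fun k => (y k : ℂ) ^ (s + p k - 1)) (Finset.mem_univ j),
    ← mul_assoc]
  congr 1
  · rw [Pi.add_apply, Pi.single_eq_same, Nat.cast_add, Nat.cast_one,
      show s + ((p j : ℂ) + 1) - 1 = (s + p j - 1) + 1 by ring, Complex.cpow_add _ _ hyj,
      Complex.cpow_one, mul_comm]
  · refine Finset.prod_congr rfl fun k hk => ?_
    simp [Finset.ne_of_mem_erase hk]

variable (Λ : FormFamily ι n)

theorem form_add_smul_single (i : ι) (y : Fin n → ℝ) (j : Fin n) (t : ℝ) :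
    Λ.form i (y + t • Pi.single j 1) = Λ.form i y + t * Λ.coeff i j := by
  classical
  simp only [form, Pi.add_apply, Pi.smul_apply, smul_eq_mul, Complex.ofReal_add, mul_add,
    Finset.sum_add_distrib, Pi.single_apply]
  congr 1
  rw [Finset.sum_eq_single j] <;> simp +contextual [mul_comm]

theorem hasDerivAt_form (i : ι) (y : Fin n → ℝ) (j : Fin n) :
    HasDerivAt (fun t : ℝ => Λ.form i (y + t • Pi.single j 1)) (Λ.coeff i j) 0 := by
  simp only [form_add_smul_single]
  have h : HasDerivAt (fun t : ℝ => (t : ℂ)) 1 0 := Complex.ofRealCLM.hasDerivAt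
  simpa using (h.mul_const (Λ.coeff i j)).const_add (Λ.form i y)

/-- Differentiation raises either the power in the denominator or the index of the function. The
integrands with data (p, β, m) are therefore closed under integration by parts up to linear
combinations. -/
theorem hasDerivAt_factor (i : ι) (b k : ℕ) {y : Fin n → ℝ} (hy : y ∈ orthant n) (j : Fin n) :
    HasDerivAt (fun t : ℝ => (Λ.form i (y + t • Pi.single j 1) ^ b)⁻¹ *
        Λ.func i k (Λ.form i (y + t • Pi.single j 1)))
      (Λ.coeff i j * (-(b : ℂ) * ((Λ.form i y ^ (b + 1))⁻¹ * Λ.func i k (Λ.form i y)) +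
        (Λ.form i y ^ b)⁻¹ * Λ.func i (k + 1) (Λ.form i y))) 0 := by
  have h0 : Λ.form i y ≠ 0 := Λ.form_ne_zero i hy
  have hG : HasDerivAt (fun v : ℂ => (v ^ b)⁻¹ * Λ.func i k v)
      (-(b : ℂ) * ((Λ.form i y ^ (b + 1))⁻¹ * Λ.func i k (Λ.form i y)) +
        (Λ.form i y ^ b)⁻¹ * Λ.func i (k + 1) (Λ.form i y)) (Λ.form i y) := by
    have h1 : HasDerivAt (fun v : ℂ => (v ^ b)⁻¹) (-(b : ℂ) * (Λ.form i y ^ (b + 1))⁻¹)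
        (Λ.form i y) := by
      have := (hasDerivAt_pow b (Λ.form i y)).inv (pow_ne_zero b h0)
      refine this.congr_deriv ?_
      rcases b with _ | b
      · simp
      · simp only [Nat.add_sub_cancel]
        field_simp
        ring
    refine (h1.mul (Λ.hasDerivAt_func i k _ (Λ.form_re_pos i hy))).congr_deriv ?_
    ring
  have hG' : HasDerivAt (fun v : ℂ => (v ^ b)⁻¹ * Λ.func i k v)
      (-(b : ℂ) * ((Λ.form i y ^ (b + 1))⁻¹ * Λ.func i k (Λ.form i y)) +
        (Λ.form i y ^ b)⁻¹ * Λ.func i (k + 1) (Λ.form i y))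
      (Λ.form i (y + (0 : ℝ) • Pi.single j 1)) := by simpa using hG
  exact hG'.scomp 0 (Λ.hasDerivAt_form i y j)

variable [Fintype ι]

theorem integrand_add_single (p : Fin n → ℕ) (β m : ι → ℕ) (s : ℂ) (w : Fin n → ℂ)
    {y : Fin n → ℝ} (hy : y ∈ orthant n) (j : Fin n) :
    Λ.integrand (p + Pi.single j 1) β m s w y = y j * Λ.integrand p β m s w y := by
  simp only [integrand, prod_cpow_add_single p s hy j]
  ring

variable [DecidableEq ι]

theorem hasDerivAt_prod_factor (β m : ι → ℕ) {y : Fin n → ℝ} (hy : y ∈ orthant n) (j : Fin n) :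
    HasDerivAt (fun t : ℝ => ∏ i, ((Λ.form i (y + t • Pi.single j 1) ^ β i)⁻¹ *
        Λ.func i (m i) (Λ.form i (y + t • Pi.single j 1))))
      (∑ i, Λ.coeff i j * (-(β i : ℂ) * (∏ k, ((Λ.form k y ^ (β + Pi.single i 1 : ι → ℕ) k)⁻¹ *
          Λ.func k (m k) (Λ.form k y))) +
        ∏ k, ((Λ.form k y ^ β k)⁻¹ * Λ.func k ((m + Pi.single i 1 : ι → ℕ) k) (Λ.form k y)))) 0 := by
  have h := HasDerivAt.fun_finsetProd (u := Finset.univ) (x := (0 : ℝ))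
    fun i _ => Λ.hasDerivAt_factor i (β i) (m i) hy j
  refine h.congr_deriv (Finset.sum_congr rfl fun i _ => ?_)
  have h1 : ∏ k, ((Λ.form k y ^ (β + Pi.single i 1 : ι → ℕ) k)⁻¹ * Λ.func k (m k) (Λ.form k y)) =
      (∏ k ∈ Finset.univ.erase i, ((Λ.form k y ^ β k)⁻¹ * Λ.func k (m k) (Λ.form k y))) *
        ((Λ.form i y ^ (β i + 1))⁻¹ * Λ.func i (m i) (Λ.form i y)) := by
    rw [← Finset.prod_erase_mul _ _ (Finset.mem_univ i)]
    congr 1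
    · refine Finset.prod_congr rfl fun k hk => ?_
      simp [Finset.ne_of_mem_erase hk]
    · simp
  have h2 : ∏ k, ((Λ.form k y ^ β k)⁻¹ * Λ.func k ((m + Pi.single i 1 : ι → ℕ) k) (Λ.form k y)) =
      (∏ k ∈ Finset.univ.erase i, ((Λ.form k y ^ β k)⁻¹ * Λ.func k (m k) (Λ.form k y))) *
        ((Λ.form i y ^ β i)⁻¹ * Λ.func i (m i + 1) (Λ.form i y)) := by
    rw [← Finset.prod_erase_mul _ _ (Finset.mem_univ i)]
    congr 1
    · refine Finset.prod_congr rfl fun k hk => ?_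
      simp [Finset.ne_of_mem_erase hk]
    · simp
  rw [h1, h2]
  simp only [zero_smul, add_zero, smul_eq_mul]
  ring

theorem integrand_add_single_form (p : Fin n → ℕ) (β m : ι → ℕ) (s : ℂ) (w : Fin n → ℂ)
    (y : Fin n → ℝ) (i : ι) :
    Λ.integrand p (β + Pi.single i 1) m s w y =
      (Λ.form i y)⁻¹ * Λ.integrand p β m s w y := by
  have : ∏ k, ((Λ.form k y ^ (β + Pi.single i 1 : ι → ℕ) k)⁻¹ * Λ.func k (m k) (Λ.form k y)) =
      (Λ.form i y)⁻¹ * ∏ k, ((Λ.form k y ^ β k)⁻¹ * Λ.func k (m k) (Λ.form k y)) := by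
    rw [← Finset.mul_prod_erase _ _ (Finset.mem_univ i),
      ← Finset.mul_prod_erase Finset.univ
        (fun k => (Λ.form k y ^ β k)⁻¹ * Λ.func k (m k) (Λ.form k y)) (Finset.mem_univ i), ← mul_assoc]
    congr 1
    · rw [Pi.add_apply, Pi.single_eq_same, pow_succ, mul_inv]
      ring
    · refine Finset.prod_congr rfl fun k hk => ?_
      simp [Finset.ne_of_mem_erase hk]
  simp only [integrand, this]
  ring

/-- The partial derivative in `y_j` of `y_j` times the integrand. -/
noncomputable def integrandDeriv (p : Fin n → ℕ) (β m : ι → ℕ) (j : Fin n) (s : ℂ) (w : Fin n → ℂ)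
    (y : Fin n → ℝ) : ℂ :=
  (s + p j) * Λ.integrand p β m s w y +
    (∑ i, Λ.coeff i j * (-(β i : ℂ) * Λ.integrand (p + Pi.single j 1) (β + Pi.single i 1) m s w y +
      Λ.integrand (p + Pi.single j 1) β (m + Pi.single i 1) s w y)) -
    w j * Λ.integrand (p + Pi.single j 1) β m s w y

theorem hasLineDerivAt_integrand (p : Fin n → ℕ) (β m : ι → ℕ) (j : Fin n) (s : ℂ)
    (w : Fin n → ℂ) {y : Fin n → ℝ} (hy : y ∈ orthant n) :
    HasLineDerivAt ℝ (Λ.integrand (p + Pi.single j 1) β m s w) (Λ.integrandDeriv p β m j s w y) y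
      (Pi.single j 1) := by
  have hyj : 0 < y j := mem_orthant.1 hy j
  have hofReal : HasDerivAt (fun t : ℝ => (t : ℂ)) 1 0 := Complex.ofRealCLM.hasDerivAt
  have hmon : HasDerivAt (fun t : ℝ => ∏ k, (((y + t • Pi.single j 1 : Fin n → ℝ) k : ℝ) : ℂ) ^
      (s + ((p + Pi.single j 1 : Fin n → ℕ) k) - 1)) ((s + p j) * ∏ k, (y k : ℂ) ^ (s + p k - 1)) 0 := by
    have hfact : (fun t : ℝ => ∏ k, (((y + t • Pi.single j 1 : Fin n → ℝ) k : ℝ) : ℂ) ^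
        (s + ((p + Pi.single j 1 : Fin n → ℕ) k) - 1)) = fun t : ℝ => ((y j : ℂ) + t) ^ (s + p j) *
          ∏ k ∈ Finset.univ.erase j, (y k : ℂ) ^ (s + p k - 1) := by
      funext t
      rw [← Finset.mul_prod_erase _ _ (Finset.mem_univ j)]
      congr 1
      · simp [add_sub_assoc]
      · refine Finset.prod_congr rfl fun k hk => ?_
        simp [Finset.ne_of_mem_erase hk]
    rw [hfact, ← Finset.mul_prod_erase Finset.univ (fun k => (y k : ℂ) ^ (s + p k - 1))
      (Finset.mem_univ j), ← mul_assoc]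
    refine HasDerivAt.mul_const ?_ _
    have h1 : HasDerivAt (fun z : ℂ => z ^ (s + p j)) ((s + p j) * (y j : ℂ) ^ (s + p j - 1))
        ((y j : ℂ) + ((0 : ℝ) : ℂ)) := by
      have := (hasDerivAt_id (y j : ℂ)).cpow_const (c := s + p j)
        (Complex.ofReal_mem_slitPlane.2 hyj)
      simpa using this
    simpa using! h1.scomp (h := fun t : ℝ => (y j : ℂ) + (t : ℂ)) 0 (hofReal.const_add (y j : ℂ))
  have hexp : HasDerivAt (fun t : ℝ => Complex.exp
      (-∑ k, w k * (((y + t • Pi.single j 1 : Fin n → ℝ) k : ℝ) : ℂ)))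
      (Complex.exp (-∑ k, w k * (y k : ℂ)) * (-w j)) 0 := by
    have hlin : (fun t : ℝ => -∑ k, w k * (((y + t • Pi.single j 1 : Fin n → ℝ) k : ℝ) : ℂ)) =
        fun t : ℝ => -∑ k, w k * (y k : ℂ) + (t : ℂ) * (-w j) := by
      funext t
      simp only [Pi.add_apply, Pi.smul_apply, smul_eq_mul, Complex.ofReal_add, mul_add,
        Finset.sum_add_distrib, Pi.single_apply, neg_add]
      congr 1
      rw [Finset.sum_eq_single j] <;> simp +contextual [mul_comm]
    have h1 : HasDerivAt (fun t : ℝ => -∑ k, w k * (y k : ℂ) + (t : ℂ) * (-w j)) (-w j) 0 := by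
      simpa using (hofReal.mul_const (-w j)).const_add (-∑ k, w k * (y k : ℂ))
    have h2 : (fun t : ℝ => Complex.exp
        (-∑ k, w k * (((y + t • Pi.single j 1 : Fin n → ℝ) k : ℝ) : ℂ))) =
        fun t : ℝ => Complex.exp (-∑ k, w k * (y k : ℂ) + (t : ℂ) * (-w j)) :=
      funext fun t => congrArg Complex.exp (congrFun hlin t)
    rw [h2]
    simpa using h1.cexp
  have h := (hmon.fun_mul (Λ.hasDerivAt_prod_factor β m hy j)).fun_mul hexp
  refine HasDerivAt.congr_deriv (f := fun t : ℝ => Λ.integrand (p + Pi.single j 1) β m s w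
    (y + t • Pi.single j 1)) h ?_
  simp only [integrandDeriv, integrand_add_single Λ p _ _ s w hy j]
  simp only [integrand, zero_smul, add_zero]
  rw [prod_cpow_add_single p s hy j]
  have hsum : ∀ (u P X : ℂ) (a b : ι → ℂ),
      (u * P * ∑ i, Λ.coeff i j * (-(β i : ℂ) * a i + b i)) * X =
        ∑ i, Λ.coeff i j * (-(β i : ℂ) * (u * (P * a i * X)) + u * (P * b i * X)) := by
    intro u P X a b
    rw [Finset.mul_sum, Finset.sum_mul]
    exact Finset.sum_congr rfl fun i _ => by ring
  rw [add_mul, hsum]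
  ring

end FormFamily

end ShintaniBarnes

/-! ### Integration by parts over the orthant -/

namespace ShintaniBarnes

namespace FormFamily

variable {ι : Type} {n : ℕ} (Λ : FormFamily ι n) [Fintype ι]

theorem neg_sum_le_excess (B : Finset (Fin n)) (p : Fin n → ℕ) (β : ι → ℕ) :
    -∑ i, (β i : ℤ) ≤ Λ.excess B p β := by
  have h1 : 0 ≤ ∑ j ∈ B, (p j : ℤ) := Finset.sum_nonneg fun _ _ => by positivity
  have h2 : ∑ i with Λ.supp i ⊆ B, (β i : ℤ) ≤ ∑ i, (β i : ℤ) :=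
    Finset.sum_le_sum_of_subset_of_nonneg (Finset.filter_subset _ _) fun _ _ _ => by positivity
  unfold excess
  linarith

theorem integrableOn_integrand_of_lt (p : Fin n → ℕ) (β m : ι → ℕ) {s : ℂ} {w : Fin n → ℂ}
    (hw : ∀ j, 0 < (w j).re) (hs : ∑ i, (β i : ℝ) < s.re) :
    IntegrableOn (Λ.integrand p β m s w) (orthant n) := by
  refine Λ.integrableOn_integrand p β m hw fun B hB => ?_
  have h1 : -∑ i, (β i : ℝ) ≤ (Λ.excess B p β : ℝ) := by
    have := Λ.neg_sum_le_excess B p β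
    exact_mod_cast this
  have h2 : (1 : ℝ) ≤ B.card := by exact_mod_cast hB.card_pos
  have h3 : 0 ≤ ∑ i, (β i : ℝ) := Finset.sum_nonneg fun _ _ => by positivity
  nlinarith

/-- Near a point of the face y_j = 0 with all other coordinates positive, the forms contribute at
worst t^(-∑β) and the monomial has order t^(Re s + p_j). The margin 2 in the hypothesis on Re s
produces t². -/
theorem norm_integrand_boundary_le (p : Fin n → ℕ) (β m : ι → ℕ) (j : Fin n) {s : ℂ}
    {w : Fin n → ℂ} (hw : ∀ j, 0 < (w j).re) (hs : ∑ i, (β i : ℝ) + 2 ≤ s.re) {y : Fin n → ℝ}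
    (hyj : y j = 0) (hy : ∀ k, k ≠ j → 0 < y k) :
    ∃ C : ℝ, ∀ t : ℝ, 0 < t → t ≤ 1 →
      ‖Λ.integrand (p + Pi.single j 1) β m s w (y + t • Pi.single j 1)‖ ≤ C * t ^ 2 := by
  choose c hc hcle using Λ.exists_le_norm_form
  choose k hk using Λ.supp_nonempty
  choose D hD using fun i => Λ.bound_func i (m i) 1 one_pos
  -- One variable k_i is chosen in each form. If it is y_j, the form is at least c t; otherwise it
  -- is at least c y_(k_i), hence at least c y_(k_i) t because t ≤ 1.
  set b : ι → ℝ := fun i => if k i = j then 1 else y (k i) with hb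
  have hbpos : ∀ i, 0 < b i := by
    intro i
    simp only [hb]
    split_ifs with h
    · exact one_pos
    · exact hy _ h
  set Y : ℝ := ∑ l, y l with hY
  set P : ℝ := ∏ l ∈ Finset.univ.erase j, y l ^ (s.re + p l - 1) with hP
  have hP0 : 0 ≤ P := Finset.prod_nonneg fun l hl =>
    Real.rpow_nonneg (hy l (Finset.ne_of_mem_erase hl)).le _
  refine ⟨P * ∏ i, (((c i * b i) ^ β i)⁻¹ * (|D i| * Real.exp (Y + 1))), fun t ht ht1 => ?_⟩
  have hcoord : ∀ l, l ≠ j → (y + t • Pi.single j 1 : Fin n → ℝ) l = y l := fun l hl => by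
    simp [hl]
  have hcoordj : (y + t • Pi.single j 1 : Fin n → ℝ) j = t := by simp [hyj]
  have hmem : (y + t • Pi.single j 1 : Fin n → ℝ) ∈ orthant n := by
    rw [mem_orthant]
    intro l
    rcases eq_or_ne l j with rfl | hl
    · rw [hcoordj]; exact ht
    · rw [hcoord l hl]; exact hy l hl
  rw [Λ.norm_integrand _ _ _ _ _ hmem]
  have h1 : ∏ l, (y + t • Pi.single j 1 : Fin n → ℝ) l ^
      (s.re + ((p + Pi.single j 1 : Fin n → ℕ) l) - 1) = t ^ (s.re + p j) * P := by
    rw [← Finset.mul_prod_erase _ _ (Finset.mem_univ j)]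
    congr 1
    · rw [hcoordj]
      congr 1
      simp [add_sub_assoc]
    · refine Finset.prod_congr rfl fun l hl => ?_
      rw [hcoord l (Finset.ne_of_mem_erase hl)]
      simp [Finset.ne_of_mem_erase hl]
  have h2 : ∏ i, ((‖Λ.form i (y + t • Pi.single j 1)‖ ^ β i)⁻¹ *
      ‖Λ.func i (m i) (Λ.form i (y + t • Pi.single j 1))‖) ≤
      (∏ i, (((c i * b i) ^ β i)⁻¹ * (|D i| * Real.exp (Y + 1)))) * (t ^ (∑ i, β i))⁻¹ := by
    rw [← Finset.prod_pow_eq_pow_sum, ← Finset.prod_inv_distrib, ← Finset.prod_mul_distrib]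
    refine Finset.prod_le_prod (fun i _ => by positivity) fun i _ => ?_
    have hform : c i * b i * t ≤ ‖Λ.form i (y + t • Pi.single j 1)‖ := by
      refine le_trans ?_ (hcle i _ hmem (k i) (hk i))
      rw [mul_assoc]
      refine mul_le_mul_of_nonneg_left ?_ (hc i).le
      by_cases hkj : k i = j
      · rw [hkj, hcoordj]
        simp [hb, hkj]
      · rw [hcoord _ hkj]
        simp only [hb, hkj, if_false]
        have := hy _ hkj
        nlinarith
    have hfunc : ‖Λ.func i (m i) (Λ.form i (y + t • Pi.single j 1))‖ ≤
        |D i| * Real.exp (Y + 1) := by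
      refine (hD i _ hmem).trans ?_
      have hsum : ∑ l, (y + t • Pi.single j 1 : Fin n → ℝ) l = Y + t := by
        simp [Finset.sum_add_distrib, Pi.single_apply, hY]
      rw [hsum, one_mul]
      gcongr
      exact le_abs_self _
    have hcb : 0 < c i * b i := mul_pos (hc i) (hbpos i)
    calc (‖Λ.form i (y + t • Pi.single j 1)‖ ^ β i)⁻¹ *
        ‖Λ.func i (m i) (Λ.form i (y + t • Pi.single j 1))‖
        ≤ ((c i * b i * t) ^ β i)⁻¹ * (|D i| * Real.exp (Y + 1)) := by gcongr
      _ = ((c i * b i) ^ β i)⁻¹ * (|D i| * Real.exp (Y + 1)) * (t ^ β i)⁻¹ := by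
        rw [mul_pow, mul_inv]; ring
  have h3 : Real.exp (-∑ l, (w l).re * (y + t • Pi.single j 1 : Fin n → ℝ) l) ≤ 1 := by
    rw [Real.exp_le_one_iff, neg_nonpos]
    exact Finset.sum_nonneg fun l _ => mul_nonneg (hw l).le (mem_orthant.1 hmem l).le
  have hC0 : 0 ≤ ∏ i, (((c i * b i) ^ β i)⁻¹ * (|D i| * Real.exp (Y + 1))) :=
    Finset.prod_nonneg fun i _ => by
      have := hc i
      have := hbpos i
      positivity
  have h4 : t ^ (s.re + p j) * (t ^ (∑ i, β i))⁻¹ ≤ t ^ 2 := by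
    rw [← Real.rpow_natCast t (∑ i, β i), ← Real.rpow_neg ht.le, ← Real.rpow_add ht,
      ← Real.rpow_natCast t 2]
    refine Real.rpow_le_rpow_of_exponent_ge ht ht1 ?_
    push_cast
    linarith [(Nat.cast_nonneg (p j) : (0 : ℝ) ≤ p j)]
  rw [h1]
  calc _ ≤ t ^ (s.re + p j) * P * ((∏ i, (((c i * b i) ^ β i)⁻¹ * (|D i| * Real.exp (Y + 1)))) *
        (t ^ (∑ i, β i))⁻¹) * 1 := by
        gcongr
    _ = P * (∏ i, (((c i * b i) ^ β i)⁻¹ * (|D i| * Real.exp (Y + 1)))) *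
        (t ^ (s.re + p j) * (t ^ (∑ i, β i))⁻¹) := by ring
    _ ≤ _ := by gcongr

theorem excess_add_single (B : Finset (Fin n)) (p : Fin n → ℕ) (β : ι → ℕ) (j : Fin n) :
    Λ.excess B (p + Pi.single j 1) β = Λ.excess B p β + if j ∈ B then 1 else 0 := by
  simp only [excess, Pi.add_apply, Nat.cast_add, Finset.sum_add_distrib]
  have : ∑ l ∈ B, (((Pi.single j 1 : Fin n → ℕ) l : ℕ) : ℤ) = if j ∈ B then 1 else 0 := by
    simp [Pi.single_apply]
  rw [this]
  ring

variable [DecidableEq ι]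

/-- Extension by zero turns integration by parts on the orthant into integration over the whole
space. The only delicate points lie on the face y_j = 0 with the other coordinates positive; there
the quadratic bound gives the derivative 0. -/
theorem hasLineDerivAt_indicator_integrand (p : Fin n → ℕ) (β m : ι → ℕ) (j : Fin n) {s : ℂ}
    {w : Fin n → ℂ} (hw : ∀ j, 0 < (w j).re) (hs : ∑ i, (β i : ℝ) + 2 ≤ s.re) (y : Fin n → ℝ) :
    HasLineDerivAt ℝ ((orthant n).indicator (Λ.integrand (p + Pi.single j 1) β m s w))
      ((orthant n).indicator (Λ.integrandDeriv p β m j s w) y) y (Pi.single j 1) := by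
  have hline : Continuous fun t : ℝ => (y + t • Pi.single j 1 : Fin n → ℝ) := by fun_prop
  by_cases hy : y ∈ orthant n
  · rw [indicator_of_mem hy]
    refine HasDerivAt.congr_of_eventuallyEq (Λ.hasLineDerivAt_integrand p β m j s w hy) ?_
    have : ∀ᶠ t in 𝓝 (0 : ℝ), (y + t • Pi.single j 1 : Fin n → ℝ) ∈ orthant n :=
      hline.continuousAt.eventually_mem ((isOpen_orthant n).mem_nhds (by simpa using hy))
    filter_upwards [this] with t ht
    rw [indicator_of_mem ht]
  · rw [indicator_of_notMem hy]
    have hzero : (∀ᶠ t in 𝓝 (0 : ℝ), (y + t • Pi.single j 1 : Fin n → ℝ) ∉ orthant n) →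
        HasLineDerivAt ℝ ((orthant n).indicator (Λ.integrand (p + Pi.single j 1) β m s w)) 0 y
          (Pi.single j 1) := by
      intro h
      refine HasDerivAt.congr_of_eventuallyEq (hasDerivAt_const (0 : ℝ) (0 : ℂ)) ?_
      filter_upwards [h] with t ht
      rw [indicator_of_notMem ht]
    by_cases hother : ∀ k, k ≠ j → 0 < y k
    · have hyj : y j ≤ 0 := by
        by_contra hcon
        refine hy (mem_orthant.2 fun k => ?_)
        rcases eq_or_ne k j with rfl | hk
        · exact not_le.1 hcon
        · exact hother k hk
      rcases hyj.lt_or_eq with hlt | heq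
      · refine hzero ?_
        have : ∀ᶠ t in 𝓝 (0 : ℝ), t < -y j := Iio_mem_nhds (by linarith)
        filter_upwards [this] with t ht hmem
        have := mem_orthant.1 hmem j
        simp only [Pi.add_apply, Pi.smul_apply, Pi.single_eq_same, smul_eq_mul, mul_one] at this
        linarith
      · obtain ⟨C, hC⟩ := Λ.norm_integrand_boundary_le p β m j hw hs heq hother
        have hO : (fun t : ℝ => (orthant n).indicator
            (Λ.integrand (p + Pi.single j 1) β m s w) (y + t • Pi.single j 1)) =O[𝓝 0]
            fun t => ‖t - 0‖ ^ 2 := by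
          refine Asymptotics.IsBigO.of_bound |C| ?_
          filter_upwards [Iio_mem_nhds (show (0 : ℝ) < 1 by norm_num)] with t ht
          rcases le_or_gt t 0 with h0 | h0
          · rw [indicator_of_notMem]
            · simp only [norm_zero]; positivity
            · intro hmem
              have := mem_orthant.1 hmem j
              simp only [Pi.add_apply, Pi.smul_apply, Pi.single_eq_same, smul_eq_mul, mul_one]
                at this
              linarith
          · refine (norm_indicator_le_norm_self _ _).trans ((hC t h0 (le_of_lt ht)).trans ?_)
            have : ‖‖t - 0‖ ^ 2‖ = t ^ 2 := by simp
            rw [this]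
            gcongr
            exact le_abs_self C
        have := hO.hasFDerivAt (𝕜 := ℝ) one_lt_two
        simpa using! this.hasDerivAt
    · push Not at hother
      obtain ⟨k, hkj, hk⟩ := hother
      refine hzero (Eventually.of_forall fun t hmem => ?_)
      have := mem_orthant.1 hmem k
      simp [hkj] at this
      linarith

/-- Integration by parts. -/
theorem add_mul_intg (p : Fin n → ℕ) (β m : ι → ℕ) (j : Fin n) {s : ℂ} {w : Fin n → ℂ}
    (hw : ∀ j, 0 < (w j).re) (hs : ∑ i, (β i : ℝ) + 2 ≤ s.re) :
    (s + p j) * Λ.intg p β m s w =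
      (∑ i, Λ.coeff i j * (β i * Λ.intg (p + Pi.single j 1) (β + Pi.single i 1) m s w -
        Λ.intg (p + Pi.single j 1) β (m + Pi.single i 1) s w)) +
      w j * Λ.intg (p + Pi.single j 1) β m s w := by
  have hint : ∀ p' m', IntegrableOn (Λ.integrand p' β m' s w) (orthant n) := fun p' m' =>
    Λ.integrableOn_integrand_of_lt p' β m' hw (by linarith)
  have hint' : ∀ i, IntegrableOn (Λ.integrand (p + Pi.single j 1) (β + Pi.single i 1) m s w)
      (orthant n) := by
    intro i
    refine Λ.integrableOn_integrand_of_lt _ _ m hw ?_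
    have : ∑ k, (((β + Pi.single i 1 : ι → ℕ) k : ℕ) : ℝ) = ∑ i, (β i : ℝ) + 1 := by
      simp only [Pi.add_apply, Nat.cast_add, Finset.sum_add_distrib]
      congr 1
      simp [Pi.single_apply]
    rw [this]
    linarith
  have hi1 : ∀ i, IntegrableOn (fun y => Λ.coeff i j * (-(β i : ℂ) *
      Λ.integrand (p + Pi.single j 1) (β + Pi.single i 1) m s w y +
      Λ.integrand (p + Pi.single j 1) β (m + Pi.single i 1) s w y)) (orthant n) := fun i =>
    (((hint' i).const_mul _).add (hint _ _)).const_mul _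
  have hi2 : IntegrableOn (fun y => ∑ i, Λ.coeff i j * (-(β i : ℂ) *
      Λ.integrand (p + Pi.single j 1) (β + Pi.single i 1) m s w y +
      Λ.integrand (p + Pi.single j 1) β (m + Pi.single i 1) s w y)) (orthant n) :=
    integrable_finsetSum _ fun i _ => hi1 i
  have hi3 : IntegrableOn (fun y => (s + p j) * Λ.integrand p β m s w y) (orthant n) :=
    (hint p m).const_mul _
  have hi4 : IntegrableOn (fun y => w j * Λ.integrand (p + Pi.single j 1) β m s w y)
    (orthant n) := (hint _ m).const_mul _
  have hi5 : IntegrableOn (fun y => (s + p j) * Λ.integrand p β m s w y +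
      ∑ i, Λ.coeff i j * (-(β i : ℂ) *
      Λ.integrand (p + Pi.single j 1) (β + Pi.single i 1) m s w y +
      Λ.integrand (p + Pi.single j 1) β (m + Pi.single i 1) s w y)) (orthant n) := hi3.add hi2
  have hD : IntegrableOn (Λ.integrandDeriv p β m j s w) (orthant n) := hi5.sub hi4
  have h0 := integral_eq_zero_of_hasLineDerivAt
    ((integrable_indicator_iff (measurableSet_orthant n)).2 (hint (p + Pi.single j 1) m))
    ((integrable_indicator_iff (measurableSet_orthant n)).2 hD)
    (Λ.hasLineDerivAt_indicator_integrand p β m j hw hs)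
  rw [integral_indicator (measurableSet_orthant n)] at h0
  have hval : ∫ y in orthant n, Λ.integrandDeriv p β m j s w y =
      (s + p j) * Λ.intg p β m s w + (∑ i, Λ.coeff i j *
        (-(β i : ℂ) * Λ.intg (p + Pi.single j 1) (β + Pi.single i 1) m s w +
        Λ.intg (p + Pi.single j 1) β (m + Pi.single i 1) s w)) -
      w j * Λ.intg (p + Pi.single j 1) β m s w := by
    unfold integrandDeriv intg
    rw [integral_sub hi5 hi4, integral_add hi3 hi2, integral_const_mul,
      integral_const_mul, integral_finsetSum _ fun i _ => hi1 i]
    congr 2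
    refine Finset.sum_congr rfl fun i _ => ?_
    rw [integral_const_mul, integral_add ((hint' i).const_mul _) (hint _ _), integral_const_mul]
  rw [hval] at h0
  have hsum : ∑ i, Λ.coeff i j * (β i * Λ.intg (p + Pi.single j 1) (β + Pi.single i 1) m s w -
      Λ.intg (p + Pi.single j 1) β (m + Pi.single i 1) s w) = -∑ i, Λ.coeff i j *
        (-(β i : ℂ) * Λ.intg (p + Pi.single j 1) (β + Pi.single i 1) m s w +
        Λ.intg (p + Pi.single j 1) β (m + Pi.single i 1) s w) := by
    rw [← Finset.sum_neg_distrib]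
    exact Finset.sum_congr rfl fun i _ => by ring
  rw [hsum]
  linear_combination h0

/-- Multiplying and dividing by the `i`-th linear form. -/
theorem intg_eq_sum (p : Fin n → ℕ) (β m : ι → ℕ) (i : ι) {s : ℂ} {w : Fin n → ℂ}
    (hw : ∀ j, 0 < (w j).re) (hs : ∑ i, (β i : ℝ) + 2 ≤ s.re) :
    Λ.intg p β m s w =
      ∑ j, Λ.coeff i j * Λ.intg (p + Pi.single j 1) (β + Pi.single i 1) m s w := by
  have hint' : ∀ j, IntegrableOn (Λ.integrand (p + Pi.single j 1) (β + Pi.single i 1) m s w)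
      (orthant n) := by
    intro j
    refine Λ.integrableOn_integrand_of_lt _ _ m hw ?_
    have : ∑ k, (((β + Pi.single i 1 : ι → ℕ) k : ℕ) : ℝ) = ∑ i, (β i : ℝ) + 1 := by
      simp only [Pi.add_apply, Nat.cast_add, Finset.sum_add_distrib]
      congr 1
      simp [Pi.single_apply]
    rw [this]
    linarith
  unfold intg
  simp only [← integral_const_mul]
  rw [← integral_finsetSum _ fun j _ => (hint' j).const_mul _]
  refine setIntegral_congr_fun (measurableSet_orthant n) fun y hy => ?_
  simp only [Λ.integrand_add_single p _ m s w hy, integrand_add_single_form]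
  have h0 := Λ.form_ne_zero i hy
  have : ∑ j, Λ.coeff i j * (y j * ((Λ.form i y)⁻¹ * Λ.integrand p β m s w y)) =
      Λ.form i y * ((Λ.form i y)⁻¹ * Λ.integrand p β m s w y) := by
    rw [form, Finset.sum_mul]
    exact Finset.sum_congr rfl fun j _ => by ring
  rw [this, mul_inv_cancel_left₀ h0]

/-- Integration by parts along the scaling of the variables in `A`. -/
theorem card_mul_add_excess_mul_intg (A : Finset (Fin n)) (p : Fin n → ℕ) (β m : ι → ℕ) {s : ℂ}
    {w : Fin n → ℂ} (hw : ∀ j, 0 < (w j).re) (hs : ∑ i, (β i : ℝ) + 2 ≤ s.re) :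
    (A.card * s + Λ.excess A p β) * Λ.intg p β m s w =
      ∑ j ∈ A, ((∑ i with ¬ Λ.supp i ⊆ A, (Λ.coeff i j * β i) *
          Λ.intg (p + Pi.single j 1) (β + Pi.single i 1) m s w) +
        (∑ i, (-Λ.coeff i j) * Λ.intg (p + Pi.single j 1) β (m + Pi.single i 1) s w) +
        w j * Λ.intg (p + Pi.single j 1) β m s w) := by
  have hsum : ∑ j ∈ A, (s + p j) * Λ.intg p β m s w = ∑ j ∈ A,
      ((∑ i, (Λ.coeff i j * β i) * Λ.intg (p + Pi.single j 1) (β + Pi.single i 1) m s w) +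
        (∑ i, (-Λ.coeff i j) * Λ.intg (p + Pi.single j 1) β (m + Pi.single i 1) s w) +
        w j * Λ.intg (p + Pi.single j 1) β m s w) := by
    refine Finset.sum_congr rfl fun j _ => ?_
    rw [Λ.add_mul_intg p β m j hw hs, ← Finset.sum_add_distrib]
    congr 1
    exact Finset.sum_congr rfl fun i _ => by ring
  -- For a form supported in A the sum over j ∈ A rebuilds the entire form, which cancels the
  -- additional power in the denominator. These terms thus return multiples of the original integral
  -- and supply the negative part of the excess.
  have hinner : ∑ j ∈ A, ∑ i with Λ.supp i ⊆ A, (Λ.coeff i j * β i) *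
      Λ.intg (p + Pi.single j 1) (β + Pi.single i 1) m s w =
      (∑ i with Λ.supp i ⊆ A, (β i : ℂ)) * Λ.intg p β m s w := by
    rw [Finset.sum_comm, Finset.sum_mul]
    refine Finset.sum_congr rfl fun i hi => ?_
    rw [Λ.intg_eq_sum p β m i hw hs, Finset.mul_sum]
    have hi' : Λ.supp i ⊆ A := (Finset.mem_filter.1 hi).2
    rw [← Finset.sum_subset (Finset.subset_univ A)]
    · exact Finset.sum_congr rfl fun j _ => by ring
    · intro j _ hj
      have : Λ.coeff i j = 0 := by
        by_contra h
        exact hj (hi' (Λ.mem_supp.2 h))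
      simp [this]
  have hsplit : ∀ j, ∑ i, (Λ.coeff i j * β i) *
      Λ.intg (p + Pi.single j 1) (β + Pi.single i 1) m s w =
      (∑ i with Λ.supp i ⊆ A, (Λ.coeff i j * β i) *
        Λ.intg (p + Pi.single j 1) (β + Pi.single i 1) m s w) +
      ∑ i with ¬ Λ.supp i ⊆ A, (Λ.coeff i j * β i) *
        Λ.intg (p + Pi.single j 1) (β + Pi.single i 1) m s w := fun j =>
    (Finset.sum_filter_add_sum_filter_not _ _ _).symm
  simp only [hsplit, add_assoc] at hsum
  rw [Finset.sum_add_distrib, hinner, ← Finset.sum_mul, Finset.sum_add_distrib,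
    Finset.sum_const, nsmul_eq_mul] at hsum
  simp only [add_assoc]
  rw [excess]
  push_cast
  linear_combination hsum

theorem excess_add_single_form (B : Finset (Fin n)) (p : Fin n → ℕ) (β : ι → ℕ) (i : ι) (k : ℕ) :
    Λ.excess B p (β + Pi.single i k) = Λ.excess B p β - if Λ.supp i ⊆ B then (k : ℤ) else 0 := by
  simp only [excess, Pi.add_apply, Nat.cast_add, Finset.sum_add_distrib]
  have : ∑ l with Λ.supp l ⊆ B, (((Pi.single i k : ι → ℕ) l : ℕ) : ℤ) =
      if Λ.supp i ⊆ B then (k : ℤ) else 0 := by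
    simp [Pi.single_apply, Finset.sum_ite_eq']
  rw [this]
  ring

end FormFamily

end ShintaniBarnes

/-! ### Continuation of the orthant integrals by induction over sets of variables -/

namespace ShintaniBarnes

open FormFamily

/-- The rational numbers with a denominator between `q` and `n`, other than `0, -1, -2, …`. -/
def poleCandidates (q n : ℕ) : Set ℂ :=
  {z | (∃ a b : ℤ, (q : ℤ) ≤ b ∧ b ≤ n ∧ 0 < b ∧ z = (a : ℂ) / (b : ℂ)) ∧ ∀ l : ℕ, z ≠ -(l : ℂ)}

/-- `F` continues meromorphically to `Re s > -K`, with poles of order at most `c` at the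
integers `0, -1, …, -(T - 1)` and all other poles among the pole candidates. -/
def Continuable (q n K T c : ℕ) (F : ℂ → (Fin n → ℂ) → ℂ) : Prop :=
  ∃ R : ℂ → ℂ, Differentiable ℂ R ∧ (∀ z, R z = 0 → z ∈ poleCandidates q n) ∧
    ∃ E : ℂ × (Fin n → ℂ) → ℂ, DifferentiableOn ℂ E (paramDomain n (-(K : ℝ))) ∧
      ∃ b : ℝ, ∀ (s : ℂ) (w : Fin n → ℂ), b < s.re → (∀ j, 0 < (w j).re) →
        (∏ l ∈ Finset.range T, (s + l)) ^ c * R s * F s w = E (s, w)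

namespace Continuable

variable {q n K T c : ℕ} {F G : ℂ → (Fin n → ℂ) → ℂ}

/-- Only large Re s matters, so identities obtained by integration by parts in that range may be
used freely. -/
theorem congr (hF : Continuable q n K T c F) {b : ℝ}
    (h : ∀ (s : ℂ) (w : Fin n → ℂ), b < s.re → (∀ j, 0 < (w j).re) → G s w = F s w) :
    Continuable q n K T c G := by
  obtain ⟨R, hR, hR0, E, hE, b', hb'⟩ := hF
  refine ⟨R, hR, hR0, E, hE, max b b', fun s w hs hw => ?_⟩
  rw [h s w ((le_max_left _ _).trans_lt hs) hw, hb' s w ((le_max_right _ _).trans_lt hs) hw]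

theorem add (hF : Continuable q n K T c F) (hG : Continuable q n K T c G) :
    Continuable q n K T c fun s w => F s w + G s w := by
  obtain ⟨R, hR, hR0, E, hE, b, hb⟩ := hF
  obtain ⟨R', hR', hR0', E', hE', b', hb'⟩ := hG
  refine ⟨fun s => R s * R' s, hR.mul hR', fun z hz => ?_,
    fun x => R' x.1 * E x + R x.1 * E' x, ?_, max b b', fun s w hs hw => ?_⟩
  · rcases mul_eq_zero.1 hz with h | h
    · exact hR0 z h
    · exact hR0' z h
  · refine DifferentiableOn.add (DifferentiableOn.mul ?_ hE) (DifferentiableOn.mul ?_ hE')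
    · exact (hR'.comp differentiable_fst).differentiableOn
    · exact (hR.comp differentiable_fst).differentiableOn
  · have h1 := hb s w ((le_max_left _ _).trans_lt hs) hw
    have h2 := hb' s w ((le_max_right _ _).trans_lt hs) hw
    beta_reduce
    linear_combination R' s * h1 + R s * h2

theorem zero : Continuable q n K T c fun _ _ => 0 :=
  ⟨fun _ => 1, differentiable_const _, fun z hz => absurd hz one_ne_zero, fun _ => 0,
    differentiableOn_const _, 0, fun s w _ _ => by simp⟩

theorem sum {α : Type*} (S : Finset α) {F : α → ℂ → (Fin n → ℂ) → ℂ}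
    (hF : ∀ a ∈ S, Continuable q n K T c (F a)) :
    Continuable q n K T c fun s w => ∑ a ∈ S, F a s w := by
  classical
  induction S using Finset.induction_on with
  | empty => simpa using zero
  | insert a S ha ih =>
    simp only [Finset.sum_insert ha]
    exact (hF a (Finset.mem_insert_self a S)).add
      (ih fun b hb => hF b (Finset.mem_insert_of_mem hb))

theorem mul {φ : ℂ × (Fin n → ℂ) → ℂ} (hφ : Differentiable ℂ φ) (hF : Continuable q n K T c F) :
    Continuable q n K T c fun s w => φ (s, w) * F s w := by
  obtain ⟨R, hR, hR0, E, hE, b, hb⟩ := hF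
  refine ⟨R, hR, hR0, fun x => φ x * E x, hφ.differentiableOn.mul hE, b, fun s w hs hw => ?_⟩
  have h1 := hb s w hs hw
  beta_reduce
  linear_combination φ (s, w) * h1

theorem const_mul (a : ℂ) (hF : Continuable q n K T c F) :
    Continuable q n K T c fun s w => a * F s w :=
  hF.mul (φ := fun _ => a) (differentiable_const a)

/-- The product of the factors `b s + e`, `d ≤ e < T`, divides the product of the factors
`s + l`, `0 ≤ l < T`, up to a function whose zeros are pole candidates. -/
theorem exists_factor (q n T : ℕ) {b : ℕ} (hb : 0 < b) (hbn : b ≤ n) {d : ℤ}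
    (h : q ≤ b ∨ b = 1 ∧ 0 ≤ d) :
    ∃ R U : ℂ → ℂ, Differentiable ℂ R ∧ Differentiable ℂ U ∧
      (∀ z, R z = 0 → z ∈ poleCandidates q n) ∧
      ∀ s : ℂ, (∏ l ∈ Finset.range T, (s + l)) * R s =
        (∏ e ∈ Finset.Ico d T, (b * s + e)) * U s := by
  classical
  -- The factor b s + e vanishes at -e/b. The e of the form b l with l ≥ 0 give b (s + l), and l ≤ b
  -- l < T makes s + l a factor of the product over l < T. The remaining e make up R.
  set J : Finset ℕ := (Finset.range T).filter fun l => (b * l : ℤ) ∈ Finset.Ico d (T : ℤ) with hJ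
  set I : Finset ℤ := (Finset.Ico d (T : ℤ)).filter fun e => ¬ ∃ l : ℕ, e = b * l with hI
  have hb0 : (b : ℂ) ≠ 0 := by exact_mod_cast hb.ne'
  refine ⟨fun s => ∏ e ∈ I, (b * s + e),
    fun s => ((b : ℂ) ^ J.card)⁻¹ * ∏ l ∈ Finset.range T \ J, (s + l), by fun_prop, by fun_prop,
    fun z hz => ?_, fun s => ?_⟩
  · obtain ⟨e, he, hze⟩ := Finset.prod_eq_zero_iff.1 hz
    simp only [hI, Finset.mem_filter, Finset.mem_Ico] at he
    have hz : z = ((-e : ℤ) : ℂ) / ((b : ℤ) : ℂ) := by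
      push_cast
      rw [eq_div_iff hb0]
      linear_combination hze
    refine ⟨⟨-e, b, ?_, by exact_mod_cast hbn, by exact_mod_cast hb, hz⟩, fun l hl => ?_⟩
    · rcases h with h | ⟨h1, h2⟩
      · exact_mod_cast h
      -- For b = 1 and d ≥ 0 every e is a natural number, so there are no remaining e; this is why
      -- no lower bound q ≤ b is needed in that case.
      · refine absurd ⟨e.toNat, ?_⟩ he.2
        rw [h1, Int.toNat_of_nonneg (h2.trans he.1.1)]
        simp
    · refine he.2 ⟨l, ?_⟩
      rw [hl] at hze
      have : (e : ℂ) = ((b * l : ℤ) : ℂ) := by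
        push_cast
        linear_combination hze
      exact_mod_cast this
  · have h1 : ∏ e ∈ Finset.Ico d (T : ℤ), ((b : ℂ) * s + e) =
        (∏ l ∈ J, ((b : ℂ) * (s + l))) * ∏ e ∈ I, ((b : ℂ) * s + e) := by
      rw [← Finset.prod_filter_mul_prod_filter_not (Finset.Ico d (T : ℤ)) fun e => ∃ l : ℕ, e = b * l]
      congr 1
      symm
      refine Finset.prod_bij (fun l _ => (b * l : ℤ)) (fun l hl => ?_) (fun l _ l' _ hll => ?_)
        (fun e he => ?_) fun l _ => ?_
      · exact Finset.mem_filter.2 ⟨(Finset.mem_filter.1 hl).2, l, rfl⟩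
      · have hb' : (b : ℤ) ≠ 0 := by exact_mod_cast hb.ne'
        exact_mod_cast mul_left_cancel₀ hb' hll
      · obtain ⟨he1, l, rfl⟩ := Finset.mem_filter.1 he
        refine ⟨l, Finset.mem_filter.2 ⟨Finset.mem_range.2 ?_, he1⟩, rfl⟩
        have h2 := (Finset.mem_Ico.1 he1).2
        have h3 : b * l < T := by exact_mod_cast h2
        exact lt_of_le_of_lt (Nat.le_mul_of_pos_left l hb) h3
      · push_cast
        ring
    have h2 : ∏ l ∈ Finset.range T, (s + (l : ℂ)) =
        (∏ l ∈ Finset.range T \ J, (s + (l : ℂ))) * ∏ l ∈ J, (s + (l : ℂ)) :=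
      (Finset.prod_sdiff (Finset.filter_subset _ _)).symm
    rw [h1, h2, Finset.prod_mul_distrib, Finset.prod_const]
    field_simp

/-- The factors b s + e are distinct, so one further power of the product of the s + l accounts for
all their zeros at nonpositive integers. -/
theorem of_factor_mul {b : ℕ} (hb : 0 < b) (hbn : b ≤ n) {d : ℤ} (h : q ≤ b ∨ b = 1 ∧ 0 ≤ d)
    (hF : Continuable q n K T c fun s w => (∏ e ∈ Finset.Ico d T, (b * s + e)) * F s w) :
    Continuable q n K T (c + 1) F := by
  obtain ⟨R', U, hR', hU, hR0', hfac⟩ := exists_factor q n T hb hbn h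
  obtain ⟨R, hR, hR0, E, hE, b', hb'⟩ := hF
  refine ⟨fun s => R s * R' s, hR.mul hR', fun z hz => ?_, fun x => U x.1 * E x, ?_, b',
    fun s w hs hw => ?_⟩
  · rcases mul_eq_zero.1 hz with h | h
    · exact hR0 z h
    · exact hR0' z h
  · exact ((hU.comp differentiable_fst).differentiableOn).mul hE
  · have h1 := hb' s w hs hw
    beta_reduce at h1 ⊢
    linear_combination (∏ l ∈ Finset.range T, (s + (l : ℂ))) ^ c * R s * F s w * hfac s + U s * h1

end Continuable

namespace FormFamily

variable {ι : Type} {n : ℕ} (Λ : FormFamily ι n) [Fintype ι] [DecidableEq ι] {q K T : ℕ}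

/-- Induction on the deficit of the excess of A below T. Each integration by parts along A consumes
one factor |A| s + e, raises the excess of A by one and lowers no other excess. -/
theorem continuable_factor_mul_intg {c : ℕ} {A : Finset (Fin n)} (k : ℕ) :
    ∀ (p : Fin n → ℕ) (β m : ι → ℕ), (T - Λ.excess A p β).toNat = k →
      (∀ (p' : Fin n → ℕ) (β' m' : ι → ℕ), (∀ B, Λ.excess B p β ≤ Λ.excess B p' β') →
        T ≤ Λ.excess A p' β' → Continuable q n K T c (Λ.intg p' β' m')) →
      Continuable q n K T c fun s w =>
        (∏ e ∈ Finset.Ico (Λ.excess A p β) T, (A.card * s + e)) * Λ.intg p β m s w := by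
  induction k with
  | zero =>
    intro p β m hk H
    have hT : (T : ℤ) ≤ Λ.excess A p β := by
      have := Int.toNat_eq_zero.1 hk
      linarith
    simpa [Finset.Ico_eq_empty_of_le hT] using H p β m (fun B => le_rfl) hT
  | succ k ih =>
    intro p β m hk H
    have hT : Λ.excess A p β < T := by
      by_contra hcon
      rw [Int.toNat_eq_zero.2 (by linarith)] at hk
      exact absurd hk (Nat.succ_ne_zero k).symm
    have hterm : ∀ (p' : Fin n → ℕ) (β' m' : ι → ℕ),
        (∀ B, Λ.excess B p β ≤ Λ.excess B p' β') → Λ.excess A p' β' = Λ.excess A p β + 1 →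
        Continuable q n K T c fun s w =>
          (∏ e ∈ Finset.Ico (Λ.excess A p β + 1) T, (A.card * s + e)) * Λ.intg p' β' m' s w := by
      intro p' β' m' hle hA
      rw [← hA]
      refine ih p' β' m' ?_ fun p'' β'' m'' h1 h2 => H p'' β'' m'' (fun B => (hle B).trans (h1 B)) h2
      omega
    have hsum : Continuable q n K T c fun s w => ∑ j ∈ A,
        ((∑ i with ¬ Λ.supp i ⊆ A, (Λ.coeff i j * β i) *
          ((∏ e ∈ Finset.Ico (Λ.excess A p β + 1) T, (A.card * s + e)) *
            Λ.intg (p + Pi.single j 1) (β + Pi.single i 1) m s w)) +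
        (∑ i, (-Λ.coeff i j) *
          ((∏ e ∈ Finset.Ico (Λ.excess A p β + 1) T, (A.card * s + e)) *
            Λ.intg (p + Pi.single j 1) β (m + Pi.single i 1) s w)) +
        w j * ((∏ e ∈ Finset.Ico (Λ.excess A p β + 1) T, (A.card * s + e)) *
            Λ.intg (p + Pi.single j 1) β m s w)) := by
      refine Continuable.sum _ fun j hj => ((Continuable.sum _ fun i hi => ?_).add
        (Continuable.sum _ fun i _ => ?_)).add ?_
      · have hi' : ¬ Λ.supp i ⊆ A := (Finset.mem_filter.1 hi).2
        by_cases hij : j ∈ Λ.supp i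
        -- The additional denominator counts for B only if the support of i lies in B; then j lies
        -- in B too and the new y_j compensates. For B = A there is only the gain.
        · refine (hterm _ _ _ (fun B => ?_) ?_).const_mul _
          · rw [excess_add_single_form, excess_add_single]
            by_cases h1 : Λ.supp i ⊆ B
            · simp [h1, h1 hij]
            · rw [if_neg h1]
              split_ifs <;> simp
          · rw [excess_add_single_form, excess_add_single, if_pos hj, if_neg hi', sub_zero]
        · have : Λ.coeff i j = 0 := by
            by_contra h
            exact hij (Λ.mem_supp.2 h)
          simpa [this] using Continuable.zero
      · refine (hterm _ _ _ (fun B => ?_) ?_).const_mul _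
        · rw [excess_add_single]
          split_ifs <;> simp
        · rw [excess_add_single, if_pos hj]
      · refine (hterm _ _ _ (fun B => ?_) ?_).mul (φ := fun x => x.2 j) (by fun_prop)
        · rw [excess_add_single]
          split_ifs <;> simp
        · rw [excess_add_single, if_pos hj]
    refine hsum.congr (b := ∑ i, (β i : ℝ) + 2) fun s w hs hw => ?_
    have hIco : Finset.Ico (Λ.excess A p β) (T : ℤ) =
        insert (Λ.excess A p β) (Finset.Ico (Λ.excess A p β + 1) (T : ℤ)) := by
      ext e
      simp only [Finset.mem_Ico, Finset.mem_insert]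
      omega
    rw [hIco, Finset.prod_insert (by simp), mul_right_comm,
      Λ.card_mul_add_excess_mul_intg A p β m hw hs.le, Finset.sum_mul]
    refine Finset.sum_congr rfl fun j _ => ?_
    rw [add_mul, add_mul, Finset.sum_mul, Finset.sum_mul]
    refine congr_arg₂ _ (congr_arg₂ _ ?_ ?_) (by ring)
    · exact Finset.sum_congr rfl fun i _ => by ring
    · exact Finset.sum_congr rfl fun i _ => by ring

/-- One round of the induction: the excess of A may be assumed to be at least T, at the cost of one
more power of the integer factors. -/
theorem continuable_intg_of_excess {c : ℕ} {A : Finset (Fin n)} (hA : A.Nonempty)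
    {p : Fin n → ℕ} {β : ι → ℕ} (m : ι → ℕ)
    (h : q ≤ A.card ∨ A.card = 1 ∧ 0 ≤ Λ.excess A p β)
    (H : ∀ (p' : Fin n → ℕ) (β' m' : ι → ℕ), (∀ B, Λ.excess B p β ≤ Λ.excess B p' β') →
        T ≤ Λ.excess A p' β' → Continuable q n K T c (Λ.intg p' β' m')) :
    Continuable q n K T (c + 1) (Λ.intg p β m) :=
  Continuable.of_factor_mul hA.card_pos (by simpa using A.card_le_univ) h
    (Λ.continuable_factor_mul_intg _ p β m rfl H)

/-- Multiplies and divides by the k-th power of ∑_{j ∈ A} y_j and expands the numerator into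
monomials of degree k. -/
theorem continuable_intg_of_insert {c : ℕ} {A : Finset (Fin n)} {i : ι} (hi : Λ.supp i = A)
    (hi1 : ∀ j ∈ A, Λ.coeff i j = 1) (m : ι → ℕ) (k : ℕ) :
    ∀ (p : Fin n → ℕ) (β : ι → ℕ), (∀ r : Fin n → ℕ, (∀ j, j ∉ A → r j = 0) → ∑ j ∈ A, r j = k →
      Continuable q n K T c (Λ.intg (p + r) (β + Pi.single i k) m)) →
      Continuable q n K T c (Λ.intg p β m) := by
  induction k with
  | zero =>
    intro p β H
    simpa using H 0 (by simp) (by simp)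
  | succ k ih =>
    intro p β H
    have hsum : Continuable q n K T c fun s w =>
        ∑ j ∈ A, Λ.intg (p + Pi.single j 1) (β + Pi.single i 1) m s w := by
      refine Continuable.sum _ fun j hj => ih _ _ fun r hr hrk => ?_
      have := H (Pi.single j 1 + r) (fun l hl => ?_) ?_
      · rw [add_assoc, add_assoc, ← Pi.single_add, add_comm 1 k]
        exact this
      · have hlj : l ≠ j := fun h => hl (h ▸ hj)
        simp [hr l hl, hlj]
      · simp only [Pi.add_apply, Finset.sum_add_distrib, hrk]
        simp [Pi.single_apply, hj, add_comm]
    refine hsum.congr (b := ∑ i, (β i : ℝ) + 2) fun s w hs hw => ?_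
    rw [Λ.intg_eq_sum p β m i hw hs.le, ← Finset.sum_subset (Finset.subset_univ A)]
    · exact Finset.sum_congr rfl fun j hj => by rw [hi1 j hj, one_mul]
    · intro j _ hj
      have : Λ.coeff i j = 0 := by
        by_contra h
        exact hj (hi ▸ Λ.mem_supp.2 h)
      simp [this]

/-- Induction on |A|, where every nonempty set not contained in A already has excess at least T. For
A = ∅ the integral is holomorphic in Re s > -K, because T ≥ nK. Otherwise some j ∈ A is found such
that, after one round of integration by parts, every subset of A through j has excess at least T;
then A without j takes the place of A. No step lowers an excess, so the bound by X persists. The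
auxiliary forms required by `hΛ` are what makes such a j available when A contains a support. -/
theorem continuable_intg (hq : ∀ i, q ≤ (Λ.supp i).card)
    (hΛ : ∀ (A : Finset (Fin n)) (i : ι), Λ.supp i ⊆ A →
      ∃ i', Λ.supp i' = A ∧ ∀ j ∈ A, Λ.coeff i' j = 1)
    (hT : n * K ≤ T) (X : ℕ) (k : ℕ) :
    ∀ (A : Finset (Fin n)), A.card = k → ∀ (p : Fin n → ℕ) (β m : ι → ℕ),
      (∀ B, -(X : ℤ) ≤ Λ.excess B p β) →
      (∀ B : Finset (Fin n), B.Nonempty → ¬ B ⊆ A → T ≤ Λ.excess B p β) →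
      Continuable q n K T k (Λ.intg p β m) := by
  induction k with
  | zero =>
    intro A hA p β m _ hB
    rw [Finset.card_eq_zero] at hA
    subst hA
    refine ⟨fun _ => 1, differentiable_const _, fun z hz => absurd hz one_ne_zero, _,
      Λ.differentiableOn_intg p β m fun B hBn => ?_, 0, fun s w _ _ => by simp⟩
    have h1 : (T : ℤ) ≤ Λ.excess B p β :=
      hB B hBn fun h => hBn.ne_empty (Finset.subset_empty.1 h)
    have h2 : (T : ℝ) ≤ Λ.excess B p β := by exact_mod_cast h1
    have h3 : (B.card : ℝ) ≤ n := by exact_mod_cast (by simpa using B.card_le_univ)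
    have h4 : ((n : ℝ) * K) ≤ T := by exact_mod_cast hT
    nlinarith [(Nat.cast_nonneg K : (0 : ℝ) ≤ K)]
  | succ k ih =>
    intro A hA p β m hX hB
    have hAn : A.Nonempty := Finset.card_pos.1 (by omega)
    by_cases hspec : ∃ i, Λ.supp i ⊆ A
    · obtain ⟨i₀, hi₀⟩ := hspec
      obtain ⟨i, hi, hi1⟩ := hΛ A i₀ hi₀
      -- By the pigeonhole principle a monomial of degree n (T + X) contains some y_j to a power of
      -- at least T + X, which lifts every set through j not containing A from at least -X to at
      -- least T. The excess of A itself is unchanged and is raised by parts.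
      refine Λ.continuable_intg_of_insert hi hi1 m (n * (T + X)) p β fun r hr hrk => ?_
      obtain ⟨j, hj, hrj⟩ : ∃ j ∈ A, T + X ≤ r j := by
        refine Finset.exists_le_of_sum_le hAn ?_
        rw [hrk, Finset.sum_const, smul_eq_mul]
        exact Nat.mul_le_mul_right _ (by simpa using A.card_le_univ)
      have hexc : ∀ B, Λ.excess B (p + r) (β + Pi.single i (n * (T + X))) =
          Λ.excess B p β + ∑ l ∈ B, (r l : ℤ) - if A ⊆ B then ((n * (T + X) : ℕ) : ℤ) else 0 := by
        intro B
        rw [excess_add_single_form, hi]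
        simp only [excess, Pi.add_apply, Nat.cast_add, Finset.sum_add_distrib]
        ring
      have hrA : ∀ B, A ⊆ B → ∑ l ∈ B, (r l : ℤ) = ((n * (T + X) : ℕ) : ℤ) := by
        intro B hAB
        rw [← hrk, ← Finset.sum_subset hAB fun l _ hl => by simp [hr l hl]]
        push_cast
        rfl
      have hrnn : ∀ B : Finset (Fin n), 0 ≤ ∑ l ∈ B, (r l : ℤ) := fun B =>
        Finset.sum_nonneg fun _ _ => by positivity
      have hmono : ∀ B, Λ.excess B p β ≤ Λ.excess B (p + r) (β + Pi.single i (n * (T + X))) := by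
        intro B
        rw [hexc]
        split_ifs with h
        · rw [hrA B h]; linarith
        · linarith [hrnn B]
      have hbig : ∀ B, j ∈ B → ¬ A ⊆ B →
          (T : ℤ) ≤ Λ.excess B (p + r) (β + Pi.single i (n * (T + X))) := by
        intro B hjB hAB
        rw [hexc, if_neg hAB]
        have h1 : (r j : ℤ) ≤ ∑ l ∈ B, (r l : ℤ) :=
          Finset.single_le_sum (f := fun l => (r l : ℤ)) (fun _ _ => by positivity) hjB
        have h2 : (T : ℤ) + X ≤ r j := by exact_mod_cast hrj
        linarith [hX B]
      refine Λ.continuable_intg_of_excess hAn m (Or.inl ((hq i).trans_eq (by rw [hi])))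
        fun p' β' m' hle hTA => ?_
      refine ih (A.erase j) (by rw [Finset.card_erase_of_mem hj]; omega) p' β' m'
        (fun B => (hX B).trans ((hmono B).trans (hle B))) fun B hBn hBA => ?_
      by_cases hBA' : B ⊆ A
      · have hjB : j ∈ B := by
          by_contra hjB
          exact hBA (Finset.subset_erase.2 ⟨hBA', hjB⟩)
        by_cases hAB : A ⊆ B
        · rwa [Finset.Subset.antisymm hBA' hAB]
        · exact (hbig B hjB hAB).trans (hle B)
      · exact (hB B hBn hBA').trans ((hmono B).trans (hle B))
    -- No form is supported in A, so the excess of a subset of A is just the degree of the monomial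
    -- there. It suffices to raise p_j for one variable j, and the factors s + e then have e ≥ 0.
    · push Not at hspec
      have hexc : ∀ B ⊆ A, ∀ (p : Fin n → ℕ) (β : ι → ℕ),
          Λ.excess B p β = ∑ j ∈ B, (p j : ℤ) := by
        intro B hBA p β
        have : (Finset.univ.filter fun i => Λ.supp i ⊆ B) = ∅ :=
          Finset.filter_eq_empty_iff.2 fun i _ h => hspec i (h.trans hBA)
        rw [excess, this, Finset.sum_empty, sub_zero]
      obtain ⟨j, hj⟩ := hAn
      have hjA : ({j} : Finset (Fin n)) ⊆ A := Finset.singleton_subset_iff.2 hj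
      refine Λ.continuable_intg_of_excess (Finset.singleton_nonempty j) m
        (Or.inr ⟨Finset.card_singleton j, by simp [hexc _ hjA]⟩) fun p' β' m' hle hTj => ?_
      refine ih (A.erase j) (by rw [Finset.card_erase_of_mem hj]; omega) p' β' m'
        (fun B => (hX B).trans (hle B)) fun B hBn hBA => ?_
      by_cases hBA' : B ⊆ A
      · have hjB : j ∈ B := by
          by_contra hjB
          exact hBA (Finset.subset_erase.2 ⟨hBA', hjB⟩)
        rw [hexc _ hjA, Finset.sum_singleton] at hTj
        rw [hexc B hBA']
        exact hTj.trans (Finset.single_le_sum (f := fun l => (p' l : ℤ))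
          (fun _ _ => by positivity) hjB)
      · exact (hB B hBn hBA').trans (hle B)

end FormFamily

end ShintaniBarnes

/-! ### The function v / (1 - exp(-v)) and the forms given by the rows -/

namespace ShintaniBarnes

/-- The entire function `(1 - exp (-v)) / v`. -/
noncomputable def expSlope (v : ℂ) : ℂ := dslope (fun v => -Complex.exp (-v)) 0 v

theorem expSlope_zero : expSlope 0 = 1 := by
  rw [expSlope, dslope_same]
  have h : HasDerivAt (fun v : ℂ => -Complex.exp (-v)) (-(Complex.exp (-0) * -1)) 0 :=
    ((hasDerivAt_neg (0 : ℂ)).cexp).neg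
  rw [h.deriv]
  simp

theorem mul_expSlope (v : ℂ) : v * expSlope v = 1 - Complex.exp (-v) := by
  have h := sub_smul_dslope (fun v : ℂ => -Complex.exp (-v)) 0 v
  simp only [sub_zero, smul_eq_mul, neg_zero, Complex.exp_zero, sub_neg_eq_add] at h
  rw [expSlope, h]
  ring

theorem differentiable_expSlope : Differentiable ℂ expSlope := by
  rw [← differentiableOn_univ]
  exact (Complex.differentiableOn_dslope univ_mem).2 (by fun_prop)

theorem norm_exp_neg_lt_one {v : ℂ} (hv : 0 < v.re) : ‖Complex.exp (-v)‖ < 1 := by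
  rw [Complex.norm_exp, Complex.neg_re, Real.exp_lt_one_iff]
  linarith

theorem one_sub_exp_neg_ne_zero {v : ℂ} (hv : 0 < v.re) : 1 - Complex.exp (-v) ≠ 0 := by
  intro h
  have := norm_exp_neg_lt_one hv
  rw [← sub_eq_zero.1 h, norm_one] at this
  exact lt_irrefl _ this

theorem expSlope_ne_zero {v : ℂ} (hv : 0 < v.re) : expSlope v ≠ 0 := by
  intro h
  have := mul_expSlope v
  rw [h, mul_zero] at this
  exact one_sub_exp_neg_ne_zero hv this.symm

/-- The function `v / (1 - exp (-v))`, without its removable singularity. -/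
noncomputable def todd (v : ℂ) : ℂ := (expSlope v)⁻¹

theorem inv_mul_todd (v : ℂ) : v⁻¹ * todd v = (1 - Complex.exp (-v))⁻¹ := by
  rw [todd, ← mul_inv, mul_expSlope]

theorem isOpen_expSlope_ne_zero : IsOpen {v | expSlope v ≠ 0} :=
  isOpen_ne_fun differentiable_expSlope.continuous continuous_const

theorem differentiableOn_todd : DifferentiableOn ℂ todd {v | expSlope v ≠ 0} :=
  differentiable_expSlope.differentiableOn.inv fun _ hv => hv

theorem differentiableOn_iteratedDeriv_todd (m : ℕ) :
    DifferentiableOn ℂ (iteratedDeriv m todd) {v | expSlope v ≠ 0} := by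
  induction m with
  | zero => simpa using differentiableOn_todd
  | succ m ih =>
    rw [iteratedDeriv_succ]
    exact ih.deriv isOpen_expSlope_ne_zero

theorem hasDerivAt_iteratedDeriv_todd (m : ℕ) {v : ℂ} (hv : 0 < v.re) :
    HasDerivAt (iteratedDeriv m todd) (iteratedDeriv (m + 1) todd v) v := by
  rw [iteratedDeriv_succ]
  exact ((differentiableOn_iteratedDeriv_todd m).differentiableAt
    (isOpen_expSlope_ne_zero.mem_nhds (expSlope_ne_zero hv))).hasDerivAt

/-- The derivatives of `todd` grow at most linearly in a sector. -/
theorem exists_norm_iteratedDeriv_todd_le (m : ℕ) (c : ℝ) :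
    ∃ C : ℝ, 0 ≤ C ∧ ∀ v : ℂ, |v.im| ≤ c * v.re → 0 < v.re →
      ‖iteratedDeriv m todd v‖ ≤ C * (1 + ‖v‖) := by
  -- The truncated sector is compact and meets the imaginary axis only at 0, where `expSlope` is 1.
  -- A closed thickening of it therefore avoids the zeros of `expSlope` and contains Cauchy discs of
  -- a fixed radius δ.
  set S : Set ℂ := {v | |v.im| ≤ c * v.re ∧ 0 ≤ v.re ∧ v.re ≤ 2} with hS
  have hSsub : S ⊆ {v | expSlope v ≠ 0} := by
    rintro v ⟨h1, h2, -⟩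
    rcases h2.eq_or_lt with h | h
    · have hv : v = 0 := by
        rw [← h, mul_zero] at h1
        exact Complex.ext h.symm (abs_eq_zero.1 (le_antisymm h1 (abs_nonneg _)))
      rw [hv, mem_ofPred_eq, expSlope_zero]
      exact one_ne_zero
    · exact expSlope_ne_zero h
  have hSclosed : IsClosed S := by
    have h1 : IsClosed {v : ℂ | |v.im| ≤ c * v.re} := isClosed_le (by fun_prop) (by fun_prop)
    have h2 : IsClosed {v : ℂ | 0 ≤ v.re} := isClosed_le (by fun_prop) (by fun_prop)
    have h3 : IsClosed {v : ℂ | v.re ≤ 2} := isClosed_le (by fun_prop) (by fun_prop)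
    exact h1.inter (h2.inter h3)
  have hScomp : IsCompact S := by
    refine Metric.isCompact_of_isClosed_isBounded hSclosed
      ((Metric.isBounded_closedBall (x := (0 : ℂ)) (r := 2 + |c| * 2)).subset ?_)
    rintro v ⟨h1, h2, h3⟩
    rw [mem_closedBall_zero_iff]
    refine (Complex.norm_le_abs_re_add_abs_im v).trans (add_le_add ?_ (h1.trans ?_))
    · rwa [abs_of_nonneg h2]
    · exact mul_le_mul (le_abs_self c) h3 h2 (abs_nonneg c)
  obtain ⟨δ, hδ, hδsub⟩ := hScomp.exists_cthickening_subset_open isOpen_expSlope_ne_zero hSsub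
  obtain ⟨B, hB⟩ := (hScomp.cthickening (r := δ)).exists_bound_of_continuousOn
    (differentiableOn_todd.continuousOn.mono hδsub)
  refine ⟨max (m.factorial * |B| / δ ^ m) (m.factorial * 4), le_max_of_le_right (by positivity),
    fun v hv hv0 => ?_⟩
  rcases le_total v.re 2 with h2 | h2
  · have hvS : v ∈ S := ⟨hv, hv0.le, h2⟩
    have hball : Metric.closedBall v δ ⊆ Metric.cthickening δ S :=
      Metric.closedBall_subset_cthickening hvS δ
    have h := Complex.norm_iteratedDeriv_le_of_forall_mem_sphere_norm_le m hδ
      ((differentiableOn_todd.mono (hball.trans hδsub)).diffContOnCl_ball le_rfl)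
      fun z hz => (hB z (hball (Metric.sphere_subset_closedBall hz))).trans (le_abs_self B)
    refine h.trans ((le_max_left _ _).trans (le_mul_of_one_le_right ?_ ?_))
    · exact le_max_of_le_right (by positivity)
    · linarith [norm_nonneg v]
  -- Far to the right the unit disc at v stays in Re z ≥ 1, where exp(-z) has norm at most 1/2 and
  -- `todd` z has norm at most 2 ‖z‖.
  · have hre : ∀ z ∈ Metric.closedBall v 1, 1 ≤ z.re := fun z hz => by
      have h1 : |(z - v).re| ≤ 1 := (Complex.abs_re_le_norm _).trans (by
        rwa [Metric.mem_closedBall, dist_eq_norm] at hz)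
      rw [Complex.sub_re] at h1
      linarith [(abs_le.1 h1).1]
    have h := Complex.norm_iteratedDeriv_le_of_forall_mem_sphere_norm_le
      (C := 4 * (1 + ‖v‖)) (f := todd) m one_pos
      ((differentiableOn_todd.mono fun z hz => expSlope_ne_zero
        (zero_lt_one.trans_le (hre z hz))).diffContOnCl_ball le_rfl)
      fun z hz => by
        have hz' := Metric.sphere_subset_closedBall hz
        have hz0 : 0 < z.re := zero_lt_one.trans_le (hre z hz')
        have hz1 : z ≠ 0 := fun h => by simp [h] at hz0
        have hexp : ‖Complex.exp (-z)‖ ≤ 1 / 2 := by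
          rw [Complex.norm_exp, Complex.neg_re]
          refine (Real.exp_le_exp.2 (neg_le_neg (hre z hz'))).trans ?_
          rw [Real.exp_neg, one_div]
          exact inv_anti₀ two_pos (by linarith [Real.add_one_le_exp (1 : ℝ)])
        have h1 : 1 / 2 ≤ ‖1 - Complex.exp (-z)‖ := by
          have := norm_sub_norm_le (1 : ℂ) (Complex.exp (-z))
          rw [norm_one] at this
          linarith
        have h2 : todd z = z * (1 - Complex.exp (-z))⁻¹ := by
          rw [← inv_mul_todd z, mul_inv_cancel_left₀ hz1]
        have h3 : ‖z‖ ≤ 1 + ‖v‖ := by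
          have := norm_sub_norm_le z v
          rw [Metric.mem_closedBall, dist_eq_norm] at hz'
          linarith
        rw [h2, norm_mul, norm_inv]
        have h4 : ‖1 - Complex.exp (-z)‖⁻¹ ≤ 2 := by
          simpa using inv_anti₀ (by norm_num) h1
        calc ‖z‖ * ‖1 - Complex.exp (-z)‖⁻¹ ≤ (1 + ‖v‖) * 2 := by gcongr
          _ ≤ _ := by linarith [norm_nonneg v]
    refine h.trans ?_
    rw [one_pow, div_one, ← mul_assoc]
    exact mul_le_mul_of_nonneg_right (le_max_right _ _) (by positivity)

/-- Coefficients that vanish or have positive real part keep the form in a fixed sector, away from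
the poles of `todd` on the imaginary axis; there the linear bound holds and is absorbed by the
exponential. -/
theorem exists_norm_iteratedDeriv_todd_form_le {n : ℕ} (a : Fin n → ℂ)
    (ha : ∀ j, a j = 0 ∨ 0 < (a j).re) (ha0 : ∃ j, a j ≠ 0) (m : ℕ) {δ : ℝ} (hδ : 0 < δ) :
    ∃ C : ℝ, ∀ y ∈ orthant n,
      ‖iteratedDeriv m todd (∑ j, a j * (y j : ℂ))‖ ≤ C * Real.exp (δ * ∑ j, y j) := by
  have hre : ∀ j, 0 ≤ (a j).re := fun j => by
    rcases ha j with h | h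
    · simp [h]
    · exact h.le
  -- A vanishing coefficient contributes 0 / 0 = 0.
  set c : ℝ := ∑ j, |(a j).im| / (a j).re with hc
  have him : ∀ j, |(a j).im| ≤ c * (a j).re := fun j => by
    rcases ha j with h | h
    · simp [h]
    · rw [← div_le_iff₀ h]
      exact Finset.single_le_sum (f := fun j => |(a j).im| / (a j).re)
        (fun l _ => div_nonneg (abs_nonneg _) (hre l)) (Finset.mem_univ j)
  obtain ⟨C, hC, hCle⟩ := exists_norm_iteratedDeriv_todd_le m c
  set A : ℝ := ∑ j, ‖a j‖ with hA
  have hA0 : 0 ≤ A := Finset.sum_nonneg fun _ _ => norm_nonneg _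
  refine ⟨C * (1 + A / δ), fun y hy => ?_⟩
  rw [mem_orthant] at hy
  set Y := ∑ j, y j with hY
  have hY0 : 0 ≤ Y := Finset.sum_nonneg fun j _ => (hy j).le
  have h1 : ‖∑ j, a j * (y j : ℂ)‖ ≤ A * Y := by
    refine (norm_sum_le _ _).trans ?_
    rw [hA, Finset.sum_mul]
    refine Finset.sum_le_sum fun j _ => ?_
    rw [norm_mul, Complex.norm_real, Real.norm_of_nonneg (hy j).le]
    exact mul_le_mul_of_nonneg_left
      (Finset.single_le_sum (f := y) (fun l _ => (hy l).le) (Finset.mem_univ j)) (norm_nonneg _)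
  have hre' : (∑ j, a j * (y j : ℂ)).re = ∑ j, (a j).re * y j := by simp
  have him' : (∑ j, a j * (y j : ℂ)).im = ∑ j, (a j).im * y j := by simp
  have h2 : |(∑ j, a j * (y j : ℂ)).im| ≤ c * (∑ j, a j * (y j : ℂ)).re := by
    rw [hre', him', Finset.mul_sum]
    refine (Finset.abs_sum_le_sum_abs _ _).trans (Finset.sum_le_sum fun j _ => ?_)
    rw [abs_mul, abs_of_pos (hy j), ← mul_assoc]
    exact mul_le_mul_of_nonneg_right (him j) (hy j).le
  have h3 : 0 < (∑ j, a j * (y j : ℂ)).re := by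
    obtain ⟨j, hj⟩ := ha0
    rw [hre']
    exact (mul_pos ((ha j).resolve_left hj) (hy j)).trans_le
      (Finset.single_le_sum (f := fun j => (a j).re * y j)
        (fun l _ => mul_nonneg (hre l) (hy l).le) (Finset.mem_univ j))
  refine (hCle _ h2 h3).trans ?_
  rw [mul_assoc]
  refine mul_le_mul_of_nonneg_left ?_ hC
  have h4 : 1 ≤ Real.exp (δ * Y) := Real.one_le_exp (by positivity)
  have h5 : δ * Y ≤ Real.exp (δ * Y) := by linarith [Real.add_one_le_exp (δ * Y)]
  have h6 : A * Y = A / δ * (δ * Y) := by field_simp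
  have h7 : A / δ * (δ * Y) ≤ A / δ * Real.exp (δ * Y) :=
    mul_le_mul_of_nonneg_left h5 (by positivity)
  nlinarith

variable {N n : ℕ}

/-- The support of a row. -/
noncomputable def rowSupp (M : Matrix (Fin N) (Fin n) ℂ) (i : Fin N) : Finset (Fin n) :=
  Finset.univ.filter fun j => M i j ≠ 0

/-- The sets of columns that contain the support of a row. -/
@[ext]
structure SpecialSet (M : Matrix (Fin N) (Fin n) ℂ) : Type where
  /-- The set of columns. -/
  carrier : Finset (Fin n)
  exists_subset : ∃ i, rowSupp M i ⊆ carrier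

noncomputable instance (M : Matrix (Fin N) (Fin n) ℂ) : Fintype (SpecialSet M) :=
  haveI : Finite (SpecialSet M) :=
    Finite.of_injective SpecialSet.carrier fun _ _ h => SpecialSet.ext h
  Fintype.ofFinite _

noncomputable instance (M : Matrix (Fin N) (Fin n) ℂ) : DecidableEq (SpecialSet M) :=
  Classical.decEq _

open Classical in
/-- The rows of `M`, with the function `todd` attached, and the indicators of the special sets, with
the constant `1` attached. -/
noncomputable def rowFamily {M : Matrix (Fin N) (Fin n) ℂ} (hM : HypothesisH M) :
    FormFamily (Fin N ⊕ SpecialSet M) n where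
  coeff := Sum.elim (fun i j => M i j) fun A j => if j ∈ A.carrier then 1 else 0
  coeff_eq_zero_or := by
    rintro (i | A) j
    · exact hM.entry i j
    · by_cases h : j ∈ A.carrier <;> simp [h]
  exists_coeff_ne_zero := by
    rintro (i | ⟨A, i, hi⟩)
    · exact hM.row i
    · obtain ⟨j, hj⟩ := hM.row i
      exact ⟨j, by simp [hi (show j ∈ rowSupp M i by simp [rowSupp, hj])]⟩
  func := Sum.elim (fun _ m => iteratedDeriv m todd) fun _ m _ => if m = 0 then 1 else 0
  hasDerivAt_func := by
    rintro (i | A) m v hv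
    · exact hasDerivAt_iteratedDeriv_todd m hv
    · simpa using hasDerivAt_const v (if m = 0 then (1 : ℂ) else 0)
  bound_func := by
    rintro (i | A) m δ hδ
    · exact exists_norm_iteratedDeriv_todd_form_le (M i) (hM.entry i) (hM.row i) m hδ
    · refine ⟨1, fun y hy => ?_⟩
      rw [mem_orthant] at hy
      have h1 : 0 ≤ ∑ j, y j := Finset.sum_nonneg fun j _ => (hy j).le
      have h2 : 1 ≤ Real.exp (δ * ∑ j, y j) := Real.one_le_exp (by positivity)
      by_cases hm : m = 0 <;> simp [hm, h2, Real.exp_nonneg]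

theorem card_le_rowSupp {M : Matrix (Fin N) (Fin n) ℂ} (i : Fin N) :
    n - maxZeros M ≤ (rowSupp M i).card := by
  have h1 : (Finset.univ.filter fun j => M i j = 0).card ≤ maxZeros M :=
    Finset.le_sup (f := fun i : Fin N => (Finset.univ.filter fun j : Fin n => M i j = 0).card)
      (Finset.mem_univ i)
  have h2 := Finset.card_filter_add_card_filter_not (s := (Finset.univ : Finset (Fin n)))
    (fun j => M i j = 0)
  rw [Finset.card_univ, Fintype.card_fin] at h2
  have h3 : (Finset.univ.filter fun j => ¬ M i j = 0) = rowSupp M i := rfl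
  rw [h3] at h2
  omega

/-- The exponents of the linear forms in the integral representation of the zeta function. -/
def rowExponent (M : Matrix (Fin N) (Fin n) ℂ) : Fin N ⊕ SpecialSet M → ℕ :=
  Sum.elim (fun _ => 1) fun _ => 0

/-- The induction starts from the set of all variables. Special sets contain the support of a row,
so they have at least n - Z elements, and they are closed under enlargement, as the induction
requires. -/
theorem continuable_intg_rowFamily {M : Matrix (Fin N) (Fin n) ℂ} (hM : HypothesisH M) {K T : ℕ}
    (hT : n * K ≤ T) :
    Continuable (n - maxZeros M) n K T n ((rowFamily hM).intg 0 (rowExponent M) 0) := by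
  classical
  have hsupp1 : ∀ i : Fin N, (rowFamily hM).supp (Sum.inl i) = rowSupp M i := fun i => rfl
  have hsupp2 : ∀ A : SpecialSet M, (rowFamily hM).supp (Sum.inr A) = A.carrier := fun A => by
    ext j
    rw [FormFamily.mem_supp]
    by_cases h : j ∈ A.carrier <;> simp [rowFamily, h]
  refine (rowFamily hM).continuable_intg ?_ ?_ hT (∑ i, rowExponent M i) n Finset.univ (by simp)
    0 (rowExponent M) 0 ?_ ?_
  · rintro (i | ⟨A, i, hi⟩)
    · rw [hsupp1]
      exact card_le_rowSupp i
    · rw [hsupp2]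
      exact (card_le_rowSupp i).trans (Finset.card_le_card hi)
  · intro A i hi
    have hA : ∃ i, rowSupp M i ⊆ A := by
      rcases i with i | ⟨B, i, hB⟩
      · exact ⟨i, hsupp1 i ▸ hi⟩
      · rw [hsupp2] at hi
        exact ⟨i, hB.trans hi⟩
    refine ⟨Sum.inr ⟨A, hA⟩, hsupp2 _, fun j hj => ?_⟩
    simp [rowFamily, hj]
  · intro B
    simp only [FormFamily.excess, Pi.zero_apply, Nat.cast_zero, Finset.sum_const_zero, zero_sub,
      neg_le_neg_iff]
    push_cast
    exact Finset.sum_le_sum_of_subset_of_nonneg (Finset.filter_subset _ _) fun _ _ _ => by positivity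
  · intro B _ h
    exact absurd (Finset.subset_univ B) h

/-- The auxiliary forms enter with exponent 0 and the function 1, so they are invisible at the
start. -/
theorem integrand_rowFamily {M : Matrix (Fin N) (Fin n) ℂ} (hM : HypothesisH M) (s : ℂ)
    (w : Fin n → ℂ) (y : Fin n → ℝ) :
    (rowFamily hM).integrand 0 (rowExponent M) 0 s w y =
      (∏ j, (y j : ℂ) ^ (s - 1)) *
        (∏ i, (1 - Complex.exp (-∑ j, M i j * (y j : ℂ)))⁻¹) *
        Complex.exp (-∑ j, w j * (y j : ℂ)) := by
  have h1 : ∀ i, ((rowFamily hM).form (Sum.inl i) y ^ rowExponent M (Sum.inl i))⁻¹ *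
      (rowFamily hM).func (Sum.inl i) 0 ((rowFamily hM).form (Sum.inl i) y) =
      (1 - Complex.exp (-∑ j, M i j * (y j : ℂ)))⁻¹ := fun i => by
    have := inv_mul_todd ((rowFamily hM).form (Sum.inl i) y)
    simpa [rowExponent, rowFamily, FormFamily.form] using this
  have h2 : ∀ A, ((rowFamily hM).form (Sum.inr A) y ^ rowExponent M (Sum.inr A))⁻¹ *
      (rowFamily hM).func (Sum.inr A) 0 ((rowFamily hM).form (Sum.inr A) y) = 1 := fun A => by
    simp [rowExponent, rowFamily]
  simp only [FormFamily.integrand, Fintype.prod_sum_type, Pi.zero_apply, h1, h2, Finset.prod_const_one,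
    mul_one, Nat.cast_zero, add_zero]

end ShintaniBarnes

/-! ### Convergence of the Dirichlet series -/

namespace ShintaniBarnes

theorem summable_norm_pi_prod_and_tsum {R : Type*} [NormedField R] [CompleteSpace R] (N : ℕ) :
    ∀ f : Fin N → ℕ → R, (∀ i, Summable fun k => ‖f i k‖) →
      (Summable fun k : Fin N → ℕ => ‖∏ i, f i (k i)‖) ∧
        ∑' k : Fin N → ℕ, ∏ i, f i (k i) = ∏ i, ∑' k, f i k := by
  induction N with
  | zero =>
    intro f _
    exact ⟨Summable.of_finite, by simp⟩
  | succ N ih =>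
    intro f hf
    obtain ⟨h1, h2⟩ := ih (fun i => f i.succ) fun i => hf i.succ
    have h3 := (hf 0).mul_norm h1
    have h4 := tsum_mul_tsum_of_summable_norm (hf 0) h1
    set e : ℕ × (Fin N → ℕ) ≃ (Fin (N + 1) → ℕ) := Fin.consEquiv fun _ => ℕ with he
    have h5 : ∀ x : ℕ × (Fin N → ℕ), ∏ i, f i (e x i) = f 0 x.1 * ∏ i : Fin N, f i.succ (x.2 i) := by
      intro x
      rw [Fin.prod_univ_succ]
      simp [he, Fin.consEquiv]
    refine ⟨?_, ?_⟩
    · rw [← e.summable_iff]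
      exact h3.congr fun x => by rw [Function.comp_apply, h5]
    · rw [← e.tsum_eq, Fin.prod_univ_succ, ← h2, h4]
      exact tsum_congr h5

theorem summable_prod_one_add_rpow (N : ℕ) {ρ : ℝ} (hρ : 1 < ρ) :
    Summable fun k : Fin N → ℕ => ∏ i, (1 + (k i : ℝ)) ^ (-ρ) := by
  have h1 : Summable fun k : ℕ => ‖(1 + (k : ℝ)) ^ (-ρ)‖ := by
    refine ((Real.summable_one_div_nat_add_rpow 1 ρ).2 hρ).congr fun k => ?_
    have : (0 : ℝ) < 1 + k := by positivity
    rw [Real.norm_of_nonneg (Real.rpow_nonneg this.le _), Real.rpow_neg this.le, one_div,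
      add_comm (k : ℝ) 1, abs_of_pos this]
  exact (summable_norm_pi_prod_and_tsum N (fun _ (k : ℕ) => (1 + (k : ℝ)) ^ (-ρ))
    fun _ => h1).1.of_norm

variable {N n : ℕ} {M : Matrix (Fin N) (Fin n) ℂ}

theorem maxZeros_le (M : Matrix (Fin N) (Fin n) ℂ) : maxZeros M ≤ n :=
  Finset.sup_le fun i _ => (Finset.card_filter_le _ _).trans (by simp)

theorem abscissa_eq (M : Matrix (Fin N) (Fin n) ℂ) :
    abscissa M = (N : ℝ) / ((n - maxZeros M : ℕ) : ℝ) := by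
  rw [abscissa, Nat.cast_sub (maxZeros_le M)]

theorem abscissa_nonneg (M : Matrix (Fin N) (Fin n) ℂ) : 0 ≤ abscissa M := by
  rw [abscissa_eq]
  positivity

theorem HypothesisH.entry_re_nonneg (hM : HypothesisH M) (i : Fin N) (j : Fin n) :
    0 ≤ (M i j).re := by
  rcases hM.entry i j with h | h
  · simp [h]
  · exact h.le

theorem HypothesisH.maxZeros_lt (hM : HypothesisH M) (hN : 0 < N) : 0 < n - maxZeros M := by
  have : Nonempty (Fin N) := ⟨⟨0, hN⟩⟩
  obtain ⟨i, -, hi⟩ := Finset.exists_mem_eq_sup (Finset.univ : Finset (Fin N))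
    Finset.univ_nonempty fun i => (Finset.univ.filter fun j : Fin n => M i j = 0).card
  obtain ⟨j, hj⟩ := hM.row i
  have h1 : (Finset.univ.filter fun j : Fin n => M i j = 0).card < n := by
    calc _ < (Finset.univ : Finset (Fin n)).card :=
          Finset.card_lt_card (Finset.filter_ssubset.2 ⟨j, Finset.mem_univ j, hj⟩)
      _ = n := by simp
  have h2 : maxZeros M = _ := hi
  omega

/-- A lower bound for the product of the linear forms. -/
theorem HypothesisH.prod_rpow_le (hM : HypothesisH M) {b : Fin n → ℝ} {k : Fin N → ℝ}
    (hk : ∀ i, 0 ≤ k i) (hb1 : ∀ j, 1 ≤ b j) (hb : ∀ i j, M i j ≠ 0 → 1 + k i ≤ b j) {σ : ℝ}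
    (hσ : 0 ≤ σ) :
    ∏ j, b j ^ (-σ) ≤ ∏ i, (1 + k i) ^ (-(σ * (n - maxZeros M : ℕ) / N)) := by
  have hb0 : ∀ j, 0 < b j := fun j => one_pos.trans_le (hb1 j)
  rcases Nat.eq_zero_or_pos N with hN | hN
  · subst hN
    simp only [Finset.univ_eq_empty, Finset.prod_empty]
    exact Finset.prod_le_one (fun j _ => Real.rpow_nonneg (hb0 j).le _) fun j _ =>
      Real.rpow_le_one_of_one_le_of_nonpos (hb1 j) (by linarith)
  have : Nonempty (Fin N) := ⟨⟨0, hN⟩⟩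
  -- Only the row with the largest k_i is used: at least n - Z of the b_j are at least 1 + k_i. The
  -- resulting power of 1 + k_i is distributed evenly over N factors and compared with the 1 + k_l,
  -- which are smaller or equal.
  obtain ⟨i, -, hi⟩ := Finset.exists_max_image (Finset.univ : Finset (Fin N)) k Finset.univ_nonempty
  have h1 : 1 ≤ 1 + k i := by linarith [hk i]
  have h0 : 0 < 1 + k i := by linarith
  have hN0 : (N : ℝ) ≠ 0 := by exact_mod_cast hN.ne'
  set q := n - maxZeros M with hq
  calc ∏ j, b j ^ (-σ) ≤ ∏ j, if M i j ≠ 0 then (1 + k i) ^ (-σ) else 1 := by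
        refine Finset.prod_le_prod (fun j _ => Real.rpow_nonneg (hb0 j).le _) fun j _ => ?_
        split_ifs with h
        · exact Real.rpow_le_rpow_of_nonpos h0 (hb i j h) (by linarith)
        · exact Real.rpow_le_one_of_one_le_of_nonpos (hb1 j) (by linarith)
    _ = ((1 + k i) ^ (-σ)) ^ (rowSupp M i).card := by
        rw [Finset.prod_ite, Finset.prod_const_one, mul_one, Finset.prod_const]
        rfl
    _ ≤ ((1 + k i) ^ (-σ)) ^ q :=
        pow_le_pow_of_le_one (Real.rpow_nonneg h0.le _)
          (Real.rpow_le_one_of_one_le_of_nonpos h1 (by linarith)) (card_le_rowSupp i)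
    _ = ∏ _l : Fin N, (1 + k i) ^ (-(σ * q / N)) := by
        rw [Finset.prod_const, Finset.card_univ, Fintype.card_fin, ← Real.rpow_natCast,
          ← Real.rpow_natCast, ← Real.rpow_mul h0.le, ← Real.rpow_mul h0.le]
        congr 1
        field_simp
    _ ≤ _ := by
        refine Finset.prod_le_prod (fun l _ => Real.rpow_nonneg h0.le _) fun l _ => ?_
        refine Real.rpow_le_rpow_of_nonpos (by linarith [hk l])
          (by linarith [hi l (Finset.mem_univ l)]) ?_
        have : 0 ≤ σ * q / N := by positivity
        linarith

/-- Uniform convergence of the series and of the integral. -/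
theorem HypothesisH.exists_prod_re_rpow_le (hM : HypothesisH M) {w : Fin n → ℂ}
    (hw : ∀ j, 0 < (w j).re) {σ₁ : ℝ} (hσ₁ : abscissa M < σ₁) (σ₂ : ℝ) :
    ∃ ρ : ℝ, 1 < ρ ∧ ∃ C : ℝ, 0 ≤ C ∧ ∀ σ : ℝ, σ₁ ≤ σ → σ ≤ σ₂ → ∀ k : Fin N → ℝ, (∀ i, 0 ≤ k i) →
      ∏ j, ((w j).re + ∑ i, k i * (M i j).re) ^ (-σ) ≤ C * ∏ i, (1 + k i) ^ (-ρ) := by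
  classical
  have hσ₁0 : 0 < σ₁ := (abscissa_nonneg M).trans_lt hσ₁
  -- A common lower bound for the Re w_j and the real parts of the nonzero entries. The condition c
  -- ≤ 1 makes c^(-σ) increasing in σ, hence at most c^(-σ₂).
  obtain ⟨c, hc0, hc1, hcw, hcM⟩ : ∃ c : ℝ, 0 < c ∧ c ≤ 1 ∧ (∀ j, c ≤ (w j).re) ∧
      ∀ i j, M i j ≠ 0 → c ≤ (M i j).re := by
    have hfin : ∀ {α : Type} [Fintype α] (f : α → ℝ), (∀ a, 0 < f a) → ∃ c, 0 < c ∧ ∀ a, c ≤ f a := by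
      intro α _ f hf
      rcases isEmpty_or_nonempty α with h | h
      · exact ⟨1, one_pos, fun a => isEmptyElim a⟩
      · obtain ⟨a, -, ha⟩ := Finset.exists_min_image (Finset.univ : Finset α) f Finset.univ_nonempty
        exact ⟨f a, hf a, fun b => ha b (Finset.mem_univ b)⟩
    obtain ⟨c₁, h1, h1'⟩ := hfin (fun j => (w j).re) hw
    obtain ⟨c₂, h2, h2'⟩ := hfin (fun x : Fin N × Fin n => if M x.1 x.2 = 0 then 1 else (M x.1 x.2).re)
      fun x => by
        by_cases h : M x.1 x.2 = 0
        · simp [h]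
        · simpa [h] using (hM.entry x.1 x.2).resolve_left h
    refine ⟨min 1 (min c₁ c₂), by positivity, min_le_left _ _,
      fun j => (min_le_right _ _).trans ((min_le_left _ _).trans (h1' j)), fun i j h => ?_⟩
    refine (min_le_right _ _).trans ((min_le_right _ _).trans ?_)
    simpa [h] using h2' (i, j)
  obtain ⟨ρ, hρ, hle⟩ : ∃ ρ : ℝ, 1 < ρ ∧ ∀ k : Fin N → ℝ, (∀ i, 0 ≤ k i) →
      ∏ i, (1 + k i) ^ (-(σ₁ * (n - maxZeros M : ℕ) / N)) ≤ ∏ i, (1 + k i) ^ (-ρ) := by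
    rcases Nat.eq_zero_or_pos N with hN | hN
    · subst hN
      -- For N = 0 the products are empty, so any exponent above 1 will do.
      exact ⟨2, by norm_num, fun k _ => by simp⟩
    · refine ⟨_, ?_, fun k _ => le_rfl⟩
      have hq : (0 : ℝ) < (n - maxZeros M : ℕ) := by exact_mod_cast hM.maxZeros_lt hN
      have hN' : (0 : ℝ) < N := by exact_mod_cast hN
      rw [abscissa_eq, div_lt_iff₀ hq] at hσ₁
      rwa [one_lt_div hN']
  refine ⟨ρ, hρ, (c ^ (-σ₂)) ^ n, by positivity, fun σ h1 h2 k hk => ?_⟩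
  set b : Fin n → ℝ := fun j => 1 + ∑ i, if M i j = 0 then 0 else k i with hb
  have hb1 : ∀ j, 1 ≤ b j := fun j => by
    have : 0 ≤ ∑ i, if M i j = 0 then 0 else k i :=
      Finset.sum_nonneg fun i _ => by split_ifs; exacts [le_rfl, hk i]
    simp only [hb]
    linarith
  have hbk : ∀ i j, M i j ≠ 0 → 1 + k i ≤ b j := fun i j h => by
    have := Finset.single_le_sum (f := fun i => if M i j = 0 then 0 else k i)
      (fun i _ => by split_ifs; exacts [le_rfl, hk i]) (Finset.mem_univ i)
    simp only [h, if_false] at this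
    simp only [hb]
    linarith
  have hcb : ∀ j, c * b j ≤ (w j).re + ∑ i, k i * (M i j).re := fun j => by
    simp only [hb]
    rw [mul_add, mul_one, Finset.mul_sum]
    refine add_le_add (hcw j) (Finset.sum_le_sum fun i _ => ?_)
    split_ifs with h
    · simp [h]
    · rw [mul_comm]
      exact mul_le_mul_of_nonneg_left (hcM i j h) (hk i)
  calc ∏ j, ((w j).re + ∑ i, k i * (M i j).re) ^ (-σ)
      ≤ ∏ j, (c ^ (-σ₂) * b j ^ (-σ₁)) := by
        have hb0 : ∀ j, 0 < b j := fun j => one_pos.trans_le (hb1 j)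
        refine Finset.prod_le_prod (fun j _ => Real.rpow_nonneg
          ((mul_pos hc0 (hb0 j)).le.trans (hcb j)) _) fun j _ => ?_
        calc _ ≤ (c * b j) ^ (-σ) :=
              Real.rpow_le_rpow_of_nonpos (mul_pos hc0 (hb0 j)) (hcb j) (by linarith)
          _ = c ^ (-σ) * b j ^ (-σ) := Real.mul_rpow hc0.le (hb0 j).le
          _ ≤ _ := by
            refine mul_le_mul ?_ ?_ (Real.rpow_nonneg (hb0 j).le _) (Real.rpow_nonneg hc0.le _)
            · exact Real.rpow_le_rpow_of_exponent_ge hc0 hc1 (by linarith)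
            · exact Real.rpow_le_rpow_of_exponent_le (hb1 j) (by linarith)
    _ = (c ^ (-σ₂)) ^ n * ∏ j, b j ^ (-σ₁) := by
        rw [Finset.prod_mul_distrib, Finset.prod_const, Finset.card_univ, Fintype.card_fin]
    _ ≤ _ := by
        refine mul_le_mul_of_nonneg_left ?_ (by positivity)
        exact (hM.prod_rpow_le hk hb1 hbk hσ₁0.le).trans (hle k hk)

/-- The summand of the series, or the integrand of the integral. -/
noncomputable def summand (M : Matrix (Fin N) (Fin n) ℂ) (s : ℂ) (w : Fin n → ℂ) (t : Fin N → ℝ) : ℂ :=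
  ∏ j, (w j + ∑ i, (t i : ℂ) * M i j) ^ (-s)

theorem zetaSeries_eq (M : Matrix (Fin N) (Fin n) ℂ) (s : ℂ) (w : Fin n → ℂ) :
    zetaSeries M s w = ∑' k : Fin N → ℕ, summand M s w fun i => k i := by
  simp [zetaSeries, summand]

theorem base_re (w : Fin n → ℂ) (t : Fin N → ℝ) (j : Fin n) :
    (w j + ∑ i, (t i : ℂ) * M i j).re = (w j).re + ∑ i, t i * (M i j).re := by
  simp

theorem HypothesisH.base_re_pos (hM : HypothesisH M) {w : Fin n → ℂ} (hw : ∀ j, 0 < (w j).re)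
    {t : Fin N → ℝ} (ht : ∀ i, 0 ≤ t i) (j : Fin n) : 0 < (w j + ∑ i, (t i : ℂ) * M i j).re := by
  rw [base_re]
  exact add_pos_of_pos_of_nonneg (hw j)
    (Finset.sum_nonneg fun i _ => mul_nonneg (ht i) (hM.entry_re_nonneg i j))

/-- The argument of z and the imaginary part of s cost at most exp(π ‖s‖), which is locally bounded
in s, so convergence reduces to real data. -/
theorem norm_cpow_neg_le {z : ℂ} (hz : 0 < z.re) {s : ℂ} (hs : 0 ≤ s.re) :
    ‖z ^ (-s)‖ ≤ z.re ^ (-s.re) * Real.exp (Real.pi * ‖s‖) := by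
  have hz0 : z ≠ 0 := fun h => by simp [h] at hz
  have h1 : -(Complex.arg z * (-s).im) ≤ Real.pi * ‖s‖ := by
    rw [Complex.neg_im, mul_neg, neg_neg]
    refine (le_abs_self _).trans ?_
    rw [abs_mul]
    exact mul_le_mul (Complex.abs_arg_le_pi z) (Complex.abs_im_le_norm s) (abs_nonneg _)
      Real.pi_pos.le
  rw [Complex.norm_cpow_of_ne_zero hz0, div_eq_mul_inv, ← Real.exp_neg, Complex.neg_re]
  refine mul_le_mul ?_ (Real.exp_le_exp.2 h1) (Real.exp_pos _).le (Real.rpow_nonneg hz.le _)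
  exact Real.rpow_le_rpow_of_nonpos hz (Complex.re_le_norm z) (by linarith)

theorem HypothesisH.exists_norm_summand_le (hM : HypothesisH M) {w : Fin n → ℂ}
    (hw : ∀ j, 0 < (w j).re) {σ₁ : ℝ} (hσ₁ : abscissa M < σ₁) (B : ℝ) :
    ∃ ρ : ℝ, 1 < ρ ∧ ∃ C : ℝ, 0 ≤ C ∧ ∀ s : ℂ, σ₁ ≤ s.re → ‖s‖ ≤ B → ∀ k : Fin N → ℝ,
      (∀ i, 0 ≤ k i) → ‖summand M s w k‖ ≤ C * ∏ i, (1 + k i) ^ (-ρ) := by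
  obtain ⟨ρ, hρ, C, hC, hle⟩ := hM.exists_prod_re_rpow_le hw hσ₁ B
  have hσ₁0 : 0 < σ₁ := (abscissa_nonneg M).trans_lt hσ₁
  refine ⟨ρ, hρ, Real.exp (Real.pi * B) ^ n * C, by positivity, fun s hs hsB k hk => ?_⟩
  rw [summand, norm_prod]
  calc _ ≤ ∏ j, (((w j).re + ∑ i, k i * (M i j).re) ^ (-s.re) * Real.exp (Real.pi * B)) := by
        refine Finset.prod_le_prod (fun _ _ => norm_nonneg _) fun j _ => ?_
        refine (norm_cpow_neg_le (hM.base_re_pos hw hk j) (hσ₁0.le.trans hs)).trans ?_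
        rw [base_re]
        refine mul_le_mul_of_nonneg_left (Real.exp_le_exp.2 ?_) (Real.rpow_nonneg ?_ _)
        · exact mul_le_mul_of_nonneg_left hsB Real.pi_pos.le
        · have := hM.base_re_pos hw hk j
          rw [base_re] at this
          exact this.le
    _ = Real.exp (Real.pi * B) ^ n * ∏ j, ((w j).re + ∑ i, k i * (M i j).re) ^ (-s.re) := by
        rw [Finset.prod_mul_distrib, Finset.prod_const, Finset.card_univ, Fintype.card_fin, mul_comm]
    _ ≤ _ := by
        rw [mul_assoc]
        exact mul_le_mul_of_nonneg_left
          (hle s.re hs ((Complex.re_le_norm s).trans hsB) k hk) (by positivity)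

theorem HypothesisH.summable_norm_summand (hM : HypothesisH M) {w : Fin n → ℂ}
    (hw : ∀ j, 0 < (w j).re) {s : ℂ} (hs : abscissa M < s.re) :
    Summable fun k : Fin N → ℕ => ‖summand M s w fun i => k i‖ := by
  obtain ⟨ρ, hρ, C, -, hle⟩ := hM.exists_norm_summand_le hw hs ‖s‖
  exact Summable.of_nonneg_of_le (fun _ => norm_nonneg _)
    (fun k => hle s le_rfl le_rfl (fun i => k i) fun i => by positivity)
    ((summable_prod_one_add_rpow N hρ).mul_left C)

theorem HypothesisH.differentiable_summand (hM : HypothesisH M) {w : Fin n → ℂ}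
    (hw : ∀ j, 0 < (w j).re) {t : Fin N → ℝ} (ht : ∀ i, 0 ≤ t i) :
    Differentiable ℂ fun s => summand M s w t := by
  unfold summand
  refine Differentiable.fun_finsetProd fun j _ => ?_
  have h : w j + ∑ i, (t i : ℂ) * M i j ≠ 0 := fun h => by
    have := hM.base_re_pos hw ht j
    simp [h] at this
  exact fun s => (differentiableAt_id.neg).const_cpow (Or.inl h)

theorem isOpen_halfPlane (σ : ℝ) : IsOpen {s : ℂ | σ < s.re} :=
  isOpen_lt continuous_const Complex.continuous_re

theorem HypothesisH.analyticOnNhd_zetaSeries (hM : HypothesisH M) {w : Fin n → ℂ}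
    (hw : ∀ j, 0 < (w j).re) :
    AnalyticOnNhd ℂ (fun s => zetaSeries M s w) {s | abscissa M < s.re} := by
  refine DifferentiableOn.analyticOnNhd (fun s hs => ?_) (isOpen_halfPlane _)
  obtain ⟨σ₁, h1, h2⟩ := exists_between (show abscissa M < s.re from hs)
  obtain ⟨ρ, hρ, C, -, hle⟩ := hM.exists_norm_summand_le hw h1 (‖s‖ + 1)
  have hU : IsOpen ({z : ℂ | σ₁ < z.re} ∩ Metric.ball 0 (‖s‖ + 1)) :=
    (isOpen_halfPlane σ₁).inter Metric.isOpen_ball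
  have := Complex.differentiableOn_tsum_of_summable_norm
    (F := fun (k : Fin N → ℕ) s => summand M s w fun i => (k i : ℝ))
    ((summable_prod_one_add_rpow N hρ).mul_left C)
    (fun k => (hM.differentiable_summand hw fun i => by positivity).differentiableOn) hU
    fun k z hz => hle z hz.1.le (mem_ball_zero_iff.1 hz.2).le (fun i => k i) fun i => by positivity
  refine DifferentiableAt.differentiableWithinAt ?_
  simp only [zetaSeries_eq]
  exact this.differentiableAt (hU.mem_nhds ⟨h2, by simp⟩)

end ShintaniBarnes

/-! ### The Mellin integral representation -/

namespace ShintaniBarnes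

theorem integrableOn_cpow_mul_exp_neg {a r : ℂ} (ha : 0 < a.re) (hr : 0 < r.re) :
    IntegrableOn (fun t : ℝ => (t : ℂ) ^ (a - 1) * Complex.exp (-(r * t))) (Ioi 0) := by
  have h1 : IntegrableOn (fun t : ℝ => t ^ (a.re - 1) * Real.exp (-r.re * t ^ (1 : ℝ))) (Ioi 0) :=
    integrableOn_rpow_mul_exp_neg_mul_rpow (by linarith) one_pos hr
  refine Integrable.mono' h1 ?_ ?_
  · refine ContinuousOn.aestronglyMeasurable ?_ measurableSet_Ioi
    refine ContinuousOn.mul (ContinuousOn.cpow (by fun_prop) continuousOn_const fun t ht => ?_)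
      (by fun_prop)
    exact Complex.ofReal_mem_slitPlane.2 ht
  · refine (ae_restrict_mem measurableSet_Ioi).mono fun t ht => ?_
    rw [norm_mul, Complex.norm_cpow_eq_rpow_re_of_pos ht, Complex.norm_exp]
    simp

/-- Both sides are holomorphic in r on the right half-plane and agree for real r > 0, in particular
on a sequence tending to 1; the identity theorem does the rest. -/
theorem integral_cpow_mul_exp_neg_mul_Ioi {a r : ℂ} (ha : 0 < a.re) (hr : 0 < r.re) :
    ∫ t : ℝ in Ioi 0, (t : ℂ) ^ (a - 1) * Complex.exp (-(r * t)) =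
      r ^ (-a) * Complex.Gamma a := by
  set U : Set ℂ := {r | 0 < r.re} with hU
  have hUo : IsOpen U := isOpen_halfPlane 0
  have hne : ∀ r ∈ U, r ∈ Complex.slitPlane := fun r hr => Or.inl hr
  have h1 : DifferentiableOn ℂ
      (fun r : ℂ => ∫ t : ℝ in Ioi 0, (t : ℂ) ^ (a - 1) * Complex.exp (-(r * t))) U := by
    refine differentiableOn_integral_of_dominated hUo
      (fun r hr => (integrableOn_cpow_mul_exp_neg ha hr).aestronglyMeasurable)
      (ae_of_all _ fun t => by fun_prop) fun r hr => ?_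
    have hr' : 0 < r.re := hr
    refine ⟨r.re / 2, by positivity, _, (integrableOn_cpow_mul_exp_neg (a := a)
      (r := ((r.re / 2 : ℝ) : ℂ)) ha (by rw [Complex.ofReal_re]; positivity)).norm,
      (ae_restrict_mem measurableSet_Ioi).mono fun t ht y hy => ?_⟩
    rw [norm_mul, norm_mul]
    refine mul_le_mul_of_nonneg_left ?_ (norm_nonneg _)
    rw [Complex.norm_exp, Complex.norm_exp]
    refine Real.exp_le_exp.2 ?_
    have h2 : |(y - r).re| < r.re / 2 := (Complex.abs_re_le_norm _).trans_lt (by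
      rwa [Metric.mem_ball, dist_eq_norm] at hy)
    rw [Complex.sub_re] at h2
    have h3 := (abs_lt.1 h2).1
    have ht' : 0 < t := ht
    simp only [Complex.neg_re, Complex.mul_re, Complex.ofReal_re, Complex.ofReal_im, mul_zero,
      sub_zero, neg_le_neg_iff]
    exact mul_le_mul_of_nonneg_right (by linarith) ht'.le
  have h2 : DifferentiableOn ℂ (fun r : ℂ => r ^ (-a) * Complex.Gamma a) U := fun r hr =>
    ((differentiableAt_id.cpow_const (hne r hr)).mul_const _).differentiableWithinAt
  have hpre : IsPreconnected U := (convex_halfSpace_re_gt 0).isPreconnected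
  refine (h1.analyticOnNhd hUo).eqOn_of_preconnected_of_frequently_eq (h2.analyticOnNhd hUo) hpre
    (z₀ := 1) (by simp [hU]) ?_ hr
  have hlim : Tendsto (fun m : ℕ => ((1 + 1 / ((m : ℝ) + 1) : ℝ) : ℂ)) atTop (𝓝[≠] 1) := by
    refine tendsto_nhdsWithin_iff.2 ⟨?_, Eventually.of_forall fun m => ?_⟩
    · have := (tendsto_one_div_add_atTop_nhds_zero_nat (𝕜 := ℝ)).const_add 1
      rw [add_zero] at this
      have h := (Complex.continuous_ofReal.tendsto _).comp this
      rwa [Complex.ofReal_one] at h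
    · have : (0 : ℝ) < 1 / ((m : ℝ) + 1) := by positivity
      intro h
      rw [mem_singleton_iff, ← Complex.ofReal_one, Complex.ofReal_inj] at h
      linarith
  refine hlim.frequently (Frequently.of_forall fun m => ?_)
  have hpos : (0 : ℝ) < 1 + 1 / ((m : ℝ) + 1) := by positivity
  rw [Complex.integral_cpow_mul_exp_neg_mul_Ioi ha hpos, Complex.cpow_neg, one_div,
    Complex.inv_cpow]
  rw [Complex.arg_ofReal_of_nonneg hpos.le]
  exact Real.pi_pos.ne

theorem integral_orthant_prod {n : ℕ} {s : ℂ} (hs : 0 < s.re) {b : Fin n → ℂ}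
    (hb : ∀ j, 0 < (b j).re) :
    IntegrableOn (fun y : Fin n → ℝ => ∏ j, ((y j : ℂ) ^ (s - 1) * Complex.exp (-(b j * y j))))
      (orthant n) ∧
    ∫ y in orthant n, ∏ j, ((y j : ℂ) ^ (s - 1) * Complex.exp (-(b j * y j))) =
      Complex.Gamma s ^ n * ∏ j, b j ^ (-s) := by
  rw [IntegrableOn, volume_restrict_orthant]
  refine ⟨Integrable.fintype_prod
    (f := fun j (t : ℝ) => (t : ℂ) ^ (s - 1) * Complex.exp (-(b j * t)))
    fun j => integrableOn_cpow_mul_exp_neg hs (hb j), ?_⟩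
  rw [integral_fintype_prod_eq_prod
    (f := fun j (t : ℝ) => (t : ℂ) ^ (s - 1) * Complex.exp (-(b j * t)))]
  simp only [integral_cpow_mul_exp_neg_mul_Ioi hs (hb _)]
  rw [Finset.prod_mul_distrib, Finset.prod_const, Finset.card_univ, Fintype.card_fin, mul_comm]

variable {N n : ℕ} {M : Matrix (Fin N) (Fin n) ℂ}

theorem prod_cpow_mul_exp_base (s : ℂ) (w : Fin n → ℂ) (t : Fin N → ℝ) (y : Fin n → ℝ) :
    ∏ j, ((y j : ℂ) ^ (s - 1) * Complex.exp (-((w j + ∑ i, (t i : ℂ) * M i j) * y j))) =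
      (∏ j, (y j : ℂ) ^ (s - 1)) * Complex.exp (-∑ j, w j * (y j : ℂ)) *
        ∏ i, Complex.exp (-(t i * ∑ j, M i j * (y j : ℂ))) := by
  rw [Finset.prod_mul_distrib, ← Complex.exp_sum, ← Complex.exp_sum, mul_assoc, ← Complex.exp_add]
  congr 2
  simp only [add_mul, neg_add, Finset.sum_add_distrib, Finset.sum_neg_distrib, Finset.sum_mul,
    Finset.mul_sum]
  rw [Finset.sum_comm]
  simp only [mul_assoc]

/-- The integral representation of the zeta function. -/
theorem HypothesisH.Gamma_pow_mul_zetaSeries (hM : HypothesisH M) {w : Fin n → ℂ}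
    (hw : ∀ j, 0 < (w j).re) {s : ℂ} (hs : abscissa M < s.re) :
    Complex.Gamma s ^ n * zetaSeries M s w = (rowFamily hM).intg 0 (rowExponent M) 0 s w := by
  have hs0 : 0 < s.re := (abscissa_nonneg M).trans_lt hs
  have hs0' : 0 < ((s.re : ℝ) : ℂ).re := by simpa using hs0
  set F : (Fin N → ℕ) → (Fin n → ℝ) → ℂ := fun k y =>
    ∏ j, ((y j : ℂ) ^ (s - 1) *
      Complex.exp (-((w j + ∑ i, (((k i : ℕ) : ℝ) : ℂ) * M i j) * y j))) with hF
  have hpos : ∀ (k : Fin N → ℕ) (j : Fin n),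
      0 < (w j + ∑ i, (((k i : ℕ) : ℝ) : ℂ) * M i j).re := fun k j =>
    hM.base_re_pos hw (t := fun i => (k i : ℝ)) (fun i => by positivity) j
  have hint : ∀ k, IntegrableOn (F k) (orthant n) := fun k =>
    (integral_orthant_prod hs0 (hpos k)).1
  have hval : ∀ k : Fin N → ℕ, ∫ y in orthant n, F k y =
      Complex.Gamma s ^ n * summand M s w fun i => k i := fun k =>
    (integral_orthant_prod hs0 (hpos k)).2
  -- The norm of the integrand is the same integrand with s, w and M replaced by their real parts.
  -- Its integrals are thus summable by the real estimate, which permits exchanging sum and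
  -- integral.
  have hnorm : ∀ k : Fin N → ℕ, ∫ y in orthant n, ‖F k y‖ =
      Real.Gamma s.re ^ n * ∏ j, ((w j).re + ∑ i, (k i : ℝ) * (M i j).re) ^ (-s.re) := by
    intro k
    have hpos' : ∀ j, 0 < (w j).re + ∑ i, (k i : ℝ) * (M i j).re := fun j => by
      have := hpos k j
      rwa [base_re w (fun i => (k i : ℝ))] at this
    have h1 := (integral_orthant_prod hs0'
      (b := fun j => (((w j).re + ∑ i, (k i : ℝ) * (M i j).re : ℝ) : ℂ))
      fun j => by rw [Complex.ofReal_re]; exact hpos' j).2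
    have h2 : ∫ y in orthant n, ∏ j, ((y j : ℂ) ^ (((s.re : ℝ) : ℂ) - 1) *
        Complex.exp (-((((w j).re + ∑ i, (k i : ℝ) * (M i j).re : ℝ) : ℂ) * y j))) =
        ((∫ y in orthant n, ‖F k y‖ : ℝ) : ℂ) := by
      rw [← integral_complex_ofReal]
      refine setIntegral_congr_fun (measurableSet_orthant n) fun y hy => ?_
      rw [mem_orthant] at hy
      simp only [hF, norm_prod, Complex.ofReal_prod]
      refine Finset.prod_congr rfl fun j _ => ?_
      rw [norm_mul, Complex.norm_cpow_eq_rpow_re_of_pos (hy j), Complex.norm_exp, Complex.neg_re,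
        Complex.re_mul_ofReal, base_re w (fun i => (k i : ℝ)), Complex.ofReal_mul,
        Complex.ofReal_cpow (hy j).le, Complex.ofReal_exp]
      simp
    rw [h2] at h1
    rw [← Complex.ofReal_inj, h1, Complex.Gamma_ofReal]
    rw [Complex.ofReal_mul, Complex.ofReal_pow, Complex.ofReal_prod]
    congr 1
    refine Finset.prod_congr rfl fun j _ => ?_
    rw [← Complex.ofReal_neg, ← Complex.ofReal_cpow (hpos' j).le]
  have hsum : Summable fun k => ∫ y in orthant n, ‖F k y‖ := by
    simp only [hnorm]
    refine Summable.mul_left _ ?_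
    obtain ⟨ρ, hρ, C, -, hle⟩ := hM.exists_prod_re_rpow_le hw hs s.re
    refine Summable.of_nonneg_of_le (fun k => ?_)
      (fun k => hle s.re le_rfl le_rfl (fun i => k i) fun i => by positivity)
      ((summable_prod_one_add_rpow N hρ).mul_left C)
    refine Finset.prod_nonneg fun j _ => Real.rpow_nonneg ?_ _
    have := hpos k j
    rw [base_re w (fun i => (k i : ℝ))] at this
    exact this.le
  have hmain := hasSum_integral_of_summable_integral_norm hint hsum
  simp only [hval] at hmain
  rw [zetaSeries_eq, ← tsum_mul_left, hmain.tsum_eq, FormFamily.intg]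
  refine setIntegral_congr_fun (measurableSet_orthant n) fun y hy => ?_
  have hL : ∀ i, 0 < (∑ j, M i j * (y j : ℂ)).re := fun i =>
    (rowFamily hM).form_re_pos (Sum.inl i) hy
  have hgeom : ∀ i, ‖Complex.exp (-∑ j, M i j * (y j : ℂ))‖ < 1 := fun i =>
    norm_exp_neg_lt_one (hL i)
  have hprod := summable_norm_pi_prod_and_tsum N
    (fun i (k : ℕ) => Complex.exp (-∑ j, M i j * (y j : ℂ)) ^ k) fun i => by
      simp only [norm_pow]
      exact summable_geometric_of_lt_one (norm_nonneg _) (hgeom i)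
  rw [integrand_rowFamily]
  simp only [hF, prod_cpow_mul_exp_base s w (fun i => ((_ : ℕ) : ℝ))]
  rw [tsum_mul_left, mul_right_comm]
  congr 2
  -- The sum over k factors into N geometric series with ratios exp(-L_i(y)).
  rw [← Finset.prod_congr rfl fun i _ => tsum_geometric_of_norm_lt_one (hgeom i), ← hprod.2]
  refine tsum_congr fun k => Finset.prod_congr rfl fun i _ => ?_
  rw [← Complex.exp_nat_mul]
  push_cast
  congr 1
  ring

end ShintaniBarnes

/-! ### Continuation of zeta and joint holomorphy outside the polar set -/

namespace ShintaniBarnes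

theorem eventually_ne_zero_nhdsNE {R : ℂ → ℂ} (hR : Differentiable ℂ R) (h0 : ∃ z, R z ≠ 0) (z : ℂ) :
    ∀ᶠ y in 𝓝[≠] z, R y ≠ 0 := by
  have hA : AnalyticOnNhd ℂ R univ := hR.differentiableOn.analyticOnNhd isOpen_univ
  refine ((hA z (mem_univ z)).eventually_eq_zero_or_eventually_ne_zero).resolve_left fun h => ?_
  obtain ⟨y, hy⟩ := h0
  exact hy (hA.eqOn_zero_of_preconnected_of_eventuallyEq_zero isPreconnected_univ (mem_univ z) h
    (mem_univ y))

/-- A function that continues after multiplication with entire functions has a meromorphic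
continuation. -/
theorem exists_isMeromorphicContinuation_of_mul {f : ℂ → ℂ} {σ : ℝ}
    (hf : AnalyticOnNhd ℂ f {s | σ < s.re})
    (h : ∀ K : ℕ, ∃ R Ψ : ℂ → ℂ, Differentiable ℂ R ∧ (∃ z, R z ≠ 0) ∧
      DifferentiableOn ℂ Ψ {s | -(K : ℝ) < s.re} ∧ ∃ b : ℝ, ∀ s : ℂ, b < s.re → R s * f s = Ψ s) :
    ∃ g, IsMeromorphicContinuation f σ g := by
  classical
  choose R Ψ hR hR0 hΨ b hb using h
  -- To the right of b the function f itself is used, since Ψ / R takes the default value 0 at the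
  -- zeros of R.
  refine exists_isMeromorphicContinuation (b := b)
    (G := fun K s => if b K < s.re then f s else Ψ K s / R K s) hf (fun K z hz => ?_)
    fun K s hs => if_pos hs
  have h1 : MeromorphicAt (fun s => Ψ K s / R K s) z :=
    ((hΨ K).analyticAt ((isOpen_halfPlane _).mem_nhds hz)).meromorphicAt.fun_div
      ((hR K).analyticAt z).meromorphicAt
  refine h1.congr ?_
  filter_upwards [eventually_ne_zero_nhdsNE (hR K) (hR0 K) z] with y hy
  split_ifs with hby
  · rw [← hb K y hby, mul_div_cancel_left₀ _ hy]
  · rfl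

/-- The identity R f = Ψ for large Re s persists for the continuation, by the identity theorem on Re
s > a. It holds a priori only off the point z, where normal forms may have a pole. -/
theorem IsMeromorphicContinuation.mul_eventuallyEq {f g R Ψ : ℂ → ℂ} {σ a b : ℝ}
    (hg : IsMeromorphicContinuation f σ g) (hR : Differentiable ℂ R)
    (hΨ : DifferentiableOn ℂ Ψ {s | a < s.re}) (h : ∀ s : ℂ, b < s.re → R s * f s = Ψ s) {z : ℂ}
    (hz : a < z.re) : (fun y => R y * g y) =ᶠ[𝓝[≠] z] Ψ := by
  refine eventuallyEq_of_eq_halfPlane (b := max b σ) (fun s _ => ?_) (fun s hs => ?_)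
    (fun s hs => ?_) hz
  · exact (hR.analyticAt s).meromorphicAt.fun_mul (hg.1.meromorphicOn s (mem_univ s))
  · exact (hΨ.analyticAt ((isOpen_halfPlane _).mem_nhds hs)).meromorphicAt
  · rw [hg.2 s ((le_max_right _ _).trans_lt hs), h s ((le_max_left _ _).trans_lt hs)]

theorem IsMeromorphicContinuation.analyticAt_of_mul {f g R Ψ : ℂ → ℂ} {σ a b : ℝ}
    (hg : IsMeromorphicContinuation f σ g) (hR : Differentiable ℂ R)
    (hΨ : DifferentiableOn ℂ Ψ {s | a < s.re}) (h : ∀ s : ℂ, b < s.re → R s * f s = Ψ s) {z : ℂ}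
    (hz : a < z.re) (hRz : R z ≠ 0) : AnalyticAt ℂ g z := by
  have h1 : AnalyticAt ℂ (fun y => Ψ y / R y) z :=
    (hΨ.analyticAt ((isOpen_halfPlane _).mem_nhds hz)).fun_div (hR.analyticAt z) hRz
  refine h1.congr (((hg.1 (mem_univ z)).eventuallyEq_nhdsNE_iff_eventuallyEq_nhds
    h1.meromorphicNFAt).1 ?_).symm
  filter_upwards [hg.mul_eventuallyEq hR hΨ h hz,
    (hR.continuous.continuousAt.eventually_ne hRz).filter_mono nhdsWithin_le_nhds] with y hy hy0
  rw [← hy, mul_div_cancel_left₀ _ hy0]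

theorem IsMeromorphicContinuation.mul_eq {f g R Ψ : ℂ → ℂ} {σ a b : ℝ}
    (hg : IsMeromorphicContinuation f σ g) (hR : Differentiable ℂ R)
    (hΨ : DifferentiableOn ℂ Ψ {s | a < s.re}) (h : ∀ s : ℂ, b < s.re → R s * f s = Ψ s) {z : ℂ}
    (hz : a < z.re) (hgz : AnalyticAt ℂ g z) : R z * g z = Ψ z := by
  have h1 := (((hR.analyticAt z).fun_mul hgz).meromorphicNFAt.eventuallyEq_nhdsNE_iff_eventuallyEq_nhds
    (hΨ.analyticAt ((isOpen_halfPlane _).mem_nhds hz)).meromorphicNFAt).1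
    (hg.mul_eventuallyEq hR hΨ h hz)
  exact h1.eq_of_nhds

theorem Gamma_add_natCast {s : ℂ} (hs : 0 < s.re) (T : ℕ) :
    Complex.Gamma (s + T) = (∏ l ∈ Finset.range T, (s + l)) * Complex.Gamma s := by
  induction T with
  | zero => simp
  | succ T ih =>
    have h : s + T ≠ 0 := fun h => by
      have h1 := congr_arg Complex.re h
      simp at h1
      have : (0 : ℝ) ≤ T := by positivity
      linarith
    rw [Nat.cast_succ, ← add_assoc, Complex.Gamma_add_one _ h, ih, Finset.prod_range_succ]
    ring

/-- Holomorphy inside a circle from holomorphy along the circle. -/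
theorem differentiableOn_of_circle {V : Type*} [NormedAddCommGroup V] [NormedSpace ℂ V]
    [FiniteDimensional ℂ V] {D : Set V} (hD : IsOpen D) {F G : ℂ × V → ℂ} {s : ℂ} {r : ℝ}
    (hr : 0 < r)
    (hF : ∀ w ∈ D, DiffContOnCl ℂ (fun z => F (z, w)) (Metric.ball s r))
    (hG : ∀ z ∈ Metric.sphere s r, ∀ w ∈ D, DifferentiableAt ℂ G (z, w))
    (hFG : ∀ z ∈ Metric.sphere s r, ∀ w ∈ D, F (z, w) = G (z, w)) :
    DifferentiableOn ℂ F (Metric.ball s r ×ˢ D) := by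
  have hmem : ∀ θ, circleMap s r θ ∈ Metric.sphere s r := circleMap_mem_sphere s hr.le
  have hne : ∀ q ∈ Metric.ball s r ×ˢ D, ∀ θ, circleMap s r θ - q.1 ≠ 0 := fun q hq θ =>
    sub_ne_zero.2 (circleMap_ne_mem_ball hq.1 θ)
  have hform : ∀ q ∈ Metric.ball s r ×ˢ D, F q = (2 * Real.pi * Complex.I)⁻¹ *
      ∫ θ in Icc 0 (2 * Real.pi), deriv (circleMap s r) θ *
        ((circleMap s r θ - q.1)⁻¹ * G (circleMap s r θ, q.2)) := by
    rintro ⟨z, w⟩ ⟨hz, hw⟩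
    have h := (hF w hw).two_pi_i_inv_smul_circleIntegral_sub_inv_smul hz
    rw [circleIntegral, intervalIntegral.integral_of_le (by positivity),
      ← integral_Icc_eq_integral_Ioc] at h
    rw [← h]
    simp only [smul_eq_mul]
    simp only [hFG _ (hmem _) w hw]
  refine DifferentiableOn.congr (DifferentiableOn.const_mul ?_ _) hform
  refine differentiableOn_integral_of_compact isCompact_Icc measurableSet_Icc
    isCompact_Icc.measure_lt_top.ne (Metric.isOpen_ball.prod hD) ?_ fun θ _ q hq => ?_
  · intro q hq
    refine ContinuousAt.continuousWithinAt ?_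
    have h1 : ContinuousAt (fun q : (ℂ × V) × ℝ => circleMap s r q.2) q :=
      ((continuous_circleMap s r).comp continuous_snd).continuousAt
    have h2 : ContinuousAt (fun q : (ℂ × V) × ℝ => (circleMap s r q.2, q.1.2)) q :=
      h1.prodMk (by fun_prop)
    have h3 : ContinuousAt (fun q : (ℂ × V) × ℝ => G (circleMap s r q.2, q.1.2)) q :=
      ContinuousAt.comp (g := G) (f := fun q : (ℂ × V) × ℝ => (circleMap s r q.2, q.1.2))
        (hG _ (hmem q.2) _ hq.1.2).continuousAt h2
    have h4 : ContinuousAt (fun q : (ℂ × V) × ℝ => deriv (circleMap s r) q.2) q := by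
      simp only [deriv_circleMap]
      exact (((continuous_circleMap 0 r).comp continuous_snd).mul continuous_const).continuousAt
    exact h4.mul (((h1.sub (by fun_prop)).inv₀ (hne q.1 hq.1 q.2)).mul h3)
  · refine DifferentiableAt.differentiableWithinAt ?_
    refine DifferentiableAt.const_mul (DifferentiableAt.mul ?_ ?_) _
    · exact ((differentiableAt_const _).sub differentiableAt_fst).inv (hne q hq θ)
    · exact DifferentiableAt.comp (g := G) q (hG _ (hmem θ) _ hq.2)
        ((differentiableAt_const _).prodMk differentiableAt_snd)

variable {N n : ℕ} {M : Matrix (Fin N) (Fin n) ℂ}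

/-- The parameters with positive real parts. -/
def rightHalf (n : ℕ) : Set (Fin n → ℂ) := {w | ∀ j, 0 < (w j).re}

theorem isOpen_rightHalf (n : ℕ) : IsOpen (rightHalf n) := by
  have : rightHalf n = ⋂ j, {w | 0 < (w j).re} := by
    ext w
    simp [rightHalf]
  rw [this]
  exact isOpen_iInter_of_finite fun j =>
    isOpen_lt continuous_const (Complex.continuous_re.comp (continuous_apply j))

/-- Γ(s + nK) = ∏_{l < nK} (s + l) · Γ(s), so the n-th power of the integer factors combines with
Γ(s)^n into Γ(s + nK)^n, whose inverse is entire. Only the pole candidates are left as zeros of R,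
and R is the same for all w. -/
theorem HypothesisH.exists_mul_zetaSeries_eq (hM : HypothesisH M) (K : ℕ) :
    ∃ R : ℂ → ℂ, Differentiable ℂ R ∧ (∀ z, R z = 0 → z ∈ poleCandidates (n - maxZeros M) n) ∧
      ∃ Φ : ℂ × (Fin n → ℂ) → ℂ, DifferentiableOn ℂ Φ (FormFamily.paramDomain n (-(K : ℝ))) ∧
        ∃ b : ℝ, ∀ (s : ℂ), b < s.re → ∀ w ∈ rightHalf n, R s * zetaSeries M s w = Φ (s, w) := by
  obtain ⟨R, hR, hR0, E, hE, b, hb⟩ := continuable_intg_rowFamily hM (K := K) le_rfl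
  refine ⟨R, hR, hR0, fun q => ((Complex.Gamma (q.1 + (n * K : ℕ)))⁻¹) ^ n * E q, ?_,
    max b (abscissa M), fun s hs w hw => ?_⟩
  · refine DifferentiableOn.mul (Differentiable.differentiableOn ?_) hE
    exact (Complex.differentiable_one_div_Gamma.comp
      (differentiable_fst.add (differentiable_const _))).pow n
  · have hs1 : b < s.re := (le_max_left _ _).trans_lt hs
    have hs2 : abscissa M < s.re := (le_max_right _ _).trans_lt hs
    have hs0 : 0 < s.re := (abscissa_nonneg M).trans_lt hs2
    have h1 := hb s w hs1 hw
    rw [← hM.Gamma_pow_mul_zetaSeries hw hs2] at h1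
    have h2 : Complex.Gamma (s + (n * K : ℕ)) ≠ 0 :=
      Complex.Gamma_ne_zero_of_re_pos (by rw [Complex.add_re, Complex.natCast_re]; positivity)
    beta_reduce
    rw [← h1, inv_pow]
    have h3 := Gamma_add_natCast hs0 (n * K)
    rw [eq_inv_mul_iff_mul_eq₀ (pow_ne_zero _ h2), h3, mul_pow]
    ring

theorem zero_notMem_poleCandidates (q n : ℕ) : (0 : ℂ) ∉ poleCandidates q n := fun h =>
  h.2 0 (by simp)

theorem differentiableOn_slice {Φ : ℂ × (Fin n → ℂ) → ℂ} {a : ℝ}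
    (hΦ : DifferentiableOn ℂ Φ (FormFamily.paramDomain n a)) {w : Fin n → ℂ} (hw : w ∈ rightHalf n) :
    DifferentiableOn ℂ (fun z => Φ (z, w)) {s | a < s.re} :=
  hΦ.comp (differentiable_id.prodMk (differentiable_const w)).differentiableOn
    fun _ hz => ⟨hz, hw⟩

theorem HypothesisH.isMeromorphicContinuation_zeta (hM : HypothesisH M) {w : Fin n → ℂ}
    (hw : w ∈ rightHalf n) :
    IsMeromorphicContinuation (fun z => zetaSeries M z w) (abscissa M) fun z => zeta M z w := by
  refine isMeromorphicContinuation_meromorphicContinuation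
    (exists_isMeromorphicContinuation_of_mul (hM.analyticOnNhd_zetaSeries hw) fun K => ?_)
  obtain ⟨R, hR, hR0, Φ, hΦ, b, hb⟩ := hM.exists_mul_zetaSeries_eq K
  exact ⟨R, fun z => Φ (z, w), hR, ⟨0, fun h => zero_notMem_poleCandidates _ _ (hR0 0 h)⟩,
    differentiableOn_slice hΦ hw, b, fun s hs => hb s hs w hw⟩

/-- The zeta function is regular in `s` outside the polar set. -/
theorem HypothesisH.analyticAt_zeta (hM : HypothesisH M) {s : ℂ} (hs : s ∉ polarSet M)
    {w : Fin n → ℂ} (hw : w ∈ rightHalf n) : AnalyticAt ℂ (fun z => zeta M z w) s := by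
  have hcont := hM.isMeromorphicContinuation_zeta hw
  obtain ⟨K, hK⟩ := exists_nat_gt (-s.re)
  obtain ⟨R, hR, hR0, Φ, hΦ, b, hb⟩ := hM.exists_mul_zetaSeries_eq K
  -- A zero of R is a pole candidate. Up to the abscissa, a pole there for this w would put s into
  -- the polar set; beyond the abscissa the series converges.
  by_cases hRs : R s = 0
  · obtain ⟨⟨a, d, hd1, hd2, -, hsad⟩, hsl⟩ := hR0 s hRs
    by_cases hle : (a : ℝ) / (d : ℝ) ≤ abscissa M
    · rw [← (hcont.1 (mem_univ s)).meromorphicOrderAt_nonneg_iff_analyticAt]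
      by_contra hneg
      refine hs ⟨⟨a, d, ?_, hd2, hle, hsad⟩, hsl, w, hw, not_le.1 hneg⟩
      rwa [Nat.cast_sub (maxZeros_le M)] at hd1
    · have hre : s.re = (a : ℝ) / (d : ℝ) := by
        have : s = (((a : ℝ) / (d : ℝ) : ℝ) : ℂ) := by rw [hsad]; push_cast; rfl
        rw [this, Complex.ofReal_re]
      have hsre : abscissa M < s.re := by
        rw [hre]
        exact not_le.1 hle
      refine (hM.analyticOnNhd_zetaSeries hw s hsre).congr ?_
      filter_upwards [(isOpen_halfPlane (abscissa M)).mem_nhds hsre] with z hz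
      exact (hcont.2 z hz).symm
  · exact hcont.analyticAt_of_mul hR (differentiableOn_slice hΦ hw) (fun z hz => hb z hz w hw)
      (a := -(K : ℝ)) (by linarith) hRs

/-- Outside the polar set, the zeta function is holomorphic in both variables. -/
theorem HypothesisH.exists_differentiableOn_zeta (hM : HypothesisH M) {s : ℂ}
    (hs : s ∉ polarSet M) : ∃ U : Set ℂ, IsOpen U ∧ s ∈ U ∧
      DifferentiableOn ℂ (fun q : ℂ × (Fin n → ℂ) => zeta M q.1 q.2) (U ×ˢ rightHalf n) := by
  obtain ⟨K, hK⟩ := exists_nat_gt (-s.re)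
  obtain ⟨R, hR, hR0, Φ, hΦ, b, hb⟩ := hM.exists_mul_zetaSeries_eq K
  have hRne : ∃ z, R z ≠ 0 := ⟨0, fun h => zero_notMem_poleCandidates _ _ (hR0 0 h)⟩
  -- R may vanish at s but not on a small circle around it, where zeta equals Φ / R and is jointly
  -- holomorphic. For each fixed w zeta is regular inside, so Cauchy's formula carries the joint
  -- holomorphy to the disc.
  have hev : ∀ᶠ z in 𝓝 s, -(K : ℝ) < z.re ∧ (z ≠ s → R z ≠ 0) := by
    have h1 : ∀ᶠ z in 𝓝 s, -(K : ℝ) < z.re :=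
      (isOpen_halfPlane (-(K : ℝ))).mem_nhds (show -(K : ℝ) < s.re by linarith)
    exact h1.and (eventually_nhdsWithin_iff.1 (eventually_ne_zero_nhdsNE hR hRne s))
  obtain ⟨r, hr, hball⟩ := Metric.nhds_basis_closedBall.eventually_iff.1 hev
  have hzeta : ∀ w ∈ rightHalf n, ∀ z ∈ Metric.closedBall s r,
      AnalyticAt ℂ (fun z => zeta M z w) z := by
    intro w hw z hz
    by_cases hzs : z = s
    · rw [hzs]
      exact hM.analyticAt_zeta hs hw
    · exact (hM.isMeromorphicContinuation_zeta hw).analyticAt_of_mul hR (differentiableOn_slice hΦ hw)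
        (fun z hz => hb z hz w hw) (hball hz).1 ((hball hz).2 hzs)
  have hsph : ∀ z ∈ Metric.sphere s r, R z ≠ 0 := fun z hz =>
    (hball (Metric.sphere_subset_closedBall hz)).2 (Metric.ne_of_mem_sphere hz hr.ne')
  refine ⟨Metric.ball s r, Metric.isOpen_ball, Metric.mem_ball_self hr,
    differentiableOn_of_circle (G := fun q => Φ q * (R q.1)⁻¹) (isOpen_rightHalf n) hr
      (fun w hw => ?_) (fun z hz w hw => ?_) fun z hz w hw => ?_⟩
  · exact DifferentiableOn.diffContOnCl_ball
      (fun z hz => (hzeta w hw z hz).differentiableAt.differentiableWithinAt) le_rfl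
  · have hR1 : Differentiable ℂ fun q : ℂ × (Fin n → ℂ) => R q.1 := hR.comp differentiable_fst
    refine DifferentiableAt.fun_mul ?_ (hR1.differentiableAt.fun_inv (hsph z hz))
    exact hΦ.differentiableAt ((FormFamily.isOpen_paramDomain n _).mem_nhds
      ⟨(hball (Metric.sphere_subset_closedBall hz)).1, hw⟩)
  · have hz' := Metric.sphere_subset_closedBall hz
    have := (hM.isMeromorphicContinuation_zeta hw).mul_eq hR (differentiableOn_slice hΦ hw)
      (fun z hz => hb z hz w hw) (hball hz').1 (hzeta w hw z hz')
    beta_reduce at this ⊢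
    rw [← this, mul_comm, inv_mul_cancel_left₀ (hsph z hz)]

end ShintaniBarnes

/-! ### Raabe's formula -/

namespace ShintaniBarnes

variable {N n : ℕ} {M : Matrix (Fin N) (Fin n) ℂ}

/-- The parameter `w` shifted by a combination of the rows of `M`. -/
noncomputable def shift (M : Matrix (Fin N) (Fin n) ℂ) (w : Fin n → ℂ) (t : Fin N → ℝ) : Fin n → ℂ :=
  fun j => w j + ∑ i, (t i : ℂ) * M i j

theorem W_add (M : Matrix (Fin N) (Fin n) ℂ) (x : Fin N → ℂ) (t : Fin N → ℝ) :
    W M (fun i => x i + (t i : ℂ)) = shift M (W M x) t := by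
  funext j
  simp [W, shift, add_mul, Finset.sum_add_distrib]

theorem HypothesisH.shift_mem (hM : HypothesisH M) {w : Fin n → ℂ} (hw : w ∈ rightHalf n)
    {t : Fin N → ℝ} (ht : ∀ i, 0 ≤ t i) : shift M w t ∈ rightHalf n :=
  fun j => hM.base_re_pos hw ht j

theorem summand_shift (s : ℂ) (w : Fin n → ℂ) (t k : Fin N → ℝ) :
    summand M s (shift M w t) k = summand M s w (t + k) := by
  simp only [summand, shift, Pi.add_apply]
  refine Finset.prod_congr rfl fun j _ => ?_
  push_cast
  simp only [add_mul, Finset.sum_add_distrib, add_assoc]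

theorem continuous_shift : Continuous fun q : (Fin n → ℂ) × (Fin N → ℝ) => shift M q.1 q.2 := by
  unfold shift
  fun_prop

theorem HypothesisH.continuousOn_summand (hM : HypothesisH M) {w : Fin n → ℂ} (hw : w ∈ rightHalf n)
    (s : ℂ) : ContinuousOn (summand M s w) {t | ∀ i, 0 ≤ t i} := by
  unfold summand
  refine continuousOn_finsetProd _ fun j _ => ?_
  refine ContinuousOn.cpow (by fun_prop) continuousOn_const fun t ht => Or.inl ?_
  exact hM.base_re_pos hw ht j

/-- The half-open unit cube at an integral point. -/
def unitCube (k : Fin N → ℕ) : Set (Fin N → ℝ) := univ.pi fun i => Ioc (k i : ℝ) (k i + 1)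

theorem measurableSet_unitCube (k : Fin N → ℕ) : MeasurableSet (unitCube k) :=
  MeasurableSet.univ_pi fun _ => measurableSet_Ioc

theorem iUnion_unitCube (N : ℕ) : ⋃ k : Fin N → ℕ, unitCube k = orthant N := by
  ext t
  simp only [mem_iUnion, unitCube, mem_univ_pi, mem_orthant, mem_Ioc]
  constructor
  · rintro ⟨k, hk⟩ i
    exact (Nat.cast_nonneg (k i)).trans_lt (hk i).1
  · intro ht
    refine ⟨fun i => ⌈t i⌉₊ - 1, fun i => ?_⟩
    have h1 : 0 < ⌈t i⌉₊ := Nat.ceil_pos.2 (ht i)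
    have h2 : ((⌈t i⌉₊ - 1 : ℕ) : ℝ) + 1 = ⌈t i⌉₊ := by
      rw [Nat.cast_sub h1]
      simp
    have h3 := Nat.ceil_lt_add_one (ht i).le
    exact ⟨by linarith, by rw [h2]; exact Nat.le_ceil _⟩

theorem pairwise_disjoint_unitCube (N : ℕ) :
    Pairwise (Function.onFun Disjoint fun k : Fin N → ℕ => unitCube k) := by
  intro k l hkl
  refine Set.disjoint_left.2 fun t hk hl => hkl (funext fun i => ?_)
  have h1 := hk i (mem_univ i)
  have h2 := hl i (mem_univ i)
  have h3 : (k i : ℝ) < l i + 1 := h1.1.trans_le h2.2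
  have h4 : (l i : ℝ) < k i + 1 := h2.1.trans_le h1.2
  have h3' : k i < l i + 1 := by exact_mod_cast h3
  have h4' : l i < k i + 1 := by exact_mod_cast h4
  omega

/-- Half-open cubes partition the orthant; they differ from the compact cubes by null sets, and
compactness is what makes the translated integrands easy to handle. -/
theorem setIntegral_unitCube {E : Type*} [NormedAddCommGroup E] [NormedSpace ℝ E]
    (f : (Fin N → ℝ) → E) (k : Fin N → ℕ) :
    ∫ t in unitCube k, f t = ∫ t in Icc (0 : Fin N → ℝ) 1, f (t + fun i => (k i : ℝ)) := by
  have h1 : (unitCube (0 : Fin N → ℕ)) =ᵐ[volume] Icc (0 : Fin N → ℝ) 1 := by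
    have := Measure.univ_pi_Ioc_ae_eq_Icc (μ := fun _ : Fin N => (volume : Measure ℝ))
      (f := (0 : Fin N → ℝ)) (g := 1)
    simpa [unitCube, volume_pi] using this
  have h2 : (fun t : Fin N → ℝ => t + fun i => (k i : ℝ)) ⁻¹' unitCube k = unitCube 0 := by
    ext t
    simp only [unitCube, mem_preimage, mem_univ_pi, Pi.add_apply, mem_Ioc, Pi.zero_apply,
      Nat.cast_zero]
    refine forall_congr' fun i => ?_
    constructor
    · rintro ⟨h, h'⟩; exact ⟨by linarith, by linarith⟩
    · rintro ⟨h, h'⟩; exact ⟨by linarith, by linarith⟩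
  rw [← setIntegral_congr_set h1, ← h2]
  exact ((measurePreserving_add_right volume (fun i => (k i : ℝ))).setIntegral_preimage_emb
    (measurableEmbedding_addRight _) f (unitCube k)).symm

/-- The Raabe formula in the domain of convergence. -/
theorem HypothesisH.setIntegral_zetaSeries (hM : HypothesisH M) {w : Fin n → ℂ}
    (hw : w ∈ rightHalf n) {s : ℂ} (hs : abscissa M < s.re) :
    ∫ t in Icc (0 : Fin N → ℝ) 1, zetaSeries M s (shift M w t) = zetaIntegral M s w := by
  obtain ⟨ρ, hρ, C, hC, hle⟩ := hM.exists_norm_summand_le hw hs ‖s‖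
  have hadd : ∀ k : Fin N → ℕ, ContinuousOn
      (fun t : Fin N → ℝ => summand M s w (t + fun i => (k i : ℝ))) (Icc 0 1) := fun k =>
    (hM.continuousOn_summand hw s).comp (by fun_prop) fun t ht i => by
      have := ht.1 i
      simp only [Pi.zero_apply, Pi.add_apply] at this ⊢
      positivity
  have hint : ∀ k : Fin N → ℕ, IntegrableOn
      (fun t : Fin N → ℝ => summand M s w (t + fun i => (k i : ℝ))) (Icc 0 1) := fun k =>
    (hadd k).integrableOn_compact isCompact_Icc
  have hbound : ∀ (k : Fin N → ℕ), ∀ t ∈ Icc (0 : Fin N → ℝ) 1,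
      ‖summand M s w (t + fun i => (k i : ℝ))‖ ≤ C * ∏ i, (1 + (k i : ℝ)) ^ (-ρ) := by
    intro k t ht
    have ht' : ∀ i, 0 ≤ t i := fun i => ht.1 i
    refine (hle s le_rfl le_rfl _ fun i => add_nonneg (ht' i) (Nat.cast_nonneg _)).trans
      (mul_le_mul_of_nonneg_left ?_ hC)
    refine Finset.prod_le_prod (fun i _ => Real.rpow_nonneg ?_ _) fun i _ => ?_
    · have := ht' i
      positivity
    · refine Real.rpow_le_rpow_of_nonpos (by positivity) ?_ (by linarith)
      linarith [ht' i]
  have hvol : (volume : Measure (Fin N → ℝ)).real (Icc 0 1) = 1 := by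
    rw [Measure.real, Real.volume_Icc_pi]
    simp
  have hsum : Summable fun k : Fin N → ℕ =>
      ∫ t in Icc (0 : Fin N → ℝ) 1, ‖summand M s w (t + fun i => (k i : ℝ))‖ := by
    refine Summable.of_nonneg_of_le (fun k => integral_nonneg fun t => norm_nonneg _) (fun k => ?_)
      ((summable_prod_one_add_rpow N hρ).mul_left C)
    have := setIntegral_mono_on (hint k).norm (integrableOn_const (by simp [Real.volume_Icc_pi]))
      measurableSet_Icc (hbound k)
    simpa [hvol] using this
  have h1 := (hasSum_integral_of_summable_integral_norm hint hsum).tsum_eq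
  have hintU : ∀ k : Fin N → ℕ, IntegrableOn (summand M s w) (unitCube k) := by
    intro k
    refine IntegrableOn.mono_set (t := Icc (fun i => (k i : ℝ)) fun i => (k i : ℝ) + 1)
      (ContinuousOn.integrableOn_compact isCompact_Icc ?_) ?_
    · exact (hM.continuousOn_summand hw s).mono fun t ht i => (Nat.cast_nonneg (k i)).trans (ht.1 i)
    · exact fun t ht => ⟨fun i => (ht i (mem_univ i)).1.le, fun i => (ht i (mem_univ i)).2⟩
  have hunion : IntegrableOn (summand M s w) (⋃ k : Fin N → ℕ, unitCube k) := by
    refine integrableOn_iUnion_of_summable_integral_norm (fun k => hintU k) ?_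
    exact hsum.congr fun k => (setIntegral_unitCube (fun t => ‖summand M s w t‖) k).symm
  have h2 := (hasSum_integral_iUnion (measurableSet_unitCube (N := N))
    (pairwise_disjoint_unitCube N) hunion).tsum_eq
  rw [iUnion_unitCube] at h2
  have h3 : zetaIntegral M s w = ∫ t in orthant N, summand M s w t := rfl
  rw [h3, ← h2]
  simp only [setIntegral_unitCube]
  rw [h1]
  refine setIntegral_congr_fun measurableSet_Icc fun t _ => ?_
  simp only [zetaSeries_eq, summand_shift]

theorem re_le_abscissa_of_mem_polarSet {s : ℂ} (hs : s ∈ polarSet M) : s.re ≤ abscissa M := by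
  obtain ⟨⟨a, b, -, -, hle, hs⟩, -⟩ := hs
  have : s = (((a : ℝ) / (b : ℝ) : ℝ) : ℂ) := by rw [hs]; push_cast; rfl
  rw [this, Complex.ofReal_re]
  exact hle

theorem HypothesisH.differentiableOn_setIntegral_shift (hM : HypothesisH M)
    {Φ : ℂ × (Fin n → ℂ) → ℂ} {U : Set ℂ} (hU : IsOpen U)
    (hΦ : DifferentiableOn ℂ Φ (U ×ˢ rightHalf n)) :
    DifferentiableOn ℂ (fun q : ℂ × (Fin n → ℂ) =>
      ∫ t in Icc (0 : Fin N → ℝ) 1, Φ (q.1, shift M q.2 t)) (U ×ˢ rightHalf n) := by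
  refine differentiableOn_integral_of_compact isCompact_Icc measurableSet_Icc
    isCompact_Icc.measure_lt_top.ne (hU.prod (isOpen_rightHalf n)) ?_ fun t ht => ?_
  · refine hΦ.continuousOn.comp
      (f := fun q : (ℂ × (Fin n → ℂ)) × (Fin N → ℝ) => (q.1.1, shift M q.1.2 q.2))
      (Continuous.continuousOn ?_) fun q hq => ⟨hq.1.1, hM.shift_mem hq.1.2 hq.2.1⟩
    exact (continuous_fst.comp continuous_fst).prodMk
      (continuous_shift.comp ((continuous_snd.comp continuous_fst).prodMk continuous_snd))
  · refine hΦ.comp (f := fun q : ℂ × (Fin n → ℂ) => (q.1, shift M q.2 t))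
      (Differentiable.differentiableOn ?_) fun q hq => ⟨hq.1, hM.shift_mem hq.2 ht.1⟩
    unfold shift
    fun_prop

theorem differentiableOn_slice_prod {Φ : ℂ × (Fin n → ℂ) → ℂ} {U : Set ℂ}
    (hΦ : DifferentiableOn ℂ Φ (U ×ˢ rightHalf n)) {w : Fin n → ℂ} (hw : w ∈ rightHalf n) :
    DifferentiableOn ℂ (fun z => Φ (z, w)) U :=
  hΦ.comp (differentiable_id.prodMk (differentiable_const w)).differentiableOn
    fun _ hz => ⟨hz, hw⟩

/-- Beyond the abscissa Raabe's formula writes the integral as an average of zeta over a compact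
cube, so the joint holomorphy of zeta is enough. -/
theorem HypothesisH.analyticOnNhd_zetaIntegral (hM : HypothesisH M) {w : Fin n → ℂ}
    (hw : w ∈ rightHalf n) :
    AnalyticOnNhd ℂ (fun s => zetaIntegral M s w) {s | abscissa M < s.re} := by
  intro s hs
  obtain ⟨U, hU, hsU, hd⟩ := hM.exists_differentiableOn_zeta
    (s := s) fun h => not_lt.2 (re_le_abscissa_of_mem_polarSet h) hs
  have h1 := (differentiableOn_slice_prod (hM.differentiableOn_setIntegral_shift hU hd) hw).analyticAt
    (hU.mem_nhds hsU)
  refine h1.congr ?_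
  filter_upwards [(isOpen_halfPlane (abscissa M)).mem_nhds hs] with z hz
  rw [← hM.setIntegral_zetaSeries hw hz]
  exact setIntegral_congr_fun measurableSet_Icc fun t ht =>
    (hM.isMeromorphicContinuation_zeta (hM.shift_mem hw ht.1)).2 z hz

/-- Because R does not depend on w, it passes through the average over the cube. The zeta integral
is thus continued with the same denominator as zeta. -/
theorem HypothesisH.mul_zetaIntegral_eq (hM : HypothesisH M) {w : Fin n → ℂ}
    (hw : w ∈ rightHalf n) {R : ℂ → ℂ} {Φ : ℂ × (Fin n → ℂ) → ℂ} {b : ℝ}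
    (hb : ∀ s : ℂ, b < s.re → ∀ w ∈ rightHalf n, R s * zetaSeries M s w = Φ (s, w)) {s : ℂ}
    (hs : max b (abscissa M) < s.re) :
    R s * zetaIntegral M s w = ∫ t in Icc (0 : Fin N → ℝ) 1, Φ (s, shift M w t) := by
  rw [← hM.setIntegral_zetaSeries hw ((le_max_right _ _).trans_lt hs), ← integral_const_mul]
  exact setIntegral_congr_fun measurableSet_Icc fun t ht =>
    hb s ((le_max_left _ _).trans_lt hs) _ (hM.shift_mem hw ht.1)

theorem paramDomain_eq (n : ℕ) (a : ℝ) :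
    FormFamily.paramDomain n a = {s : ℂ | a < s.re} ×ˢ rightHalf n := rfl

theorem HypothesisH.isMeromorphicContinuation_zetaInt (hM : HypothesisH M) {w : Fin n → ℂ}
    (hw : w ∈ rightHalf n) :
    IsMeromorphicContinuation (fun z => zetaIntegral M z w) (abscissa M) fun z => zetaInt M z w := by
  refine isMeromorphicContinuation_meromorphicContinuation
    (exists_isMeromorphicContinuation_of_mul (hM.analyticOnNhd_zetaIntegral hw) fun K => ?_)
  obtain ⟨R, hR, hR0, Φ, hΦ, b, hb⟩ := hM.exists_mul_zetaSeries_eq K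
  rw [paramDomain_eq] at hΦ
  exact ⟨R, _, hR, ⟨0, fun h => zero_notMem_poleCandidates _ _ (hR0 0 h)⟩,
    differentiableOn_slice_prod (hM.differentiableOn_setIntegral_shift (isOpen_halfPlane _) hΦ) hw,
    _, fun s hs => hM.mul_zetaIntegral_eq hw hb hs⟩

/-- The Raabe formula near a point outside the polar set. -/
theorem HypothesisH.analyticAt_zetaInt_and_eq (hM : HypothesisH M) {s : ℂ} (hs : s ∉ polarSet M)
    {w : Fin n → ℂ} (hw : w ∈ rightHalf n) :
    AnalyticAt ℂ (fun z => zetaInt M z w) s ∧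
      zetaInt M s w = ∫ t in Icc (0 : Fin N → ℝ) 1, zeta M s (shift M w t) := by
  obtain ⟨U, hU, hsU, hd⟩ := hM.exists_differentiableOn_zeta hs
  obtain ⟨K, hK⟩ := exists_nat_gt (-s.re)
  have hKs : -(K : ℝ) < s.re := by linarith
  obtain ⟨R, hR, hR0, Φ, hΦ, b, hb⟩ := hM.exists_mul_zetaSeries_eq K
  have hRne : ∃ z, R z ≠ 0 := ⟨0, fun h => zero_notMem_poleCandidates _ _ (hR0 0 h)⟩
  have hcont := hM.isMeromorphicContinuation_zetaInt hw
  have h1 : AnalyticAt ℂ (fun z => ∫ t in Icc (0 : Fin N → ℝ) 1, zeta M z (shift M w t)) s :=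
    (differentiableOn_slice_prod (hM.differentiableOn_setIntegral_shift hU hd) hw).analyticAt
      (hU.mem_nhds hsU)
  have h2 := hcont.mul_eventuallyEq hR (differentiableOn_slice_prod
    (hM.differentiableOn_setIntegral_shift (isOpen_halfPlane _) hΦ) hw)
    (fun s hs => hM.mul_zetaIntegral_eq hw hb hs) hKs
  -- Off s, both sides become the cube average of Φ after multiplication by R, and R does not vanish
  -- there.
  have h3 : (fun z => zetaInt M z w) =ᶠ[𝓝[≠] s]
      fun z => ∫ t in Icc (0 : Fin N → ℝ) 1, zeta M z (shift M w t) := by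
    filter_upwards [h2, eventually_ne_zero_nhdsNE hR hRne s,
      nhdsWithin_le_nhds (hU.mem_nhds hsU),
      nhdsWithin_le_nhds ((isOpen_halfPlane (-(K : ℝ))).mem_nhds hKs)] with z hz hRz hzU hzK
    refine mul_left_cancel₀ hRz (hz.trans ?_)
    rw [← integral_const_mul]
    refine setIntegral_congr_fun measurableSet_Icc fun t ht => ?_
    have hwt := hM.shift_mem hw ht.1
    exact ((hM.isMeromorphicContinuation_zeta hwt).mul_eq hR (differentiableOn_slice hΦ hwt)
      (fun z hz => hb z hz _ hwt) hzK
      ((differentiableOn_slice_prod hd hwt).analyticAt (hU.mem_nhds hzU))).symm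
  have h4 := ((hcont.1 (mem_univ s)).eventuallyEq_nhdsNE_iff_eventuallyEq_nhds h1.meromorphicNFAt).1 h3
  exact ⟨h1.congr h4.symm, h4.eq_of_nhds⟩

end ShintaniBarnes

/-! ### Iterated differences of zeta -/

namespace ShintaniBarnes

variable {N n : ℕ} {M : Matrix (Fin N) (Fin n) ℂ}

/-- The vector of complex numbers with natural number entries. -/
def natVec (k : Fin N → ℕ) : Fin N → ℂ := fun i => (k i : ℂ)

theorem natVec_add_single (k : Fin N → ℕ) (i : Fin N) :
    natVec (k + Pi.single i 1) = Pi.single i 1 + natVec k := by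
  funext l
  by_cases h : l = i
  · subst h
    simp [natVec, add_comm]
  · simp [natVec, h]

/-- Telescoping in direction i: the terms with k_i ≥ 1 form the same sum at y + e_i, so the
difference in direction i leaves minus the terms with k_i = 0. -/
theorem tsum_ite_eq_add {T : (Fin N → ℂ) → ℂ} {y : Fin N → ℂ}
    (hT : Summable fun k : Fin N → ℕ => T (y + natVec k)) (l : List (Fin N)) {i : Fin N}
    (hi : i ∉ l) :
    ∑' k : Fin N → ℕ, (if ∀ m ∈ l, k m = 0 then T (y + natVec k) else 0) =
      ∑' k : Fin N → ℕ, (if ∀ m ∈ l, k m = 0 then T (y + Pi.single i 1 + natVec k) else 0) +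
      ∑' k : Fin N → ℕ, (if ∀ m ∈ i :: l, k m = 0 then T (y + natVec k) else 0) := by
  classical
  set A : (Fin N → ℕ) → ℂ := fun k =>
    if (∀ m ∈ l, k m = 0) ∧ k i ≠ 0 then T (y + natVec k) else 0 with hA
  have hsumm : ∀ (p : (Fin N → ℕ) → Prop) [DecidablePred p],
      Summable fun k : Fin N → ℕ => if p k then T (y + natVec k) else 0 := fun p _ => by
    refine (hT.indicator {k | p k}).congr fun k => ?_
    simp [indicator_apply]
  have hinj : Function.Injective fun k : Fin N → ℕ => k + Pi.single i 1 := add_left_injective _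
  have hsupp : Function.support A ⊆ range fun k : Fin N → ℕ => k + Pi.single i 1 := by
    intro k hk
    have hki : k i ≠ 0 := by
      intro h
      simp [hA, h] at hk
    refine ⟨k - Pi.single i 1, funext fun m => ?_⟩
    by_cases h : m = i
    · subst h
      simp
      omega
    · simp [h]
  have h1 : ∑' k, A k =
      ∑' k : Fin N → ℕ, (if ∀ m ∈ l, k m = 0 then T (y + Pi.single i 1 + natVec k) else 0) := by
    rw [← hinj.tsum_eq hsupp]
    refine tsum_congr fun k => ?_
    have hcond : ((∀ m ∈ l, (k + Pi.single i 1 : Fin N → ℕ) m = 0) ∧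
        (k + Pi.single i 1 : Fin N → ℕ) i ≠ 0) ↔
        ∀ m ∈ l, k m = 0 := by
      constructor
      · intro h m hm
        simpa using (Nat.add_eq_zero_iff.1 (h.1 m hm)).1
      · intro h
        refine ⟨fun m hm => ?_, by simp⟩
        have : m ≠ i := fun h => hi (h ▸ hm)
        simp [h m hm, this]
    simp only [hA, hcond, natVec_add_single, add_assoc]
  rw [← h1, ← Summable.tsum_add (hsumm fun k => (∀ m ∈ l, k m = 0) ∧ k i ≠ 0)
    (hsumm fun k => ∀ m ∈ i :: l, k m = 0)]
  refine tsum_congr fun k => ?_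
  by_cases h : ∀ m ∈ l, k m = 0 <;> by_cases h' : k i = 0 <;> simp [h, h']

/-- Iterated differences of a sum over all integral translates. -/
theorem foldr_fwdDiff_tsum {T F : (Fin N → ℂ) → ℂ} {X : Set (Fin N → ℂ)}
    (hX : ∀ y ∈ X, ∀ i, y + Pi.single i 1 ∈ X)
    (hT : ∀ y ∈ X, Summable fun k : Fin N → ℕ => T (y + natVec k))
    (hF : ∀ y ∈ X, F y = ∑' k : Fin N → ℕ, T (y + natVec k)) (l : List (Fin N)) :
    l.Nodup → ∀ y ∈ X, l.foldr (fun i G => fwdDiff (Pi.single i 1) G) F y =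
      (-1) ^ l.length *
        ∑' k : Fin N → ℕ, (if ∀ m ∈ l, k m = 0 then T (y + natVec k) else 0) := by
  induction l with
  | nil =>
    intro _ y hy
    simp [hF y hy]
  | cons i l ih =>
    intro hl y hy
    obtain ⟨hil, hl⟩ := List.nodup_cons.1 hl
    rw [List.foldr_cons, fwdDiff, ih hl y hy, ih hl _ (hX y hy i), tsum_ite_eq_add (hT y hy) l hil,
      List.length_cons, pow_succ]
    ring

theorem mixedDifference_tsum {T F : (Fin N → ℂ) → ℂ} {X : Set (Fin N → ℂ)}
    (hX : ∀ y ∈ X, ∀ i, y + Pi.single i 1 ∈ X)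
    (hT : ∀ y ∈ X, Summable fun k : Fin N → ℕ => T (y + natVec k))
    (hF : ∀ y ∈ X, F y = ∑' k : Fin N → ℕ, T (y + natVec k)) {y : Fin N → ℂ} (hy : y ∈ X) :
    mixedDifference F y = (-1) ^ N * T y := by
  rw [mixedDifference, foldr_fwdDiff_tsum hX hT hF _ (List.nodup_finRange N) y hy,
    List.length_finRange, tsum_eq_single 0]
  · have : natVec (0 : Fin N → ℕ) = 0 := by
      funext i
      simp [natVec]
    simp [this]
  · intro k hk
    refine if_neg fun h => hk (funext fun i => h i (List.mem_finRange i))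

/-- Transfers meromorphy and analyticity in s from zeta at each point of X to its iterated
differences. -/
theorem foldr_fwdDiff_induction {p : (ℂ → ℂ) → Prop}
    (hp : ∀ f g : ℂ → ℂ, p f → p g → p fun z => f z - g z) {F : ℂ → (Fin N → ℂ) → ℂ}
    {X : Set (Fin N → ℂ)} (hX : ∀ y ∈ X, ∀ i, y + Pi.single i 1 ∈ X)
    (hF : ∀ y ∈ X, p fun z => F z y) (l : List (Fin N)) :
    ∀ y ∈ X, p fun z => l.foldr (fun i G => fwdDiff (Pi.single i 1) G) (F z) y := by
  induction l with
  | nil => exact hF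
  | cons i l ih => exact fun y hy => hp _ _ (ih _ (hX y hy i)) (ih y hy)

/-- The points that `W` maps to parameters with positive real parts. -/
def goodSet (M : Matrix (Fin N) (Fin n) ℂ) : Set (Fin N → ℂ) := {y | W M y ∈ rightHalf n}

theorem differentiable_W : Differentiable ℂ (W M) := by
  unfold W
  fun_prop

theorem isOpen_goodSet : IsOpen (goodSet M) :=
  (isOpen_rightHalf n).preimage differentiable_W.continuous

theorem HypothesisH.add_mem_goodSet (hM : HypothesisH M) {y : Fin N → ℂ} (hy : y ∈ goodSet M)
    {t : Fin N → ℝ} (ht : ∀ i, 0 ≤ t i) : (y + fun i => (t i : ℂ)) ∈ goodSet M := by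
  have h := hM.shift_mem hy ht
  rw [← W_add] at h
  exact h

theorem ofReal_single (i : Fin N) (u : ℝ) :
    (fun l => ((Pi.single i u : Fin N → ℝ) l : ℂ)) = Pi.single i (u : ℂ) := by
  funext l
  by_cases h : l = i
  · subst h
    simp
  · simp [h]

theorem HypothesisH.add_single_mem_goodSet (hM : HypothesisH M) {y : Fin N → ℂ}
    (hy : y ∈ goodSet M) (i : Fin N) : y + Pi.single i 1 ∈ goodSet M := by
  have h := hM.add_mem_goodSet hy (t := Pi.single i 1) fun l => by
    by_cases h : l = i
    · subst h
      simp
    · simp [h]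
  rwa [ofReal_single, Complex.ofReal_one] at h

/-- Telescoping proves the identity beyond the abscissa. Both sides are meromorphic in s on ℂ, the
right one entire, and both are analytic at the given s, so they agree there. -/
theorem HypothesisH.mixedDifference_zeta (hM : HypothesisH M) {s : ℂ} (hs : s ∉ polarSet M)
    {x : Fin N → ℂ} (hx : x ∈ goodSet M) :
    mixedDifference (fun y => zeta M s (W M y)) x = (-1) ^ N * ∏ j, W M x j ^ (-s) := by
  have hX : ∀ y ∈ goodSet M, ∀ i, y + Pi.single i 1 ∈ goodSet M := fun y hy i =>
    hM.add_single_mem_goodSet hy i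
  have hconv : ∀ z : ℂ, abscissa M < z.re →
      mixedDifference (fun y => zeta M z (W M y)) x = (-1) ^ N * ∏ j, W M x j ^ (-z) := by
    intro z hz
    have hterm : ∀ (y : Fin N → ℂ) (k : Fin N → ℕ),
        ∏ j, W M (y + natVec k) j ^ (-z) = summand M z (W M y) fun i => k i := by
      intro y k
      simp [summand, W, natVec, add_mul, Finset.sum_add_distrib]
    refine mixedDifference_tsum (T := fun y => ∏ j, W M y j ^ (-z)) hX (fun y hy => ?_)
      (fun y hy => ?_) hx
    · simp only [hterm]
      exact (hM.summable_norm_summand hy hz).of_norm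
    · simp only [hterm]
      rw [← zetaSeries_eq]
      exact (hM.isMeromorphicContinuation_zeta hy).2 z hz
  have hmer : ∀ z₀ : ℂ, MeromorphicAt
      (fun z => mixedDifference (fun y => zeta M z (W M y)) x) z₀ := fun z₀ =>
    foldr_fwdDiff_induction (p := fun f => MeromorphicAt f z₀) (fun f g hf hg => hf.fun_sub hg)
      (F := fun z y => zeta M z (W M y)) hX
      (fun y hy => (hM.isMeromorphicContinuation_zeta hy).1.meromorphicOn z₀ (mem_univ z₀)) _ x hx
  have han : AnalyticAt ℂ (fun z => mixedDifference (fun y => zeta M z (W M y)) x) s :=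
    foldr_fwdDiff_induction (p := fun f => AnalyticAt ℂ f s) (fun f g hf hg => hf.fun_sub hg)
      (F := fun z y => zeta M z (W M y)) hX (fun y hy => hM.analyticAt_zeta hs hy) _ x hx
  have hdiff : Differentiable ℂ fun z : ℂ => (-1) ^ N * ∏ j, W M x j ^ (-z) := by
    refine Differentiable.const_mul (Differentiable.fun_finsetProd fun j _ => ?_) _
    have h : W M x j ≠ 0 := fun h => by
      have := hx j
      simp [h] at this
    exact fun s => (differentiableAt_id.neg).const_cpow (Or.inl h)
  have h := eventuallyEq_of_eq_halfPlane (a := s.re - 1) (fun z _ => hmer z)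
    (fun z _ => (hdiff.analyticAt z).meromorphicAt) hconv (z := s) (by linarith)
  exact ((han.meromorphicNFAt.eventuallyEq_nhdsNE_iff_eventuallyEq_nhds
    (hdiff.analyticAt s).meromorphicNFAt).1 h).eq_of_nhds

end ShintaniBarnes

/-! ### Derivatives of averages over the unit cube -/

namespace ShintaniBarnes

variable {N : ℕ}

/-- Replacing one coordinate by an independent copy preserves a product of probability measures. -/
theorem measurePreserving_update {ι : Type*} [Fintype ι] [DecidableEq ι] {α : Type*}
    [MeasurableSpace α] (ν : Measure α) [IsProbabilityMeasure ν] (i : ι) :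
    MeasurePreserving (fun q : α × (ι → α) => Function.update q.2 i q.1)
      (ν.prod (Measure.pi fun _ : ι => ν)) (Measure.pi fun _ : ι => ν) := by
  have hmeas : Measurable fun q : α × (ι → α) => Function.update q.2 i q.1 := by
    refine measurable_pi_iff.2 fun l => ?_
    by_cases h : l = i
    · subst h
      simpa using measurable_fst
    · simp only [Function.update_of_ne h]
      exact (measurable_pi_apply l).comp measurable_snd
  refine ⟨hmeas, (Measure.pi_eq fun s hs => ?_).symm⟩
  have hpre : (fun q : α × (ι → α) => Function.update q.2 i q.1) ⁻¹' univ.pi s =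
      s i ×ˢ univ.pi (Function.update s i univ) := by
    ext ⟨u, t⟩
    simp only [mem_preimage, mem_univ_pi, mem_prod]
    constructor
    · intro h
      refine ⟨by simpa using h i, fun l => ?_⟩
      by_cases hl : l = i
      · subst hl
        simp
      · simpa [hl] using h l
    · rintro ⟨h1, h2⟩ l
      by_cases hl : l = i
      · subst hl
        simpa using h1
      · simpa [hl] using h2 l
  rw [Measure.map_apply hmeas (MeasurableSet.univ_pi hs), hpre, Measure.prod_prod, Measure.pi_pi,
    ← Finset.mul_prod_erase Finset.univ _ (Finset.mem_univ i),
    ← Finset.mul_prod_erase Finset.univ (fun l => ν (s l)) (Finset.mem_univ i)]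
  rw [Function.update_self, measure_univ, one_mul]
  congr 1
  refine Finset.prod_congr rfl fun l hl => ?_
  rw [Function.update_of_ne (Finset.ne_of_mem_erase hl)]

theorem volume_restrict_Icc_zero_one (N : ℕ) :
    (volume : Measure (Fin N → ℝ)).restrict (Icc 0 1) =
      Measure.pi fun _ => (volume : Measure ℝ).restrict (Icc 0 1) := by
  rw [volume_pi, ← pi_univ_Icc, Measure.restrict_pi_pi]
  rfl

instance : IsProbabilityMeasure ((volume : Measure ℝ).restrict (Icc 0 1)) :=
  ⟨by simp⟩

/-- The vector with the entries of `t` at the places in `S`, and zeros elsewhere. -/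
noncomputable def maskVec (S : Finset (Fin N)) (t : Fin N → ℝ) : Fin N → ℂ :=
  fun i => ((if i ∈ S then t i else 0 : ℝ) : ℂ)

theorem continuous_maskVec (S : Finset (Fin N)) : Continuous (maskVec S) := by
  refine continuous_pi fun i => Complex.continuous_ofReal.comp ?_
  split_ifs
  · exact continuous_apply i
  · exact continuous_const

theorem maskVec_update {S : Finset (Fin N)} {i : Fin N} (hi : i ∉ S) (t : Fin N → ℝ) (u : ℝ) :
    maskVec (insert i S) (Function.update t i u) = Pi.single i (u : ℂ) + maskVec S t := by
  funext l
  by_cases h : l = i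
  · subst h
    simp [maskVec, hi]
  · simp [maskVec, h]

/-- The average of the translates of `f` by the real vectors in the unit cube in the
directions in `S`. -/
noncomputable def cubeAverage (S : Finset (Fin N)) (f : (Fin N → ℂ) → ℂ) (y : Fin N → ℂ) : ℂ :=
  ∫ t in Icc (0 : Fin N → ℝ) 1, f (y + maskVec S t)

theorem cubeAverage_empty (f : (Fin N → ℂ) → ℂ) (y : Fin N → ℂ) : cubeAverage ∅ f y = f y := by
  have hvol : (volume : Measure (Fin N → ℝ)).real (Icc 0 1) = 1 := by
    rw [Measure.real, Real.volume_Icc_pi]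
    simp
  have : ∀ t : Fin N → ℝ, maskVec ∅ t = 0 := fun t => by
    funext i
    simp [maskVec]
  simp [cubeAverage, this, hvol]

/-- `X` is stable under translation by real vectors with nonnegative entries. -/
def TranslationStable (X : Set (Fin N → ℂ)) : Prop :=
  ∀ y ∈ X, ∀ t : Fin N → ℝ, (∀ i, 0 ≤ t i) → (y + fun i => (t i : ℂ)) ∈ X

variable {X : Set (Fin N → ℂ)} {f : (Fin N → ℂ) → ℂ}

theorem add_maskVec_mem (hX : TranslationStable X) {y : Fin N → ℂ} (hy : y ∈ X) (S : Finset (Fin N)) {t : Fin N → ℝ}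
    (ht : t ∈ Icc (0 : Fin N → ℝ) 1) : y + maskVec S t ∈ X :=
  hX y hy (fun i => if i ∈ S then t i else 0) fun i => by
    split_ifs
    exacts [ht.1 i, le_rfl]

theorem add_single_mem (hX : TranslationStable X) {y : Fin N → ℂ} (hy : y ∈ X) (i : Fin N) {u : ℝ} (hu : 0 ≤ u) :
    y + Pi.single i (u : ℂ) ∈ X := by
  have := hX y hy (Pi.single i u) fun l => by
    by_cases h : l = i
    · subst h
      simpa using hu
    · simp [h]
  rwa [ofReal_single] at this

theorem continuousOn_translate (hX : TranslationStable X) (hf : ContinuousOn f X) {y : Fin N → ℂ} (hy : y ∈ X)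
    (S : Finset (Fin N)) :
    ContinuousOn (fun t : Fin N → ℝ => f (y + maskVec S t)) (Icc 0 1) :=
  hf.comp (continuous_const.add (continuous_maskVec S)).continuousOn
    fun _ ht => add_maskVec_mem hX hy S ht

theorem integrableOn_translate (hX : TranslationStable X) (hf : ContinuousOn f X) {y : Fin N → ℂ} (hy : y ∈ X)
    (S : Finset (Fin N)) :
    IntegrableOn (fun t : Fin N → ℝ => f (y + maskVec S t)) (Icc 0 1) :=
  (continuousOn_translate hX hf hy S).integrableOn_compact isCompact_Icc

/-- Fubini in the coordinate i. Overwriting that coordinate by an independent uniform variable keeps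
the index set Fin N, and `maskVec S` does not see the overwritten entry because i ∉ S. -/
theorem cubeAverage_insert (hX : TranslationStable X) (hf : ContinuousOn f X) {y : Fin N → ℂ} (hy : y ∈ X)
    {S : Finset (Fin N)} {i : Fin N} (hi : i ∉ S) :
    cubeAverage (insert i S) f y = ∫ u in (0 : ℝ)..1, cubeAverage S f (y + Pi.single i (u : ℂ)) := by
  have hint := integrableOn_translate hX hf hy (insert i S)
  have hmp := measurePreserving_update ((volume : Measure ℝ).restrict (Icc 0 1)) i
  rw [IntegrableOn, volume_restrict_Icc_zero_one] at hint
  have hint' := hmp.integrable_comp_of_integrable hint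
  rw [intervalIntegral.integral_of_le zero_le_one, ← integral_Icc_eq_integral_Ioc]
  simp only [cubeAverage, volume_restrict_Icc_zero_one]
  rw [← hmp.map_eq, integral_map hmp.measurable.aemeasurable
    (by rw [hmp.map_eq]; exact hint.aestronglyMeasurable), hmp.map_eq]
  refine (integral_prod _ hint').trans ?_
  simp only [Function.comp_apply, maskVec_update hi, add_assoc]

theorem differentiableOn_cubeAverage (hXo : IsOpen X) (hX : TranslationStable X)
    (hf : DifferentiableOn ℂ f X) (S : Finset (Fin N)) :
    DifferentiableOn ℂ (cubeAverage S f) X := by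
  refine differentiableOn_integral_of_compact isCompact_Icc measurableSet_Icc
    isCompact_Icc.measure_lt_top.ne hXo ?_ fun t ht => ?_
  · refine hf.continuousOn.comp
      (f := fun q : (Fin N → ℂ) × (Fin N → ℝ) => q.1 + maskVec S q.2)
      (continuous_fst.add ((continuous_maskVec S).comp continuous_snd)).continuousOn
      fun q hq => add_maskVec_mem hX hq.1 S hq.2
  · exact hf.comp (f := fun y : Fin N → ℂ => y + maskVec S t)
      (differentiable_id.add_const _).differentiableOn fun y hy => add_maskVec_mem hX hy S ht

/-- Along the real direction the average is the integral of φ from τ to τ + 1, with derivative φ(1)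
- φ(0) at τ = 0. The average is holomorphic, so its complex line derivative exists and equals this
real one. -/
theorem lineDeriv_cubeAverage_insert (hXo : IsOpen X) (hX : TranslationStable X)
    (hf : DifferentiableOn ℂ f X) {y : Fin N → ℂ} (hy : y ∈ X)
    {S : Finset (Fin N)} {i : Fin N} (hi : i ∉ S) :
    lineDeriv ℂ (cubeAverage (insert i S) f) y (Pi.single i 1) =
      cubeAverage S f (y + Pi.single i 1) - cubeAverage S f y := by
  -- An open, upward closed set of reals containing 0; it also contains the slightly negative τ
  -- needed for a two-sided derivative.
  set O : Set ℝ := {v | y + Pi.single i (v : ℂ) ∈ X} with hO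
  set φ : ℝ → ℂ := fun v => cubeAverage S f (y + Pi.single i (v : ℂ)) with hφ
  have hcont : Continuous fun v : ℝ => y + (Pi.single i (v : ℂ) : Fin N → ℂ) :=
    continuous_const.add ((continuous_single i).comp Complex.continuous_ofReal)
  have hOo : IsOpen O := hXo.preimage hcont
  have hOup : ∀ v ∈ O, ∀ v', v ≤ v' → v' ∈ O := by
    intro v hv v' hvv'
    have := add_single_mem hX hv i (sub_nonneg.2 hvv')
    rw [add_assoc, ← Pi.single_add] at this
    simpa [hO] using this
  have hO0 : (0 : ℝ) ∈ O := by simpa [hO] using hy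
  have hφc : ContinuousOn φ O :=
    (differentiableOn_cubeAverage hXo hX hf S).continuousOn.comp hcont.continuousOn fun v hv => hv
  have hφi : ∀ a ∈ O, ∀ b ∈ O, IntervalIntegrable φ volume a b := by
    intro a ha b hb
    refine (hφc.mono fun v hv => ?_).intervalIntegrable
    rcases le_total a b with h | h
    · exact hOup a ha v (by rw [uIcc_of_le h] at hv; exact hv.1)
    · exact hOup b hb v (by rw [uIcc_of_ge h] at hv; exact hv.1)
  have hprim : ∀ b ∈ O, HasDerivAt (fun b => ∫ v in (0 : ℝ)..b, φ v) (φ b) b := fun b hb =>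
    intervalIntegral.integral_hasDerivAt_right (hφi 0 hO0 b hb)
      (hφc.stronglyMeasurableAtFilter hOo b hb) (hφc.continuousAt (hOo.mem_nhds hb))
  have hO1 : (1 : ℝ) ∈ O := hOup 0 hO0 1 zero_le_one
  have h1 : HasDerivAt (fun τ : ℝ => (∫ v in (0 : ℝ)..(τ + 1), φ v) - ∫ v in (0 : ℝ)..τ, φ v)
      (φ 1 - φ 0) 0 := by
    refine HasDerivAt.fun_sub ?_ (hprim 0 hO0)
    refine HasDerivAt.comp_add_const (f := fun b => ∫ v in (0 : ℝ)..b, φ v) 0 1 ?_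
    rw [zero_add]
    exact hprim 1 hO1
  have hline : DifferentiableAt ℂ
      (fun τ : ℂ => cubeAverage (insert i S) f (y + τ • Pi.single i 1)) 0 := by
    refine DifferentiableAt.comp (g := cubeAverage (insert i S) f) (0 : ℂ) ?_ (by fun_prop)
    refine (differentiableOn_cubeAverage hXo hX hf _).differentiableAt (hXo.mem_nhds ?_)
    simpa using hy
  have h2 : HasDerivAt
      (fun τ : ℝ => cubeAverage (insert i S) f (y + (τ : ℂ) • Pi.single i 1))
      (lineDeriv ℂ (cubeAverage (insert i S) f) y (Pi.single i 1)) 0 := by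
    have h := hline.hasDerivAt
    rw [← Complex.ofReal_zero] at h
    exact h.comp_ofReal
  have h3 : (fun τ : ℝ => cubeAverage (insert i S) f (y + (τ : ℂ) • Pi.single i 1)) =ᶠ[𝓝 0]
      fun τ : ℝ => (∫ v in (0 : ℝ)..(τ + 1), φ v) - ∫ v in (0 : ℝ)..τ, φ v := by
    filter_upwards [hOo.mem_nhds hO0] with τ hτ
    have hsmul : ((τ : ℂ) • Pi.single i 1 : Fin N → ℂ) = Pi.single i (τ : ℂ) := by
      rw [← Pi.single_smul]
      simp
    have hτ1 : τ + 1 ∈ O := hOup τ hτ _ (by linarith)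
    rw [intervalIntegral.integral_interval_sub_left (hφi 0 hO0 _ hτ1) (hφi 0 hO0 τ hτ), hsmul,
      cubeAverage_insert hX hf.continuousOn hτ hi]
    have := intervalIntegral.integral_comp_add_left (a := 0) (b := 1) φ τ
    rw [add_zero] at this
    rw [← this]
    refine intervalIntegral.integral_congr fun u _ => ?_
    simp only [hφ, Complex.ofReal_add, Pi.single_add, add_assoc]
  have h4 := (h1.congr_of_eventuallyEq h3).unique h2
  rw [← h4]
  simp [hφ]

theorem differentiableOn_foldr_fwdDiff (hX : TranslationStable X) (hf : DifferentiableOn ℂ f X) (l : List (Fin N)) :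
    DifferentiableOn ℂ (l.foldr (fun i G => fwdDiff (Pi.single i 1) G) f) X := by
  induction l with
  | nil => exact hf
  | cons i l ih =>
    refine DifferentiableOn.fun_sub (ih.comp (f := fun y : Fin N → ℂ => y + Pi.single i 1)
      (differentiable_id.add_const _).differentiableOn fun y hy => ?_) ih
    simpa using add_single_mem hX hy i zero_le_one

/-- Each derivative removes its direction from the average and applies the corresponding difference
to f, which commutes with averaging over the remaining directions. Distinctness of the directions
guarantees that each one is still present when its turn comes. -/
theorem foldr_lineDeriv_cubeAverage (hXo : IsOpen X) (hX : TranslationStable X)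
    (hf : DifferentiableOn ℂ f X) {F : (Fin N → ℂ) → ℂ}
    (hF : ∀ y ∈ X, F y = cubeAverage Finset.univ f y) (l : List (Fin N)) : l.Nodup → ∀ y ∈ X,
      l.foldr (fun i G x => lineDeriv ℂ G x (Pi.single i 1)) F y =
        cubeAverage (Finset.univ \ l.toFinset) (l.foldr (fun i G => fwdDiff (Pi.single i 1) G) f) y := by
  induction l with
  | nil =>
    intro _ y hy
    simpa using hF y hy
  | cons i l ih =>
    intro hl y hy
    obtain ⟨hil, hl⟩ := List.nodup_cons.1 hl
    set B := l.foldr (fun i G => fwdDiff (Pi.single i 1) G) f with hB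
    have hBd : DifferentiableOn ℂ B X := differentiableOn_foldr_fwdDiff hX hf l
    set S : Finset (Fin N) := Finset.univ \ (i :: l).toFinset with hS
    have hiS : i ∉ S := by simp [hS]
    have hins : Finset.univ \ l.toFinset = insert i S := by
      ext m
      by_cases hm : m = i
      · subst hm
        simp [hil]
      · simp [hS, hm]
    rw [List.foldr_cons, List.foldr_cons]
    -- The next derivative depends on the germ at y, so the inductive identity is needed on a
    -- neighbourhood, which the open set X provides.
    have hev : l.foldr (fun i G x => lineDeriv ℂ G x (Pi.single i 1)) F =ᶠ[𝓝 y]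
        cubeAverage (insert i S) B := by
      filter_upwards [hXo.mem_nhds hy] with z hz
      rw [ih hl z hz, hins]
    rw [hev.lineDeriv_eq, lineDeriv_cubeAverage_insert hXo hX hBd hy hiS]
    have hy' : y + Pi.single i 1 ∈ X := by simpa using add_single_mem hX hy i zero_le_one
    rw [cubeAverage, cubeAverage, ← integral_sub
      (integrableOn_translate hX hBd.continuousOn hy' S)
      (integrableOn_translate hX hBd.continuousOn hy S), cubeAverage]
    refine integral_congr_ae (ae_of_all _ fun t => ?_)
    simp only [fwdDiff, add_right_comm, hB]

/-- Mixed partial derivatives of the average over the unit cube are iterated differences. -/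
theorem mixedPartial_cubeAverage (hXo : IsOpen X) (hX : TranslationStable X)
    (hf : DifferentiableOn ℂ f X) {F : (Fin N → ℂ) → ℂ}
    (hF : ∀ y ∈ X, F y = cubeAverage Finset.univ f y) {y : Fin N → ℂ} (hy : y ∈ X) :
    mixedPartial F y = mixedDifference f y := by
  rw [mixedPartial, foldr_lineDeriv_cubeAverage hXo hX hf hF _ (List.nodup_finRange N) y hy,
    mixedDifference]
  have : (Finset.univ : Finset (Fin N)) \ (List.finRange N).toFinset = ∅ := by
    ext m
    simp
  rw [this, cubeAverage_empty]

end ShintaniBarnes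

/-! ### The theorem -/

theorem proposition4p1 {N n : ℕ} (M : Matrix (Fin N) (Fin n) ℂ)
    (hM : ShintaniBarnes.HypothesisH M)
    (s : ℂ) (hs : s ∉ ShintaniBarnes.polarSet M)
    (x : Fin N → ℂ) (hx : ∀ i, 0 < (x i).re)
    (hW : ∀ j, 0 < (ShintaniBarnes.W M x j).re) :
    -- both functions are regular at `s`, so that their values there are meaningful
    (AnalyticAt ℂ (fun z => ShintaniBarnes.zeta M z (ShintaniBarnes.W M x)) s ∧
      AnalyticAt ℂ (fun z => ShintaniBarnes.zetaInt M z (ShintaniBarnes.W M x)) s) ∧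
    -- the Raabe formula
    (MeasureTheory.IntegrableOn
        (fun t : Fin N → ℝ =>
          ShintaniBarnes.zeta M s (ShintaniBarnes.W M fun i => x i + (t i : ℂ)))
        (Set.Icc 0 1) ∧
      ∫ t : Fin N → ℝ in Set.Icc 0 1,
          ShintaniBarnes.zeta M s (ShintaniBarnes.W M fun i => x i + (t i : ℂ)) =
        ShintaniBarnes.zetaInt M s (ShintaniBarnes.W M x)) ∧
    -- the mixed partial derivative; analyticity near `x` makes all the partial derivatives exist
    (AnalyticAt ℂ (fun y => ShintaniBarnes.zetaInt M s (ShintaniBarnes.W M y)) x ∧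
      ShintaniBarnes.mixedPartial
          (fun y => ShintaniBarnes.zetaInt M s (ShintaniBarnes.W M y)) x =
        ShintaniBarnes.mixedDifference
          (fun y => ShintaniBarnes.zeta M s (ShintaniBarnes.W M y)) x ∧
      ShintaniBarnes.mixedDifference
          (fun y => ShintaniBarnes.zeta M s (ShintaniBarnes.W M y)) x =
        (-1) ^ N * ∏ j, (∑ i, x i * M i j) ^ (-s) ∧
      (-1) ^ N * ∏ j, (∑ i, x i * M i j) ^ (-s) =
        (-1) ^ N * ShintaniBarnes.zetaZero s (ShintaniBarnes.W M x)) := by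
  have hgood : x ∈ ShintaniBarnes.goodSet M := hW
  have hstable : ShintaniBarnes.TranslationStable (ShintaniBarnes.goodSet M) :=
    fun y hy t ht => hM.add_mem_goodSet hy ht
  obtain ⟨U, hU, hsU, hd⟩ := hM.exists_differentiableOn_zeta hs
  have hzeta : DifferentiableOn ℂ (fun y => ShintaniBarnes.zeta M s (ShintaniBarnes.W M y))
      (ShintaniBarnes.goodSet M) :=
    hd.comp (f := fun y => (s, ShintaniBarnes.W M y))
      ((differentiable_const s).prodMk ShintaniBarnes.differentiable_W).differentiableOn
      fun y hy => ⟨hsU, hy⟩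
  have hmask : ∀ (y : Fin N → ℂ) (t : Fin N → ℝ),
      y + ShintaniBarnes.maskVec Finset.univ t = fun i => y i + (t i : ℂ) := fun y t => by
    funext i
    simp [ShintaniBarnes.maskVec]
  have hraabe : ∀ y ∈ ShintaniBarnes.goodSet M, ShintaniBarnes.zetaInt M s (ShintaniBarnes.W M y) =
      ShintaniBarnes.cubeAverage Finset.univ
        (fun y => ShintaniBarnes.zeta M s (ShintaniBarnes.W M y)) y := fun y hy => by
    rw [(hM.analyticAt_zetaInt_and_eq hs hy).2, ShintaniBarnes.cubeAverage]
    simp only [hmask, ShintaniBarnes.W_add]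
  refine ⟨⟨hM.analyticAt_zeta hs hW, (hM.analyticAt_zetaInt_and_eq hs hW).1⟩, ⟨?_, ?_⟩, ?_, ?_, ?_, rfl⟩
  · have h := ShintaniBarnes.integrableOn_translate hstable hzeta.continuousOn hgood Finset.univ
    simpa only [hmask] using h
  · rw [hraabe x hgood, ShintaniBarnes.cubeAverage]
    simp only [hmask]
  · refine (ShintaniBarnes.analyticAt_of_differentiableOn ShintaniBarnes.isOpen_goodSet
      (ShintaniBarnes.differentiableOn_cubeAverage ShintaniBarnes.isOpen_goodSet hstable hzeta
        Finset.univ) hgood).congr ?_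
    filter_upwards [ShintaniBarnes.isOpen_goodSet.mem_nhds hgood] with y hy
    exact (hraabe y hy).symm
  · exact ShintaniBarnes.mixedPartial_cubeAverage ShintaniBarnes.isOpen_goodSet hstable hzeta hraabe
      hgood
  · exact hM.mixedDifference_zeta hs hgood
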